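/- Let $\theta$ be an irrational real number and $\lambda=e^{2\pi i\theta}$. Let $\mathcal A_\theta=\{\sum_{m,n\in\mathbb Z}a_{mn}u^mv^n : (a_{mn})\in\mathcal S(\mathbb Z^2)\}$ be the smooth noncommutative torus, with $u,v$ invertible and $uv=\lambda vu$, and let $\Omega\mathcal A_\theta=\Omega^0\oplus\Omega^1\oplus\Omega^2$ be its differential graded algebra (dga) of forms: $\Omega^0=\mathcal A_\theta$, $\Omega^1=\{a\,du+b\,dv\}$, $\Omega^2=\{a\,du\,dv\}$ with $a,b\in\mathcal A_\theta$, where $u\,du=du\,u$, $u\,dv=\lambda\,dv\,u$, $v\,du=\bar\lambda\,du\,v$, $v\,dv=dv\,v$, $du\,dv=-\lambda\,dv\,du$ and $(du)^2=(dv)^2=0$. The torus $\mathbb T^2$ acts on $\Omega\mathcal A_\theta$ by dga automorphisms with $\alpha_t(u^mv^n)=e^{i(mt_1+nt_2)}u^mv^n$. For a graded bimodule $\Omega\mathcal E$ over a dga $\Omega\mathcal A$ put $Z_g(\Omega\mathcal E)=\{\epsilon : \epsilon\nu=(-1)^{|\epsilon||\nu|}\nu\epsilon \text{ for all }\nu\in\Omega\mathcal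 A\}$ (extended bilinearly), the graded centre, and let $Z_g(\mathcal E)$ be its degree $0$ part. Let $\mathcal C_\flat(\Omega\mathcal A)$ be the tensor category of graded $\Omega\mathcal A$-bimodules $\Omega\mathcal E$ that are direct summands of some $\Omega\mathcal A^n$ (as graded bimodules), equipped with a $\mathbb C$-linear map $\nabla:\Omega\mathcal E\to\Omega\mathcal E$ of degree $1$ satisfying the left and right graded Leibniz rules and $\nabla^2=0$; the tensor product is $\otimes_{\Omega\mathcal A}$ with $\nabla(\epsilon\otimes\zeta)=\nabla\epsilon\otimes\zeta+(-1)^{|\epsilon|}\epsilon\otimes\nabla\zeta$ and the unit is $(\Omega\mathcal A,d)$. For a character $p$ of $Z_g(\mathcal A)$, $\pi^1(\Omega\mathcal A,p)$ is the group scheme over $\mathbb C$ of tensor automorphisms of the fibre functor $\Omega\mathcal E\mapsto Z_g(\mathcal E)\otimes_{Z_g(\mathcal A)}\mathbb C_p$ on $\mathcal C_\flat(\Omega\mathcal A)$. The algebraic hull of a topological group $K$ is the group scheme of tensor automorphisms of the forgetful functor on the category of continuous representations of $K$ on finite-dimensional complex vector spaces. Then: 1. The centre of $\mathcal A_\theta$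 is $\mathbb C$, and $Z_g(\mathcal A_\theta)=\mathbb C$. 2. $Z_g(\Omega\mathcal A_\theta)=(\Omega\mathcal A_\theta)^{\mathbb T^2}$. The forms $u^{-1}du$ and $v^{-1}dv$ are linearly independent, and, with $V$ their complex span, the inclusion $V\subset\Omega^1\mathcal A_\theta$ extends to an injective algebra homomorphism $\bigwedge V\to\Omega\mathcal A_\theta$ with image $Z_g(\Omega\mathcal A_\theta)$, mapping $\bigwedge^kV$ onto $Z_g(\Omega\mathcal A_\theta)\cap\Omega^k\mathcal A_\theta$ for all $k\ge 0$; moreover $d=0$ on $Z_g(\Omega\mathcal A_\theta)$. Thus $Z_g(\Omega\mathcal A_\theta)\cong\bigwedge V$ as dga's, with $d=0$ on $\bigwedge V$. 3. There is exactly one base point $p$, and $\pi^1(\Omega\mathcal A_\theta,p)$ is an affine group scheme isomorphic to the algebraic hull of the topological group $\mathbb R^2$. -/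

import Mathlib

open scoped TensorProduct ExteriorAlgebra
open CategoryTheory

noncomputable section

/-! ## The noncommutative torus -/

namespace NCTorus

/-- The weight `1 + |m| + |n|` on `ℤ²`. -/
def weight (x : ℤ × ℤ) : ℝ := 1 + |(x.1 : ℝ)| + |(x.2 : ℝ)|

lemma one_le_weight (x : ℤ × ℤ) : 1 ≤ weight x := by
  unfold weight; linarith [abs_nonneg (x.1 : ℝ), abs_nonneg (x.2 : ℝ)]

lemma weight_pos (x : ℤ × ℤ) : 0 < weight x := lt_of_lt_of_le one_pos (one_le_weight x)

lemma weight_add_le (x y : ℤ × ℤ) : weight (x + y) ≤ weight x * weight y := by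
  have h1 := abs_add_le (x.1 : ℝ) y.1
  have h2 := abs_add_le (x.2 : ℝ) y.2
  have := abs_nonneg (x.1 : ℝ)
  have := abs_nonneg (x.2 : ℝ)
  have := abs_nonneg (y.1 : ℝ)
  have := abs_nonneg (y.2 : ℝ)
  simp only [weight, Prod.fst_add, Prod.snd_add, Int.cast_add]
  have : 0 ≤ (|(x.1 : ℝ)| + |(x.2 : ℝ)|) * (|(y.1 : ℝ)| + |(y.2 : ℝ)|) := by positivity
  nlinarith

/-- The Schwartz space `𝒮(ℤ²)` of rapidly decreasing double sequences. -/
def schwartz : Submodule ℂ (ℤ × ℤ → ℂ) where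
  carrier := {a | ∀ k : ℕ, ∃ C : ℝ, ∀ x, weight x ^ k * ‖a x‖ ≤ C}
  zero_mem' := fun k => ⟨0, fun x => by simp⟩
  add_mem' := by
    intro a b ha hb k
    obtain ⟨C, hC⟩ := ha k
    obtain ⟨D, hD⟩ := hb k
    refine ⟨C + D, fun x => ?_⟩
    have hw : 0 ≤ weight x ^ k := (pow_pos (weight_pos x) k).le
    calc weight x ^ k * ‖a x + b x‖ ≤ weight x ^ k * (‖a x‖ + ‖b x‖) := by
          gcongr; exact norm_add_le _ _
      _ ≤ C + D := by rw [mul_add]; exact add_le_add (hC x) (hD x)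
  smul_mem' := by
    intro c a ha k
    obtain ⟨C, hC⟩ := ha k
    refine ⟨‖c‖ * C, fun x => ?_⟩
    have := mul_le_mul_of_nonneg_left (hC x) (norm_nonneg c)
    simp only [Pi.smul_apply, norm_smul]
    linarith [mul_left_comm (weight x ^ k) ‖c‖ ‖a x‖]

lemma summable_weight : Summable fun x : ℤ × ℤ => (weight x ^ 4)⁻¹ := by
  have h1 : Summable fun m : ℤ => ((1 + |(m : ℝ)|) ^ 2)⁻¹ := by
    have h2 : Summable fun m : ℤ => 1 / |(m : ℝ) + 0| ^ (2 : ℝ) :=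
      (Real.summable_one_div_int_add_rpow 0 2).2 (by norm_num)
    refine Summable.of_norm_bounded_eventually h2 ?_
    rw [Filter.eventually_cofinite]
    refine (Set.finite_singleton (0 : ℤ)).subset fun m hm => ?_
    by_contra hne
    apply hm
    have hpos : 0 < |(m : ℝ)| := abs_pos.2 (by exact_mod_cast hne)
    have e : ((2 : ℝ)) = ((2 : ℕ) : ℝ) := by norm_num
    rw [add_zero, e, Real.rpow_natCast, one_div, Real.norm_of_nonneg (by positivity)]
    apply inv_anti₀ (by positivity)
    gcongr
    linarith
  refine Summable.of_nonneg_of_le (fun x => ?_) (fun x => ?_)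
    (h1.mul_of_nonneg h1 (fun _ => by positivity) (fun _ => by positivity))
  · have := weight_pos x; positivity
  · rw [← mul_inv]
    apply inv_anti₀ (by positivity)
    rw [← mul_pow]
    have h3 : (1 + |(x.1 : ℝ)|) * (1 + |(x.2 : ℝ)|) ≤ weight x ^ 2 := by
      unfold weight
      nlinarith [abs_nonneg (x.1 : ℝ), abs_nonneg (x.2 : ℝ),
        mul_nonneg (abs_nonneg (x.1 : ℝ)) (abs_nonneg (x.2 : ℝ))]
    calc ((1 + |(x.1 : ℝ)|) * (1 + |(x.2 : ℝ)|)) ^ 2 ≤ (weight x ^ 2) ^ 2 := by gcongr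
      _ = weight x ^ 4 := by ring

lemma summable_of_schwartz {a : ℤ × ℤ → ℂ} (ha : a ∈ schwartz) (k : ℕ) :
    Summable fun x => weight x ^ k * ‖a x‖ := by
  obtain ⟨C, hC⟩ := ha (k + 4)
  refine Summable.of_nonneg_of_le (fun x => ?_) (fun x => ?_) (summable_weight.mul_left C)
  · have := weight_pos x; positivity
  · have hw := weight_pos x
    have h4 : 0 < weight x ^ 4 := by positivity
    rw [← div_eq_mul_inv, le_div_iff₀ h4]
    calc _ = weight x ^ (k + 4) * ‖a x‖ := by ring
      _ ≤ C := hC x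

lemma summable_norm {a : ℤ × ℤ → ℂ} (ha : a ∈ schwartz) : Summable fun x => ‖a x‖ := by
  simpa using summable_of_schwartz ha 0

lemma bounded_of_schwartz {a : ℤ × ℤ → ℂ} (ha : a ∈ schwartz) : ∃ C, ∀ x, ‖a x‖ ≤ C := by
  simpa using ha 0

/-- The phase `λ^{-nm'}` in `(u^m v^n)(u^{m'} v^{n'}) = λ^{-nm'} u^{m+m'} v^{n+n'}`, where
`λ = e^{2πiθ}` and `uv = λvu`. -/
def cocycle (θ : ℝ) (x y : ℤ × ℤ) : ℂ :=
  Complex.exp (2 * Real.pi * Complex.I * θ * (-(x.2 * y.1 : ℤ) : ℂ))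

lemma norm_cocycle (θ : ℝ) (x y : ℤ × ℤ) : ‖cocycle θ x y‖ = 1 := by
  unfold cocycle
  rw [show (2 * Real.pi * Complex.I * θ * (-(x.2 * y.1 : ℤ) : ℂ)) =
    ((2 * Real.pi * θ * (-(x.2 * y.1 : ℤ) : ℝ) : ℝ) : ℂ) * Complex.I by push_cast; ring]
  exact Complex.norm_exp_ofReal_mul_I _

lemma cocycle_assoc (θ : ℝ) (x y z : ℤ × ℤ) :
    cocycle θ x y * cocycle θ (x + y) z = cocycle θ y z * cocycle θ x (y + z) := by
  unfold cocycle
  rw [← Complex.exp_add, ← Complex.exp_add]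
  congr 1
  simp only [Prod.fst_add, Prod.snd_add]
  push_cast
  ring

@[simp] lemma cocycle_zero_left (θ : ℝ) (y : ℤ × ℤ) : cocycle θ 0 y = 1 := by simp [cocycle]

@[simp] lemma cocycle_zero_right (θ : ℝ) (x : ℤ × ℤ) : cocycle θ x 0 = 1 := by simp [cocycle]

/-- The coefficients of the product `(∑ a_x u^{x₁} v^{x₂}) (∑ b_y u^{y₁} v^{y₂})`. -/
def conv (θ : ℝ) (a b : ℤ × ℤ → ℂ) (z : ℤ × ℤ) : ℂ :=
  ∑' x, a x * b (z - x) * cocycle θ x (z - x)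

lemma summable_conv (θ : ℝ) {a b : ℤ × ℤ → ℂ} (ha : a ∈ schwartz) (hb : b ∈ schwartz)
    (z : ℤ × ℤ) : Summable fun x => a x * b (z - x) * cocycle θ x (z - x) := by
  obtain ⟨C, hC⟩ := bounded_of_schwartz hb
  refine Summable.of_norm_bounded ((summable_norm ha).mul_right C) fun x => ?_
  rw [norm_mul, norm_mul, norm_cocycle, mul_one]
  gcongr
  exact hC _

lemma conv_mem (θ : ℝ) {a b : ℤ × ℤ → ℂ} (ha : a ∈ schwartz) (hb : b ∈ schwartz) :
    conv θ a b ∈ schwartz := by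
  intro k
  obtain ⟨C, hC⟩ := hb k
  refine ⟨∑' x, weight x ^ k * ‖a x‖ * C, fun z => ?_⟩
  have hs := (summable_of_schwartz ha k).mul_right C
  have hn := (summable_conv θ ha hb z).norm
  have hw : 0 ≤ weight z ^ k := (pow_pos (weight_pos z) k).le
  calc weight z ^ k * ‖conv θ a b z‖
      ≤ weight z ^ k * ∑' x, ‖a x * b (z - x) * cocycle θ x (z - x)‖ := by
        gcongr; exact norm_tsum_le_tsum_norm hn
    _ = ∑' x, weight z ^ k * ‖a x * b (z - x) * cocycle θ x (z - x)‖ := tsum_mul_left.symm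
    _ ≤ ∑' x, weight x ^ k * ‖a x‖ * C := by
        refine (hn.mul_left _).tsum_le_tsum (fun x => ?_) hs
        rw [norm_mul, norm_mul, norm_cocycle, mul_one]
        have h1 : weight z ^ k ≤ weight x ^ k * weight (z - x) ^ k := by
          rw [← mul_pow]
          have := weight_add_le x (z - x)
          rw [add_sub_cancel] at this
          exact pow_le_pow_left₀ (weight_pos z).le this k
        have := weight_pos x
        calc weight z ^ k * (‖a x‖ * ‖b (z - x)‖)
            ≤ (weight x ^ k * weight (z - x) ^ k) * (‖a x‖ * ‖b (z - x)‖) := by gcongr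
          _ = weight x ^ k * ‖a x‖ * (weight (z - x) ^ k * ‖b (z - x)‖) := by ring
          _ ≤ weight x ^ k * ‖a x‖ * C := by gcongr; exact hC _

lemma conv_assoc (θ : ℝ) {a b c : ℤ × ℤ → ℂ} (ha : a ∈ schwartz) (hb : b ∈ schwartz)
    (hc : c ∈ schwartz) : conv θ (conv θ a b) c = conv θ a (conv θ b c) := by
  funext z
  let F : ℤ × ℤ → ℤ × ℤ → ℂ := fun x y =>
    a y * b (x - y) * cocycle θ y (x - y) * (c (z - x) * cocycle θ x (z - x))
  have hF : Summable (Function.uncurry F) := by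
    obtain ⟨C, hC⟩ := bounded_of_schwartz hc
    let e : (ℤ × ℤ) × (ℤ × ℤ) ≃ (ℤ × ℤ) × (ℤ × ℤ) :=
      { toFun := fun p => (p.2, p.1 - p.2)
        invFun := fun p => (p.1 + p.2, p.1)
        left_inv := fun p => by simp
        right_inv := fun p => by simp }
    have h1 : Summable fun p : (ℤ × ℤ) × (ℤ × ℤ) => ‖a p.1‖ * ‖b p.2‖ :=
      (summable_norm ha).mul_of_nonneg (summable_norm hb) (fun _ => norm_nonneg _)
        (fun _ => norm_nonneg _)
    have h2 : Summable fun p : (ℤ × ℤ) × (ℤ × ℤ) => ‖a p.2‖ * ‖b (p.1 - p.2)‖ * C :=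
      ((e.summable_iff).2 h1).mul_right C
    refine Summable.of_norm_bounded h2 fun p => ?_
    simp only [Function.uncurry, F, norm_mul, norm_cocycle, mul_one]
    gcongr
    exact hC _
  have hl : conv θ (conv θ a b) c z = ∑' x, ∑' y, F x y := by
    unfold conv
    refine tsum_congr fun x => ?_
    rw [mul_assoc, ← tsum_mul_right]
  rw [hl, ← Summable.tsum_comm hF]
  refine tsum_congr fun y => ?_
  have hr : a y * conv θ b c (z - y) * cocycle θ y (z - y) =
      ∑' w, a y * (b w * c (z - y - w) * cocycle θ w (z - y - w)) * cocycle θ y (z - y) := by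
    unfold conv
    rw [← tsum_mul_left, ← tsum_mul_right]
  rw [hr, ← (Equiv.subRight y).tsum_eq
    fun w => a y * (b w * c (z - y - w) * cocycle θ w (z - y - w)) * cocycle θ y (z - y)]
  refine tsum_congr fun x => ?_
  simp only [Equiv.subRight_apply, F]
  have h := cocycle_assoc θ y (x - y) (z - x)
  have e1 : y + (x - y) = x := by abel
  have e2 : x - y + (z - x) = z - y := by abel
  have e3 : z - y - (x - y) = z - x := by abel
  rw [e1, e2] at h
  rw [e3]
  linear_combination (a y * b (x - y) * c (z - x)) * h

lemma conv_add (θ : ℝ) {a b c : ℤ × ℤ → ℂ} (ha : a ∈ schwartz) (hb : b ∈ schwartz)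
    (hc : c ∈ schwartz) : conv θ a (b + c) = conv θ a b + conv θ a c := by
  funext z
  simp only [conv, Pi.add_apply]
  rw [← (summable_conv θ ha hb z).tsum_add (summable_conv θ ha hc z)]
  exact tsum_congr fun x => by ring

lemma add_conv (θ : ℝ) {a b c : ℤ × ℤ → ℂ} (ha : a ∈ schwartz) (hb : b ∈ schwartz)
    (hc : c ∈ schwartz) : conv θ (a + b) c = conv θ a c + conv θ b c := by
  funext z
  simp only [conv, Pi.add_apply]
  rw [← (summable_conv θ ha hc z).tsum_add (summable_conv θ hb hc z)]
  exact tsum_congr fun x => by ring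

lemma single_mem (x : ℤ × ℤ) : (Pi.single x 1 : ℤ × ℤ → ℂ) ∈ schwartz := by
  intro k
  refine ⟨weight x ^ k, fun y => ?_⟩
  rcases eq_or_ne y x with rfl | h
  · simp
  · simp [Pi.single_eq_of_ne h, (pow_pos (weight_pos x) k).le]

lemma one_conv (θ : ℝ) (a : ℤ × ℤ → ℂ) : conv θ (Pi.single 0 1) a = a := by
  funext z
  unfold conv
  rw [tsum_eq_single 0 fun x hx => by simp [Pi.single_eq_of_ne hx]]
  simp

lemma conv_one (θ : ℝ) (a : ℤ × ℤ → ℂ) : conv θ a (Pi.single 0 1) = a := by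
  funext z
  unfold conv
  rw [tsum_eq_single z fun x hx => by
    rw [Pi.single_eq_of_ne (sub_ne_zero.2 hx.symm)]; simp]
  simp

/-- The smooth noncommutative torus `𝒜_θ`: the series `∑ a_{mn} u^m v^n` with `(a_{mn}) ∈ 𝒮(ℤ²)`,
where `uv = e^{2πiθ} vu`. An element is given by its sequence of coefficients. -/
def Alg (_θ : ℝ) : Type := schwartz

variable {θ : ℝ}

namespace Alg

instance : AddCommGroup (Alg θ) := inferInstanceAs (AddCommGroup schwartz)
instance : Module ℂ (Alg θ) := inferInstanceAs (Module ℂ schwartz)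

/-- The coefficient `a_{mn}`. -/
def coeff (a : Alg θ) : ℤ × ℤ → ℂ := a.1

lemma coeff_mem (a : Alg θ) : a.coeff ∈ schwartz := a.2

@[ext] lemma ext {a b : Alg θ} (h : a.coeff = b.coeff) : a = b := Subtype.ext h

/-- The element with prescribed coefficients. -/
def mk (θ : ℝ) (a : ℤ × ℤ → ℂ) (ha : a ∈ schwartz) : Alg θ := ⟨a, ha⟩

@[simp] lemma coeff_mk (a : ℤ × ℤ → ℂ) (ha : a ∈ schwartz) : (mk θ a ha).coeff = a := rfl
@[simp] lemma coeff_add (a b : Alg θ) : (a + b).coeff = a.coeff + b.coeff := rfl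
@[simp] lemma coeff_zero : (0 : Alg θ).coeff = 0 := rfl
@[simp] lemma coeff_smul (c : ℂ) (a : Alg θ) : (c • a).coeff = c • a.coeff := rfl

/-- The monomial `u^m v^n`. -/
def mono (θ : ℝ) (m n : ℤ) : Alg θ := mk θ (Pi.single (m, n) 1) (single_mem _)

instance : Mul (Alg θ) := ⟨fun a b => mk θ (conv θ a.coeff b.coeff) (conv_mem θ a.2 b.2)⟩
instance : One (Alg θ) := ⟨mk θ (Pi.single 0 1) (single_mem _)⟩

@[simp] lemma coeff_mul (a b : Alg θ) : (a * b).coeff = conv θ a.coeff b.coeff := rfl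
@[simp] lemma coeff_one : (1 : Alg θ).coeff = Pi.single 0 1 := rfl

instance : Ring (Alg θ) where
  __ := (inferInstance : AddCommGroup (Alg θ))
  mul_assoc a b c := ext (conv_assoc θ a.2 b.2 c.2)
  one_mul a := ext (one_conv θ _)
  mul_one a := ext (conv_one θ _)
  left_distrib a b c := ext (conv_add θ a.2 b.2 c.2)
  right_distrib a b c := ext (add_conv θ a.2 b.2 c.2)
  zero_mul a := ext (by funext z; simp [conv])
  mul_zero a := ext (by funext z; simp [conv])

instance : Algebra ℂ (Alg θ) := Algebra.ofModule
  (fun c a b => ext (by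
    funext z
    simp only [coeff_mul, coeff_smul, conv, Pi.smul_apply, smul_eq_mul]
    rw [← tsum_mul_left]
    exact tsum_congr fun x => by ring))
  (fun c a b => ext (by
    funext z
    simp only [coeff_mul, coeff_smul, conv, Pi.smul_apply, smul_eq_mul]
    rw [← tsum_mul_left]
    exact tsum_congr fun x => by ring))

lemma deriv_mem (χ : ℤ × ℤ →+ ℤ) (hχ : ∀ x, |(χ x : ℝ)| ≤ weight x) (a : Alg θ) :
    (fun x => (χ x : ℂ) * a.coeff x) ∈ schwartz := by
  intro k
  obtain ⟨C, hC⟩ := a.coeff_mem (k + 1)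
  refine ⟨C, fun x => le_trans ?_ (hC x)⟩
  have hw := weight_pos x
  rw [norm_mul, Complex.norm_intCast, pow_succ, mul_assoc]
  gcongr
  exact hχ x

/-- The derivation of `𝒜_θ` with `u^m v^n ↦ χ(m,n) u^m v^n`, for an additive map `χ` of at most
linear growth. -/
def deriv (χ : ℤ × ℤ →+ ℤ) (hχ : ∀ x, |(χ x : ℝ)| ≤ weight x) : Alg θ →ₗ[ℂ] Alg θ where
  toFun a := mk θ (fun x => χ x * a.coeff x) (deriv_mem χ hχ a)
  map_add' a b := ext (by funext x; simp [mul_add])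
  map_smul' c a := ext (by funext x; simp [mul_left_comm])

@[simp] lemma coeff_deriv (χ : ℤ × ℤ →+ ℤ) (hχ : ∀ x, |(χ x : ℝ)| ≤ weight x) (a : Alg θ)
    (x : ℤ × ℤ) : (deriv χ hχ a).coeff x = χ x * a.coeff x := rfl

lemma deriv_mul (χ : ℤ × ℤ →+ ℤ) (hχ : ∀ x, |(χ x : ℝ)| ≤ weight x) (a b : Alg θ) :
    deriv χ hχ (a * b) = deriv χ hχ a * b + a * deriv χ hχ b := by
  ext z
  have h1 := summable_conv θ (deriv χ hχ a).coeff_mem b.coeff_mem z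
  have h2 := summable_conv θ a.coeff_mem (deriv χ hχ b).coeff_mem z
  simp only [coeff_mul, coeff_add, Pi.add_apply]
  change (χ z : ℂ) * conv θ a.coeff b.coeff z = _
  unfold conv
  rw [← h1.tsum_add h2, ← tsum_mul_left]
  refine tsum_congr fun x => ?_
  simp only [coeff_deriv]
  have : (χ z : ℂ) = χ x + χ (z - x) := by rw [← Int.cast_add, ← map_add, add_sub_cancel]
  rw [this]
  ring

lemma deriv_comm (χ ψ : ℤ × ℤ →+ ℤ) (hχ : ∀ x, |(χ x : ℝ)| ≤ weight x)
    (hψ : ∀ x, |(ψ x : ℝ)| ≤ weight x) (a : Alg θ) :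
    deriv χ hχ (deriv ψ hψ a) = deriv ψ hψ (deriv χ hχ a) := by
  ext x
  simp [mul_left_comm]

/-- `δ₁ (u^m v^n) = m u^m v^n`. -/
def δ₁ : Alg θ →ₗ[ℂ] Alg θ := deriv (AddMonoidHom.fst ℤ ℤ) fun x => by
  simp only [AddMonoidHom.coe_fst, weight]; linarith [abs_nonneg (x.2 : ℝ)]

/-- `δ₂ (u^m v^n) = n u^m v^n`. -/
def δ₂ : Alg θ →ₗ[ℂ] Alg θ := deriv (AddMonoidHom.snd ℤ ℤ) fun x => by
  simp only [AddMonoidHom.coe_snd, weight]; linarith [abs_nonneg (x.1 : ℝ)]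

lemma δ₁_mul (a b : Alg θ) : δ₁ (a * b) = δ₁ a * b + a * δ₁ b := deriv_mul _ _ _ _
lemma δ₂_mul (a b : Alg θ) : δ₂ (a * b) = δ₂ a * b + a * δ₂ b := deriv_mul _ _ _ _
lemma δ₁_δ₂ (a : Alg θ) : δ₁ (δ₂ a) = δ₂ (δ₁ a) := deriv_comm _ _ _ _ _

lemma rot_mem (t : ℝ × ℝ) (a : Alg θ) :
    (fun x : ℤ × ℤ => Complex.exp ((x.1 * t.1 + x.2 * t.2 : ℝ) * Complex.I) * a.coeff x)
      ∈ schwartz := by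
  intro k
  obtain ⟨C, hC⟩ := a.coeff_mem k
  refine ⟨C, fun x => le_trans (le_of_eq ?_) (hC x)⟩
  rw [norm_mul, Complex.norm_exp_ofReal_mul_I, one_mul]

/-- The action `α` of `𝕋²` on `𝒜_θ` by automorphisms, `α_t (u^m v^n) = e^{i(m t₁ + n t₂)} u^m v^n`,
with `t ∈ ℝ²` representing a point of `𝕋² = ℝ² / 2πℤ²`. -/
def rot (t : ℝ × ℝ) : Alg θ →ₐ[ℂ] Alg θ := AlgHom.ofLinearMap
  { toFun := fun a => mk θ
      (fun x => Complex.exp ((x.1 * t.1 + x.2 * t.2 : ℝ) * Complex.I) * a.coeff x) (rot_mem t a)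
    map_add' := fun a b => ext (by funext x; simp [mul_add])
    map_smul' := fun c a => ext (by funext x; simp [mul_left_comm]) }
  (by
    ext x
    rcases eq_or_ne x 0 with rfl | h
    · simp
    · simp [Pi.single_eq_of_ne h])
  (by
    intro a b
    ext z
    simp only [LinearMap.coe_mk, AddHom.coe_mk, coeff_mk, coeff_mul, conv]
    rw [← tsum_mul_left]
    refine tsum_congr fun x => ?_
    have : Complex.exp ((z.1 * t.1 + z.2 * t.2 : ℝ) * Complex.I) =
        Complex.exp ((x.1 * t.1 + x.2 * t.2 : ℝ) * Complex.I) *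
        Complex.exp (((z - x).1 * t.1 + (z - x).2 * t.2 : ℝ) * Complex.I) := by
      rw [← Complex.exp_add]
      congr 1
      simp only [Prod.fst_sub, Prod.snd_sub]
      push_cast
      ring
    rw [this]
    ring)

@[simp] lemma coeff_rot (t : ℝ × ℝ) (a : Alg θ) (x : ℤ × ℤ) : (rot t a).coeff x =
    Complex.exp ((x.1 * t.1 + x.2 * t.2 : ℝ) * Complex.I) * a.coeff x := rfl

lemma rot_δ₁ (t : ℝ × ℝ) (a : Alg θ) : rot t (δ₁ a) = δ₁ (rot t a) := by
  ext x
  simp [δ₁, mul_left_comm]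

lemma rot_δ₂ (t : ℝ × ℝ) (a : Alg θ) : rot t (δ₂ a) = δ₂ (rot t a) := by
  ext x
  simp [δ₂, mul_left_comm]

lemma mono_mul_mono (m n m' n' : ℤ) : mono θ m n * mono θ m' n' =
    cocycle θ (m, n) (m', n') • mono θ (m + m') (n + n') := by
  ext z
  simp only [mono, coeff_mul, coeff_mk, coeff_smul, conv, Pi.smul_apply, smul_eq_mul]
  rw [tsum_eq_single (m, n) fun x hx => by simp [Pi.single_eq_of_ne hx]]
  rcases eq_or_ne z (m + m', n + n') with rfl | h
  · simp
  · have h' : z - (m, n) ≠ (m', n') := fun e => h (by rw [← sub_add_cancel z (m, n), e]; ext <;> simp [add_comm])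
    simp [Pi.single_eq_of_ne h, Pi.single_eq_of_ne h']

lemma mono_zero : mono θ 0 0 = 1 := rfl

/-- The commutation relation `uv = e^{2πiθ} vu`. -/
lemma u_mul_v : mono θ 1 0 * mono θ 0 1 =
    Complex.exp (2 * Real.pi * Complex.I * θ) • (mono θ 0 1 * mono θ 1 0) := by
  rw [mono_mul_mono, mono_mul_mono, smul_smul]
  simp [cocycle, ← Complex.exp_add]

end Alg

/-- The differential forms `Ω𝒜_θ`. As a left `𝒜_θ`-module it is free on
`1, e₁ = u⁻¹du, e₂ = v⁻¹dv, e₁e₂`; the element with components `f₀, f₁, f₂, f₁₂` is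
`f₀ + f₁ e₁ + f₂ e₂ + f₁₂ e₁e₂`. -/
@[ext] structure Forms (θ : ℝ) where
  f₀ : Alg θ
  f₁ : Alg θ
  f₂ : Alg θ
  f₁₂ : Alg θ

namespace Forms

/-- The components of a form. -/
def equivProd : Forms θ ≃ Alg θ × Alg θ × Alg θ × Alg θ where
  toFun w := (w.f₀, w.f₁, w.f₂, w.f₁₂)
  invFun p := ⟨p.1, p.2.1, p.2.2.1, p.2.2.2⟩
  left_inv _ := rfl
  right_inv _ := rfl

instance : AddCommGroup (Forms θ) := equivProd.addCommGroup
instance : Module ℂ (Forms θ) := equivProd.module ℂ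

/-- The product, determined by the product of `𝒜_θ` and `a eᵢ = eᵢ a`, `eᵢ² = 0`,
`e₂e₁ = - e₁e₂`; this amounts to `u du = du u`, `u dv = λ dv u`, `v du = λ⁻¹ du v`, `v dv = dv v`,
`du dv = - λ dv du`. -/
instance : Mul (Forms θ) := ⟨fun w z =>
  ⟨w.f₀ * z.f₀, w.f₀ * z.f₁ + w.f₁ * z.f₀, w.f₀ * z.f₂ + w.f₂ * z.f₀,
    w.f₀ * z.f₁₂ + w.f₁ * z.f₂ - w.f₂ * z.f₁ + w.f₁₂ * z.f₀⟩⟩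

instance : One (Forms θ) := ⟨⟨1, 0, 0, 0⟩⟩

section
variable (w z : Forms θ) (c : ℂ)
@[simp] lemma zero_f₀ : (0 : Forms θ).f₀ = 0 := rfl
@[simp] lemma zero_f₁ : (0 : Forms θ).f₁ = 0 := rfl
@[simp] lemma zero_f₂ : (0 : Forms θ).f₂ = 0 := rfl
@[simp] lemma zero_f₁₂ : (0 : Forms θ).f₁₂ = 0 := rfl
@[simp] lemma one_f₀ : (1 : Forms θ).f₀ = 1 := rfl
@[simp] lemma one_f₁ : (1 : Forms θ).f₁ = 0 := rfl
@[simp] lemma one_f₂ : (1 : Forms θ).f₂ = 0 := rfl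
@[simp] lemma one_f₁₂ : (1 : Forms θ).f₁₂ = 0 := rfl
@[simp] lemma add_f₀ : (w + z).f₀ = w.f₀ + z.f₀ := rfl
@[simp] lemma add_f₁ : (w + z).f₁ = w.f₁ + z.f₁ := rfl
@[simp] lemma add_f₂ : (w + z).f₂ = w.f₂ + z.f₂ := rfl
@[simp] lemma add_f₁₂ : (w + z).f₁₂ = w.f₁₂ + z.f₁₂ := rfl
@[simp] lemma neg_f₀ : (-w).f₀ = -w.f₀ := rfl
@[simp] lemma neg_f₁ : (-w).f₁ = -w.f₁ := rfl
@[simp] lemma neg_f₂ : (-w).f₂ = -w.f₂ := rfl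
@[simp] lemma neg_f₁₂ : (-w).f₁₂ = -w.f₁₂ := rfl
@[simp] lemma smul_f₀ : (c • w).f₀ = c • w.f₀ := rfl
@[simp] lemma smul_f₁ : (c • w).f₁ = c • w.f₁ := rfl
@[simp] lemma smul_f₂ : (c • w).f₂ = c • w.f₂ := rfl
@[simp] lemma smul_f₁₂ : (c • w).f₁₂ = c • w.f₁₂ := rfl
@[simp] lemma mul_f₀ : (w * z).f₀ = w.f₀ * z.f₀ := rfl
@[simp] lemma mul_f₁ : (w * z).f₁ = w.f₀ * z.f₁ + w.f₁ * z.f₀ := rfl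
@[simp] lemma mul_f₂ : (w * z).f₂ = w.f₀ * z.f₂ + w.f₂ * z.f₀ := rfl
@[simp] lemma mul_f₁₂ : (w * z).f₁₂ =
    w.f₀ * z.f₁₂ + w.f₁ * z.f₂ - w.f₂ * z.f₁ + w.f₁₂ * z.f₀ := rfl
end

instance : Ring (Forms θ) where
  __ := (inferInstance : AddCommGroup (Forms θ))
  mul_assoc a b c := by ext1 <;> simp <;> noncomm_ring
  one_mul a := by ext1 <;> simp
  mul_one a := by ext1 <;> simp
  left_distrib a b c := by ext1 <;> simp <;> noncomm_ring
  right_distrib a b c := by ext1 <;> simp <;> noncomm_ring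
  zero_mul a := by ext1 <;> simp
  mul_zero a := by ext1 <;> simp

instance : Algebra ℂ (Forms θ) := Algebra.ofModule
  (fun c a b => by ext1 <;> simp [smul_add, smul_sub])
  (fun c a b => by ext1 <;> simp [smul_add, smul_sub])

/-- The homogeneous components of `Ω𝒜_θ`. -/
def deg (θ : ℝ) : ℕ → Submodule ℂ (Forms θ)
  | 0 => { carrier := {w | w.f₁ = 0 ∧ w.f₂ = 0 ∧ w.f₁₂ = 0}
           zero_mem' := by simp
           add_mem' := by rintro a b ⟨h1, h2, h3⟩ ⟨k1, k2, k3⟩; simp [*]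
           smul_mem' := by rintro c a ⟨h1, h2, h3⟩; simp [*] }
  | 1 => { carrier := {w | w.f₀ = 0 ∧ w.f₁₂ = 0}
           zero_mem' := by simp
           add_mem' := by rintro a b ⟨h1, h2⟩ ⟨k1, k2⟩; simp [*]
           smul_mem' := by rintro c a ⟨h1, h2⟩; simp [*] }
  | 2 => { carrier := {w | w.f₀ = 0 ∧ w.f₁ = 0 ∧ w.f₂ = 0}
           zero_mem' := by simp
           add_mem' := by rintro a b ⟨h1, h2, h3⟩ ⟨k1, k2, k3⟩; simp [*]
           smul_mem' := by rintro c a ⟨h1, h2, h3⟩; simp [*] }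
  | _ + 3 => ⊥

lemma mem_deg_zero {w : Forms θ} : w ∈ deg θ 0 ↔ w.f₁ = 0 ∧ w.f₂ = 0 ∧ w.f₁₂ = 0 := Iff.rfl
lemma mem_deg_one {w : Forms θ} : w ∈ deg θ 1 ↔ w.f₀ = 0 ∧ w.f₁₂ = 0 := Iff.rfl
lemma mem_deg_two {w : Forms θ} : w ∈ deg θ 2 ↔ w.f₀ = 0 ∧ w.f₁ = 0 ∧ w.f₂ = 0 := Iff.rfl
lemma mem_deg_add_three {n : ℕ} {w : Forms θ} : w ∈ deg θ (n + 3) ↔ w = 0 := Submodule.mem_bot ℂ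

instance : SetLike.GradedMonoid (deg θ) where
  one_mem := by simp [mem_deg_zero]
  mul_mem := by
    intro i j a b ha hb
    match i, j, ha, hb with
    | 0, 0, ha, hb => rw [mem_deg_zero] at *; simp [ha, hb]
    | 0, 1, ha, hb => rw [mem_deg_zero] at ha; rw [mem_deg_one] at *; simp [ha, hb]
    | 0, 2, ha, hb => rw [mem_deg_zero] at ha; rw [mem_deg_two] at *; simp [ha, hb]
    | 1, 0, ha, hb => rw [mem_deg_zero] at hb; rw [mem_deg_one] at *; simp [ha, hb]
    | 1, 1, ha, hb => rw [mem_deg_one] at ha hb; rw [mem_deg_two]; simp [ha, hb]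
    | 2, 0, ha, hb => rw [mem_deg_zero] at hb; rw [mem_deg_two] at *; simp [ha, hb]
    | 1, 2, ha, hb =>
      rw [mem_deg_one] at ha; rw [mem_deg_two] at hb
      exact (mem_deg_add_three (n := 0)).2 (by ext1 <;> simp [ha, hb])
    | 2, 1, ha, hb =>
      rw [mem_deg_two] at ha; rw [mem_deg_one] at hb
      exact (mem_deg_add_three (n := 0)).2 (by ext1 <;> simp [ha, hb])
    | 2, 2, ha, hb =>
      rw [mem_deg_two] at ha hb
      exact (mem_deg_add_three (n := 1)).2 (by ext1 <;> simp [ha, hb])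
    | i, j + 3, ha, hb =>
      rw [mem_deg_add_three] at hb; subst hb; rw [mul_zero]; exact Submodule.zero_mem _
    | i + 3, j, ha, hb =>
      rw [mem_deg_add_three] at ha; subst ha; rw [zero_mul]; exact Submodule.zero_mem _

/-- The decomposition of a form into homogeneous components. -/
def decomp : Forms θ →ₗ[ℂ] DirectSum ℕ fun i => deg θ i :=
  DirectSum.lof ℂ ℕ (fun i => deg θ i) 0 ∘ₗ
    { toFun := fun w => ⟨⟨w.f₀, 0, 0, 0⟩, by simp [mem_deg_zero]⟩
      map_add' := fun a b => Subtype.ext (by ext1 <;> simp)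
      map_smul' := fun c a => Subtype.ext (by ext1 <;> simp) } +
  DirectSum.lof ℂ ℕ (fun i => deg θ i) 1 ∘ₗ
    { toFun := fun w => ⟨⟨0, w.f₁, w.f₂, 0⟩, by simp [mem_deg_one]⟩
      map_add' := fun a b => Subtype.ext (by ext1 <;> simp)
      map_smul' := fun c a => Subtype.ext (by ext1 <;> simp) } +
  DirectSum.lof ℂ ℕ (fun i => deg θ i) 2 ∘ₗ
    { toFun := fun w => ⟨⟨0, 0, 0, w.f₁₂⟩, by simp [mem_deg_two]⟩
      map_add' := fun a b => Subtype.ext (by ext1 <;> simp)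
      map_smul' := fun c a => Subtype.ext (by ext1 <;> simp) }

lemma decomp_apply (w : Forms θ) : decomp w =
    DirectSum.lof ℂ ℕ (fun i => deg θ i) 0 ⟨⟨w.f₀, 0, 0, 0⟩, by simp [mem_deg_zero]⟩ +
    DirectSum.lof ℂ ℕ (fun i => deg θ i) 1 ⟨⟨0, w.f₁, w.f₂, 0⟩, by simp [mem_deg_one]⟩ +
    DirectSum.lof ℂ ℕ (fun i => deg θ i) 2 ⟨⟨0, 0, 0, w.f₁₂⟩, by simp [mem_deg_two]⟩ := rfl

lemma lof_eq_zero {i : ℕ} (a : deg θ i) (h : a = 0) :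
    DirectSum.lof ℂ ℕ (fun i => deg θ i) i a = 0 := by rw [h, map_zero]

instance : DirectSum.Decomposition (deg θ) := DirectSum.Decomposition.ofLinearMap _ decomp
  (by
    refine LinearMap.ext fun w => ?_
    simp only [LinearMap.comp_apply, decomp_apply, map_add, DirectSum.coeLinearMap_lof]
    ext1 <;> simp)
  (by
    refine DirectSum.linearMap_ext ℂ fun i => LinearMap.ext fun a => ?_
    simp only [LinearMap.comp_apply, DirectSum.coeLinearMap_lof, LinearMap.id_apply]
    match i, a with
    | 0, ⟨a, ha⟩ =>
      obtain ⟨h1, h2, h3⟩ := ha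
      rw [decomp_apply, lof_eq_zero (i := 1) _ (Subtype.ext (by ext1 <;> simp [h1, h2])),
        lof_eq_zero (i := 2) _ (Subtype.ext (by ext1 <;> simp [h3])), add_zero, add_zero]
      congr 2
      ext1 <;> simp [h1, h2, h3]
    | 1, ⟨a, ha⟩ =>
      obtain ⟨h1, h2⟩ := ha
      rw [decomp_apply, lof_eq_zero (i := 0) _ (Subtype.ext (by ext1 <;> simp [h1])),
        lof_eq_zero (i := 2) _ (Subtype.ext (by ext1 <;> simp [h2])), add_zero, zero_add]
      congr 2
      ext1 <;> simp [h1, h2]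
    | 2, ⟨a, ha⟩ =>
      obtain ⟨h1, h2, h3⟩ := ha
      rw [decomp_apply, lof_eq_zero (i := 0) _ (Subtype.ext (by ext1 <;> simp [h1])),
        lof_eq_zero (i := 1) _ (Subtype.ext (by ext1 <;> simp [h2, h3])), add_zero, zero_add]
      congr 2
      ext1 <;> simp [h1, h2, h3]
    | i + 3, ⟨a, ha⟩ =>
      have h0 : a = 0 := mem_deg_add_three.1 ha
      subst h0
      have : (⟨0, ha⟩ : deg θ (i + 3)) = 0 := rfl
      rw [this, map_zero]
      exact map_zero _)

instance : GradedAlgebra (deg θ) where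

/-- The differential, `d (u^m v^n) = u^m v^n (m e₁ + n e₂)` and `de₁ = de₂ = 0`. -/
def d : Forms θ →ₗ[ℂ] Forms θ where
  toFun w := ⟨0, Alg.δ₁ w.f₀, Alg.δ₂ w.f₀, Alg.δ₁ w.f₂ - Alg.δ₂ w.f₁⟩
  map_add' a b := by
    ext1 <;> simp only [map_add, add_f₀, add_f₁, add_f₂, add_f₁₂]
    · simp
    · abel
  map_smul' c a := by ext1 <;> simp [smul_sub]

@[simp] lemma d_f₀ (w : Forms θ) : (d w).f₀ = 0 := rfl
@[simp] lemma d_f₁ (w : Forms θ) : (d w).f₁ = Alg.δ₁ w.f₀ := rfl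
@[simp] lemma d_f₂ (w : Forms θ) : (d w).f₂ = Alg.δ₂ w.f₀ := rfl
@[simp] lemma d_f₁₂ (w : Forms θ) : (d w).f₁₂ = Alg.δ₁ w.f₂ - Alg.δ₂ w.f₁ := rfl

lemma d_mem (i : ℕ) (w : Forms θ) (hw : w ∈ deg θ i) : d w ∈ deg θ (i + 1) := by
  match i, hw with
  | 0, hw => rw [mem_deg_zero] at hw; rw [mem_deg_one]; simp [hw]
  | 1, hw => rw [mem_deg_one] at hw; rw [mem_deg_two]; simp [hw]
  | 2, hw =>
    rw [mem_deg_two] at hw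
    exact (mem_deg_add_three (n := 0)).2 (by ext1 <;> simp [hw])
  | n + 3, hw =>
    rw [mem_deg_add_three] at hw; subst hw; rw [map_zero]; exact Submodule.zero_mem _

lemma d_d (w : Forms θ) : d (d w) = 0 := by
  ext1 <;> simp [Alg.δ₁_δ₂]

lemma d_mul (i : ℕ) (w z : Forms θ) (hw : w ∈ deg θ i) :
    d (w * z) = d w * z + (-1 : ℂ) ^ i • (w * d z) := by
  match i, hw with
  | 0, hw =>
    rw [mem_deg_zero] at hw
    ext1 <;> simp [hw, Alg.δ₁_mul, Alg.δ₂_mul]; noncomm_ring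
  | 1, hw =>
    rw [mem_deg_one] at hw
    ext1 <;> simp [hw, Alg.δ₁_mul, Alg.δ₂_mul]; noncomm_ring
  | 2, hw =>
    rw [mem_deg_two] at hw
    ext1 <;> simp [hw]
  | n + 3, hw =>
    rw [mem_deg_add_three] at hw; subst hw; simp

/-- The action `α` of `𝕋²` on `Ω𝒜_θ`: the extension of the action on `𝒜_θ` that commutes with `d`;
it leaves `u⁻¹du` and `v⁻¹dv` invariant. -/
def rot (t : ℝ × ℝ) : Forms θ →ₐ[ℂ] Forms θ := AlgHom.ofLinearMap
  { toFun := fun w => ⟨Alg.rot t w.f₀, Alg.rot t w.f₁, Alg.rot t w.f₂, Alg.rot t w.f₁₂⟩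
    map_add' := fun a b => by ext1 <;> simp
    map_smul' := fun c a => by ext1 <;> simp }
  (by ext1 <;> simp)
  (fun a b => by ext1 <;> simp)

lemma rot_d (t : ℝ × ℝ) (w : Forms θ) : rot t (d w) = d (rot t w) := by
  ext1 <;> simp [rot, Alg.rot_δ₁, Alg.rot_δ₂]

/-- The inclusion `𝒜_θ = Ω⁰𝒜_θ ⊆ Ω𝒜_θ`. -/
def ofAlg : Alg θ →ₐ[ℂ] Forms θ := AlgHom.ofLinearMap
  { toFun := fun a => ⟨a, 0, 0, 0⟩
    map_add' := fun a b => by ext1 <;> simp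
    map_smul' := fun c a => by ext1 <;> simp }
  rfl
  (fun a b => by ext1 <;> simp)

@[simp] lemma ofAlg_f₀ (a : Alg θ) : (ofAlg a).f₀ = a := rfl
@[simp] lemma ofAlg_f₁ (a : Alg θ) : (ofAlg a).f₁ = 0 := rfl
@[simp] lemma ofAlg_f₂ (a : Alg θ) : (ofAlg a).f₂ = 0 := rfl
@[simp] lemma ofAlg_f₁₂ (a : Alg θ) : (ofAlg a).f₁₂ = 0 := rfl

/-- The form `u⁻¹ du`. -/
def uForm (θ : ℝ) : Forms θ := ofAlg (Alg.mono θ (-1) 0) * d (ofAlg (Alg.mono θ 1 0))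

/-- The form `v⁻¹ dv`. -/
def vForm (θ : ℝ) : Forms θ := ofAlg (Alg.mono θ 0 (-1)) * d (ofAlg (Alg.mono θ 0 1))

lemma uForm_eq : uForm θ = ⟨0, 1, 0, 0⟩ := by
  have h1 : Alg.δ₁ (Alg.mono θ 1 0) = Alg.mono θ 1 0 := by
    ext x
    rcases eq_or_ne x (1, 0) with rfl | h
    · simp [Alg.δ₁]
    · simp [Alg.δ₁, Alg.mono, Pi.single_eq_of_ne h]
  have h2 : Alg.δ₂ (Alg.mono θ 1 0) = 0 := by
    ext x
    rcases eq_or_ne x (1, 0) with rfl | h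
    · simp [Alg.δ₂]
    · simp [Alg.δ₂, Alg.mono, Pi.single_eq_of_ne h]
  ext1
  · simp [uForm]
  · simp [uForm, h1, Alg.mono_mul_mono, Alg.mono_zero, NCTorus.cocycle]
  · simp [uForm, h2]
  · simp [uForm]

lemma vForm_eq : vForm θ = ⟨0, 0, 1, 0⟩ := by
  have h1 : Alg.δ₂ (Alg.mono θ 0 1) = Alg.mono θ 0 1 := by
    ext x
    rcases eq_or_ne x (0, 1) with rfl | h
    · simp [Alg.δ₂]
    · simp [Alg.δ₂, Alg.mono, Pi.single_eq_of_ne h]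
  have h2 : Alg.δ₁ (Alg.mono θ 0 1) = 0 := by
    ext x
    rcases eq_or_ne x (0, 1) with rfl | h
    · simp [Alg.δ₁]
    · simp [Alg.δ₁, Alg.mono, Pi.single_eq_of_ne h]
  ext1
  · simp [vForm]
  · simp [vForm, h2]
  · simp [vForm, h1, Alg.mono_mul_mono, Alg.mono_zero, NCTorus.cocycle]
  · simp [vForm]

end Forms
end NCTorus
end

noncomputable section

/-! ## Differential graded algebras, bimodules and flat connections -/

/-- A differential graded algebra `Ω = ⨁_{k ≥ 0} Ωᵏ` over `ℂ`. -/
structure DGA where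
  carrier : Type
  [ring : Ring carrier]
  [algebra : Algebra ℂ carrier]
  deg : ℕ → Submodule ℂ carrier
  [graded : GradedAlgebra deg]
  d : carrier →ₗ[ℂ] carrier
  d_mem : ∀ i a, a ∈ deg i → d a ∈ deg (i + 1)
  d_mul : ∀ i a b, a ∈ deg i → d (a * b) = d a * b + (-1 : ℂ) ^ i • (a * d b)
  d_d : ∀ a, d (d a) = 0

attribute [instance] DGA.ring DGA.algebra DGA.graded

/-- A graded `Ω`-bimodule `⨁_{k ≥ 0} Eᵏ`. The right action of `α` on `ε` is written
`MulOpposite.op α • ε`. -/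
structure GradedBimodule (Ω : DGA) where
  carrier : Type
  [addCommGroup : AddCommGroup carrier]
  [module : Module ℂ carrier]
  [left : Module Ω.carrier carrier]
  [right : Module (Ω.carrier)ᵐᵒᵖ carrier]
  [left_tower : IsScalarTower ℂ Ω.carrier carrier]
  [right_tower : IsScalarTower ℂ (Ω.carrier)ᵐᵒᵖ carrier]
  [comm : SMulCommClass Ω.carrier (Ω.carrier)ᵐᵒᵖ carrier]
  deg : ℕ → Submodule ℂ carrier
  [decomposition : DirectSum.Decomposition deg]
  smul_mem : ∀ i j (a : Ω.carrier) (e : carrier), a ∈ Ω.deg i → e ∈ deg j → a • e ∈ deg (i + j)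
  op_smul_mem : ∀ i j (e : carrier) (a : Ω.carrier), e ∈ deg i → a ∈ Ω.deg j →
    MulOpposite.op a • e ∈ deg (i + j)

attribute [instance] GradedBimodule.addCommGroup GradedBimodule.module GradedBimodule.left
  GradedBimodule.right GradedBimodule.left_tower GradedBimodule.right_tower GradedBimodule.comm
  GradedBimodule.decomposition

open scoped RightActions

namespace GradedBimodule

variable {Ω : DGA}

/-- `Ω` as a graded bimodule over itself. -/
def self (Ω : DGA) : GradedBimodule Ω where
  carrier := Ω.carrier
  deg := Ω.deg
  smul_mem _ _ _ _ ha he := SetLike.mul_mem_graded ha he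
  op_smul_mem _ _ _ _ he ha := SetLike.mul_mem_graded he ha

/-- The grading of the zero bimodule. -/
def zeroDeg : ℕ → Submodule ℂ PUnit.{1} := fun _ => ⊥

instance : DirectSum.Decomposition zeroDeg := DirectSum.Decomposition.ofLinearMap _ 0
  (LinearMap.ext fun _ => rfl)
  (DirectSum.linearMap_ext ℂ fun _ => LinearMap.ext fun a => by
    have : a = 0 := Subtype.ext rfl
    rw [this, map_zero, map_zero])

/-- The zero bimodule. -/
def zero (Ω : DGA) : GradedBimodule Ω where
  carrier := PUnit.{1}
  deg := zeroDeg
  smul_mem _ _ _ _ _ _ := (Submodule.mem_bot ℂ).2 rfl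
  op_smul_mem _ _ _ _ _ _ := (Submodule.mem_bot ℂ).2 rfl

/-- The degree `i` component of an element. -/
def component (E : GradedBimodule Ω) (i : ℕ) : E.carrier →ₗ[ℂ] E.carrier :=
  (E.deg i).subtype ∘ₗ DirectSum.component ℂ ℕ (fun i => E.deg i) i ∘ₗ
    (DirectSum.decomposeLinearEquiv E.deg).toLinearMap

lemma component_apply (E : GradedBimodule Ω) (i : ℕ) (e : E.carrier) :
    E.component i e = (DirectSum.decompose E.deg e i : E.carrier) := rfl

/-- The graded centre `Z_g(E) = {ε ∈ E | [ε, ν] = 0 for all ν ∈ Ω}`, where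
`[ε, ν] = εν - (-1)^{|ε||ν|} νε` for homogeneous `ε, ν`, extended bilinearly. The condition
`[ε, ν] = 0` for homogeneous `ν` is written out on the homogeneous components of `ε`. -/
def gradedCentre (E : GradedBimodule Ω) : Submodule ℂ E.carrier where
  carrier := {e | ∀ i j, ∀ ν ∈ Ω.deg j,
    E.component i e <• ν = (-1 : ℂ) ^ (i * j) • (ν • E.component i e)}
  zero_mem' := by
    intro i j ν _
    simp
  add_mem' := by
    intro a b ha hb i j ν hν
    rw [map_add, smul_add, smul_add, smul_add, ha i j ν hν, hb i j ν hν]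
  smul_mem' := by
    intro c a ha i j ν hν
    rw [map_smul, smul_comm _ c, ha i j ν hν, smul_comm ν c, smul_comm c]

/-- The degree zero part `Z_g(E)⁰` of the graded centre. -/
def centreZero (E : GradedBimodule Ω) : Submodule ℂ E.carrier := E.gradedCentre ⊓ E.deg 0

lemma mem_centreZero {E : GradedBimodule Ω} {e : E.carrier} :
    e ∈ E.centreZero ↔ e ∈ E.deg 0 ∧ ∀ ν : Ω.carrier, e <• ν = ν • e := by
  constructor
  · rintro ⟨h, he⟩
    have h0 : E.component 0 e = e := by
      rw [component_apply, DirectSum.decompose_of_mem_same _ he]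
    refine ⟨he, fun ν => ?_⟩
    induction ν using DirectSum.Decomposition.inductionOn Ω.deg with
    | zero => simp
    | homogeneous ν => simpa [h0] using h 0 _ ν.1 ν.2
    | add x y hx hy => rw [MulOpposite.op_add, add_smul, add_smul, hx, hy]
  · rintro ⟨he, h⟩
    refine ⟨fun i j ν _ => ?_, he⟩
    rcases eq_or_ne i 0 with rfl | hi
    · rw [component_apply, DirectSum.decompose_of_mem_same _ he, h]
      simp
    · rw [component_apply, DirectSum.decompose_of_mem_ne _ he hi.symm]
      simp

lemma smul_mem_centreZero {E : GradedBimodule Ω} {a : Ω.carrier} {e : E.carrier}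
    (ha : a ∈ (self Ω).centreZero) (he : e ∈ E.centreZero) : a • e ∈ E.centreZero := by
  have ha := mem_centreZero.1 ha
  have he := mem_centreZero.1 he
  rw [mem_centreZero]
  have ha' : ∀ ν : Ω.carrier, a * ν = ν * a := ha.2
  refine ⟨E.smul_mem 0 0 a e ha.1 he.1, fun ν => ?_⟩
  rw [← smul_comm, he.2, smul_smul, smul_smul, ha']

/-- `E` is finitely generated projective: `E ⊕ F ≅ Ωⁿ` as graded bimodules, for some graded
bimodule `F` and some `n`. -/
def IsFGP (E : GradedBimodule Ω) : Prop :=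
  ∃ (F : GradedBimodule Ω) (n : ℕ) (φ : (E.carrier × F.carrier) ≃ₗ[ℂ] (Fin n → Ω.carrier)),
    (∀ (a : Ω.carrier) x, φ (a • x) = a • φ x) ∧
    (∀ (a : Ω.carrier) x, φ (x <• a) = φ x <• a) ∧
    ∀ k, ∀ e ∈ E.deg k, ∀ f ∈ F.deg k, ∀ j, φ (e, f) j ∈ Ω.deg k

end GradedBimodule

/-- An object of the category of flat connections: a finitely generated projective graded bimodule
with a flat connection. -/
structure FlatBimodule (Ω : DGA) extends GradedBimodule Ω where
  fgp : toGradedBimodule.IsFGP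
  nabla : carrier →ₗ[ℂ] carrier
  nabla_mem : ∀ i e, e ∈ deg i → nabla e ∈ deg (i + 1)
  nabla_right : ∀ i e (a : Ω.carrier), e ∈ deg i →
    nabla (e <• a) = nabla e <• a + (-1 : ℂ) ^ i • (e <• Ω.d a)
  nabla_left : ∀ i (a : Ω.carrier) e, a ∈ Ω.deg i →
    nabla (a • e) = Ω.d a • e + (-1 : ℂ) ^ i • (a • nabla e)
  flat : ∀ e, nabla (nabla e) = 0

namespace FlatBimodule

variable {Ω : DGA}

/-- A morphism: a bimodule map of degree zero commuting with the connections. -/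
@[ext] structure Hom (E F : FlatBimodule Ω) where
  toLinearMap : E.carrier →ₗ[ℂ] F.carrier
  map_smul : ∀ (a : Ω.carrier) e, toLinearMap (a • e) = a • toLinearMap e
  map_op_smul : ∀ (a : Ω.carrier) e, toLinearMap (e <• a) = toLinearMap e <• a
  map_mem : ∀ i, ∀ e ∈ E.deg i, toLinearMap e ∈ F.deg i
  map_nabla : ∀ e, toLinearMap (E.nabla e) = F.nabla (toLinearMap e)

/-- The category `𝒞_♭(Ω)` of flat connections. -/
instance : Category (FlatBimodule Ω) where
  Hom := Hom
  id E := ⟨LinearMap.id, fun _ _ => rfl, fun _ _ => rfl, fun _ _ h => h, fun _ => rfl⟩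
  comp f g := ⟨g.toLinearMap ∘ₗ f.toLinearMap,
    fun a e => by simp [f.map_smul, g.map_smul],
    fun a e => by simp [f.map_op_smul, g.map_op_smul],
    fun i e h => g.map_mem i _ (f.map_mem i e h),
    fun e => by simp [f.map_nabla, g.map_nabla]⟩

/-- The unit object `(Ω, d)`. -/
def unit (Ω : DGA) : FlatBimodule Ω where
  __ := GradedBimodule.self Ω
  fgp := by
    refine ⟨GradedBimodule.zero Ω, 1, ?_, ?_⟩
    · exact
        { toFun := fun x _ => x.1
          invFun := fun y => (y 0, PUnit.unit)
          map_add' := fun _ _ => rfl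
          map_smul' := fun _ _ => rfl
          left_inv := fun _ => rfl
          right_inv := fun y => funext fun j => by rw [Subsingleton.elim j 0] }
    · exact ⟨fun _ _ => rfl, fun _ _ => rfl, fun k e he _ _ _ => he⟩
  nabla := Ω.d
  nabla_mem := Ω.d_mem
  nabla_right i e a h := Ω.d_mul i e a h
  nabla_left i a e h := Ω.d_mul i a e h
  flat := Ω.d_d

/-- `μ : E × F → G` exhibits `G` as the tensor product `E ⊗_Ω F` in the category of flat
connections: `G` is the quotient of `E ⊗_ℂ F` by the relations `εα ⊗ ζ = ε ⊗ αζ`, as a graded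
bimodule, with the connection `∇(ε ⊗ ζ) = ∇ε ⊗ ζ + (-1)^{|ε|} ε ⊗ ∇ζ`. -/
structure IsTensor (E F G : FlatBimodule Ω)
    (μ : E.carrier →ₗ[ℂ] F.carrier →ₗ[ℂ] G.carrier) : Prop where
  surjective : LinearMap.range (TensorProduct.lift μ) = ⊤
  ker : LinearMap.ker (TensorProduct.lift μ) =
    Submodule.span ℂ {x | ∃ (e : E.carrier) (a : Ω.carrier) (f : F.carrier),
      x = (e <• a) ⊗ₜ[ℂ] f - e ⊗ₜ[ℂ] (a • f)}
  smul : ∀ (a : Ω.carrier) e f, μ (a • e) f = a • μ e f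
  op_smul : ∀ (a : Ω.carrier) e f, μ e (f <• a) = μ e f <• a
  mem : ∀ i j, ∀ e ∈ E.deg i, ∀ f ∈ F.deg j, μ e f ∈ G.deg (i + j)
  nabla : ∀ i, ∀ e ∈ E.deg i, ∀ f,
    G.nabla (μ e f) = μ (E.nabla e) f + (-1 : ℂ) ^ i • μ e (F.nabla f)

lemma IsTensor.balanced {E F G : FlatBimodule Ω}
    {μ : E.carrier →ₗ[ℂ] F.carrier →ₗ[ℂ] G.carrier} (h : IsTensor E F G μ) (e : E.carrier)
    (a : Ω.carrier) (f : F.carrier) : μ (e <• a) f = μ e (a • f) := by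
  have : (e <• a) ⊗ₜ[ℂ] f - e ⊗ₜ[ℂ] (a • f) ∈ LinearMap.ker (TensorProduct.lift μ) := by
    rw [h.ker]; exact Submodule.subset_span ⟨e, a, f, rfl⟩
  simpa [sub_eq_zero] using this

lemma IsTensor.mem_centreZero {E F G : FlatBimodule Ω}
    {μ : E.carrier →ₗ[ℂ] F.carrier →ₗ[ℂ] G.carrier} (h : IsTensor E F G μ) {e : E.carrier}
    {f : F.carrier} (he : e ∈ E.centreZero) (hf : f ∈ F.centreZero) :
    μ e f ∈ G.centreZero := by
  rw [GradedBimodule.mem_centreZero] at *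
  exact ⟨h.mem 0 0 e he.1 f hf.1, fun ν => by
    rw [← h.op_smul, hf.2, ← h.balanced, he.2, h.smul]⟩

end FlatBimodule

/-! ## The fibre functor -/

namespace DGA

/-- The algebra `Z_g(Ω)⁰`. -/
def centreZero (Ω : DGA) : Subalgebra ℂ Ω.carrier where
  __ := (GradedBimodule.self Ω).centreZero
  mul_mem' ha hb := GradedBimodule.smul_mem_centreZero ha hb
  algebraMap_mem' c := GradedBimodule.mem_centreZero.2
    ⟨SetLike.algebraMap_mem_graded Ω.deg c, fun ν => Algebra.commutes c ν⟩

/-- The base points: characters of `Z_g(Ω)⁰`. -/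
abbrev BasePoint (Ω : DGA) : Type := Ω.centreZero →ₐ[ℂ] ℂ

end DGA

namespace FlatBimodule

variable {Ω : DGA} (p : Ω.BasePoint)

/-- The subspace `ker(p) · Z_g(E)⁰` of `Z_g(E)⁰`. -/
def kerSMul (E : FlatBimodule Ω) : Submodule ℂ E.centreZero :=
  Submodule.span ℂ {x | ∃ (a : Ω.centreZero) (e : E.centreZero), p a = 0 ∧
    (x : E.carrier) = (a : Ω.carrier) • (e : E.carrier)}

/-- The fibre `Z_g(E)⁰ ⊗_{Z_g(Ω)⁰} ℂ` at `p`, where `Z_g(Ω)⁰` acts on `ℂ` through `p`; as `p` is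
surjective this is `Z_g(E)⁰ / ker(p) Z_g(E)⁰`. -/
abbrev Fibre (E : FlatBimodule Ω) : Type := E.centreZero ⧸ E.kerSMul p

/-- The restriction of a morphism to `Z_g(E)⁰`. -/
def centreMap {E F : FlatBimodule Ω} (f : E ⟶ F) : E.centreZero →ₗ[ℂ] F.centreZero :=
  (Hom.toLinearMap f).restrict fun e he => by
    rw [GradedBimodule.mem_centreZero] at *
    exact ⟨Hom.map_mem f 0 e he.1, fun ν => by
      rw [← Hom.map_op_smul, he.2, Hom.map_smul]⟩

lemma kerSMul_le {E F : FlatBimodule Ω} (f : E ⟶ F) :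
    E.kerSMul p ≤ (F.kerSMul p).comap (centreMap f) := by
  refine Submodule.span_le.2 ?_
  rintro x ⟨a, e, ha, hx⟩
  refine Submodule.subset_span ⟨a, centreMap f e, ha, ?_⟩
  change Hom.toLinearMap f x = a.1 • Hom.toLinearMap f e
  rw [hx, Hom.map_smul]

/-- The fibre functor at `p`. -/
def fibreFunctor : FlatBimodule Ω ⥤ ModuleCat.{0} ℂ where
  obj E := ModuleCat.of ℂ (E.Fibre p)
  map f := ModuleCat.ofHom (Submodule.mapQ _ _ (centreMap f) (kerSMul_le p f))
  map_id E := by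
    ext x
    rfl
  map_comp f g := by
    ext x
    rfl

/-- The map of fibres `E_p × F_p → G_p` induced by a tensor product `E × F → G`. -/
def IsTensor.fibreMap {E F G : FlatBimodule Ω} {μ : E.carrier →ₗ[ℂ] F.carrier →ₗ[ℂ] G.carrier}
    (h : IsTensor E F G μ) : E.Fibre p →ₗ[ℂ] F.Fibre p →ₗ[ℂ] G.Fibre p :=
  let B : E.centreZero →ₗ[ℂ] F.centreZero →ₗ[ℂ] G.Fibre p :=
    LinearMap.mk₂ ℂ
      (fun e f => (G.kerSMul p).mkQ ⟨μ e.1 f.1, h.mem_centreZero e.2 f.2⟩)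
      (fun e e' f => by rw [← map_add]; congr 1; ext; simp)
      (fun c e f => by rw [← map_smul]; congr 1; ext; simp)
      (fun e f f' => by rw [← map_add]; congr 1; ext; simp)
      (fun c e f => by rw [← map_smul]; congr 1; ext; simp)
  have hB : ∀ e f, B e f = (G.kerSMul p).mkQ ⟨μ e.1 f.1, h.mem_centreZero e.2 f.2⟩ :=
    fun _ _ => rfl
  let B' : E.Fibre p →ₗ[ℂ] F.centreZero →ₗ[ℂ] G.Fibre p := (E.kerSMul p).liftQ B (by
    refine Submodule.span_le.2 ?_
    rintro x ⟨a, e, ha, hx⟩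
    refine LinearMap.ext fun f => ?_
    rw [hB]
    refine (Submodule.Quotient.mk_eq_zero _).2 (Submodule.subset_span
      ⟨a, ⟨μ e.1 f.1, h.mem_centreZero e.2 f.2⟩, ha, ?_⟩)
    simp [hx, h.smul])
  ((F.kerSMul p).liftQ B'.flip (by
    refine Submodule.span_le.2 ?_
    rintro x ⟨a, f, ha, hx⟩
    refine LinearMap.ext fun e => ?_
    obtain ⟨e, rfl⟩ := Submodule.mkQ_surjective _ e
    change B e x = 0
    rw [hB]
    refine (Submodule.Quotient.mk_eq_zero _).2 (Submodule.subset_span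
      ⟨a, ⟨μ e.1 f.1, h.mem_centreZero e.2 f.2⟩, ha, ?_⟩)
    have he := (GradedBimodule.mem_centreZero.1 e.2).2 a
    simp only [hx]
    rw [← h.balanced, he, h.smul])).flip

@[simp] lemma IsTensor.fibreMap_mk {E F G : FlatBimodule Ω}
    {μ : E.carrier →ₗ[ℂ] F.carrier →ₗ[ℂ] G.carrier} (h : IsTensor E F G μ)
    (e : E.centreZero) (f : F.centreZero) :
    h.fibreMap p ((E.kerSMul p).mkQ e) ((F.kerSMul p).mkQ f) =
      (G.kerSMul p).mkQ ⟨μ e.1 f.1, h.mem_centreZero e.2 f.2⟩ := rfl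

end FlatBimodule
end

noncomputable section

/-! ## Tensor automorphisms of a fibre functor -/

/-- A functor `ω` from a category `C` to vector spaces, together with the tensor structure: the unit
object of `C`, and the relation `IsTensor E F G m` expressing that
`m : ω(E) × ω(F) → ω(G)` is the bilinear map coming from an identification of `G` with the tensor
product of `E` and `F` in `C` and the tensor structure of `ω`. -/
structure TensorFunctor (C : Type 1) [Category.{0} C] where
  functor : C ⥤ ModuleCat.{0} ℂ
  unit : C
  IsTensor : ∀ E F G : C,
    (functor.obj E →ₗ[ℂ] functor.obj F →ₗ[ℂ] functor.obj G) → Prop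

section BaseChange

variable {V W U : Type} [AddCommGroup V] [Module ℂ V] [AddCommGroup W] [Module ℂ W]
  [AddCommGroup U] [Module ℂ U]

/-- The base change `R ⊗ V × R ⊗ W → R ⊗ U` of a bilinear map `V × W → U`. -/
def bilinBaseChange (R : Type) [CommRing R] [Algebra ℂ R] (m : V →ₗ[ℂ] W →ₗ[ℂ] U) :
    R ⊗[ℂ] V →ₗ[R] R ⊗[ℂ] W →ₗ[R] R ⊗[ℂ] U :=
  (TensorProduct.mk R (R ⊗[ℂ] V) (R ⊗[ℂ] W)).compr₂
    ((TensorProduct.lift m).baseChange R ∘ₗ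
      (TensorProduct.AlgebraTensorModule.distribBaseChange ℂ R V W).symm.toLinearMap)

@[simp] lemma bilinBaseChange_tmul (R : Type) [CommRing R] [Algebra ℂ R]
    (m : V →ₗ[ℂ] W →ₗ[ℂ] U) (r s : R) (v : V) (w : W) :
    bilinBaseChange R m (r ⊗ₜ v) (s ⊗ₜ w) = (r * s) ⊗ₜ m v w := by
  simp [bilinBaseChange]

variable {R S T : Type} [CommRing R] [Algebra ℂ R] [CommRing S] [Algebra ℂ S]
  [CommRing T] [Algebra ℂ T]

/-- `f ⊗ id : R ⊗ V → S ⊗ V`. -/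
def coeffMap (V : Type) [AddCommGroup V] [Module ℂ V] (f : R →ₐ[ℂ] S) :
    R ⊗[ℂ] V →ₗ[ℂ] S ⊗[ℂ] V := f.toLinearMap.rTensor V

@[simp] lemma coeffMap_tmul (f : R →ₐ[ℂ] S) (r : R) (v : V) :
    coeffMap V f (r ⊗ₜ v) = f r ⊗ₜ v := rfl

lemma coeffMap_smul (f : R →ₐ[ℂ] S) (r : R) (x : R ⊗[ℂ] V) :
    coeffMap V f (r • x) = f r • coeffMap V f x := by
  induction x with
  | zero => simp
  | tmul s v => simp [TensorProduct.smul_tmul']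
  | add x y hx hy => rw [smul_add, map_add, map_add, smul_add, hx, hy]

lemma ext_coeffMap {M : Type} [AddCommGroup M] [Module S M] (f : R →ₐ[ℂ] S)
    {A B : S ⊗[ℂ] V →ₗ[S] M} (h : ∀ x, A (coeffMap V f x) = B (coeffMap V f x)) : A = B := by
  refine LinearMap.ext fun x => ?_
  induction x with
  | zero => simp
  | tmul s v =>
    have := h (1 ⊗ₜ v)
    rw [coeffMap_tmul, map_one] at this
    rw [← mul_one s, ← smul_eq_mul, ← TensorProduct.smul_tmul', map_smul, map_smul, this]
  | add x y hx hy => rw [map_add, map_add, hx, hy]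

/-- The base change of an `R`-linear endomorphism of `R ⊗ V` along `R → S`. -/
def pushEnd (f : R →ₐ[ℂ] S) (A : R ⊗[ℂ] V →ₗ[R] R ⊗[ℂ] V) : S ⊗[ℂ] V →ₗ[S] S ⊗[ℂ] V :=
  TensorProduct.AlgebraTensorModule.lift
    (LinearMap.toSpanSingleton S (V →ₗ[ℂ] S ⊗[ℂ] V)
      (coeffMap V f ∘ₗ A.restrictScalars ℂ ∘ₗ TensorProduct.mk ℂ R V 1))

lemma pushEnd_coeffMap (f : R →ₐ[ℂ] S) (A : R ⊗[ℂ] V →ₗ[R] R ⊗[ℂ] V) (x : R ⊗[ℂ] V) :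
    pushEnd f A (coeffMap V f x) = coeffMap V f (A x) := by
  induction x with
  | zero => simp
  | tmul r v =>
    have h : r ⊗ₜ[ℂ] v = r • ((1 : R) ⊗ₜ[ℂ] v) := by simp [TensorProduct.smul_tmul']
    have e : pushEnd f A (coeffMap V f (r ⊗ₜ v)) = f r • coeffMap V f (A (1 ⊗ₜ v)) := by
      simp [pushEnd]
    rw [e, ← coeffMap_smul, ← map_smul, ← h]
  | add x y hx hy => simp only [map_add, hx, hy]

lemma pushEnd_comp (f : R →ₐ[ℂ] S) (A B : R ⊗[ℂ] V →ₗ[R] R ⊗[ℂ] V) :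
    pushEnd f (A ∘ₗ B) = pushEnd f A ∘ₗ pushEnd f B :=
  ext_coeffMap f fun x => by simp [pushEnd_coeffMap]

lemma pushEnd_id (f : R →ₐ[ℂ] S) :
    pushEnd f (LinearMap.id : R ⊗[ℂ] V →ₗ[R] R ⊗[ℂ] V) = LinearMap.id :=
  ext_coeffMap f fun x => by simp [pushEnd_coeffMap]

/-- The base change of an `R`-linear automorphism of `R ⊗ V` along `R → S`. -/
def pushEquiv (f : R →ₐ[ℂ] S) (A : (R ⊗[ℂ] V) ≃ₗ[R] (R ⊗[ℂ] V)) :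
    (S ⊗[ℂ] V) ≃ₗ[S] (S ⊗[ℂ] V) :=
  LinearEquiv.ofLinearMap (pushEnd f A.toLinearMap) (pushEnd f A.symm.toLinearMap)
    (by rw [← pushEnd_comp, LinearEquiv.comp_symm, pushEnd_id])
    (by rw [← pushEnd_comp, LinearEquiv.symm_comp, pushEnd_id])

@[simp] lemma pushEquiv_coeffMap (f : R →ₐ[ℂ] S) (A : (R ⊗[ℂ] V) ≃ₗ[R] (R ⊗[ℂ] V))
    (x : R ⊗[ℂ] V) : pushEquiv f A (coeffMap V f x) = coeffMap V f (A x) :=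
  pushEnd_coeffMap f A.toLinearMap x

lemma equiv_ext_coeffMap (f : R →ₐ[ℂ] S) {A B : (S ⊗[ℂ] V) ≃ₗ[S] (S ⊗[ℂ] V)}
    (h : ∀ x, A (coeffMap V f x) = B (coeffMap V f x)) : A = B :=
  LinearEquiv.toLinearMap_injective (ext_coeffMap f h)

lemma baseChange_coeffMap (f : R →ₐ[ℂ] S) (φ : V →ₗ[ℂ] W) (x : R ⊗[ℂ] V) :
    φ.baseChange S (coeffMap V f x) = coeffMap W f (φ.baseChange R x) := by
  induction x with
  | zero => simp
  | tmul r v => simp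
  | add x y hx hy => simp only [map_add, hx, hy]

lemma bilinBaseChange_coeffMap (f : R →ₐ[ℂ] S) (m : V →ₗ[ℂ] W →ₗ[ℂ] U) (x : R ⊗[ℂ] V)
    (y : R ⊗[ℂ] W) : bilinBaseChange S m (coeffMap V f x) (coeffMap W f y) =
      coeffMap U f (bilinBaseChange R m x y) := by
  induction x with
  | zero => simp
  | tmul r v =>
    induction y with
    | zero => simp
    | tmul s w => simp
    | add x y hx hy => simp only [map_add, hx, hy]
  | add x y hx hy => simp only [map_add, LinearMap.add_apply, hx, hy]

end BaseChange

namespace TensorFunctor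

variable {C : Type 1} [Category.{0} C] (ω : TensorFunctor C)

/-- The `R`-points of the group scheme `Aut^⊗(ω)`: automorphisms of the functor
`E ↦ R ⊗ ω(E)` that are compatible with the tensor product and the unit. -/
@[ext] structure Aut (R : Type) [CommRing R] [Algebra ℂ R] where
  app : ∀ E : C, (R ⊗[ℂ] ω.functor.obj E) ≃ₗ[R] (R ⊗[ℂ] ω.functor.obj E)
  naturality : ∀ {E F : C} (f : E ⟶ F) x,
    (ω.functor.map f).hom.baseChange R (app E x) = app F ((ω.functor.map f).hom.baseChange R x)
  tensor : ∀ {E F G : C} m, ω.IsTensor E F G m → ∀ x y,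
    app G (bilinBaseChange R m x y) = bilinBaseChange R m (app E x) (app F y)
  unit : ∀ x, app ω.unit x = x

namespace Aut

variable {ω} {R S : Type} [CommRing R] [Algebra ℂ R] [CommRing S] [Algebra ℂ S]

instance : Mul (ω.Aut R) := ⟨fun g h =>
  { app := fun E => g.app E * h.app E
    naturality := fun f x => by simp [g.naturality, h.naturality]
    tensor := fun m hm x y => by simp [g.tensor m hm, h.tensor m hm]
    unit := fun x => by simp [g.unit, h.unit] }⟩

instance : One (ω.Aut R) := ⟨
  { app := fun _ => 1
    naturality := fun _ _ => rfl
    tensor := fun _ _ _ _ => rfl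
    unit := fun _ => rfl }⟩

instance : Inv (ω.Aut R) := ⟨fun g =>
  { app := fun E => (g.app E)⁻¹
    naturality := fun {E F} f x => by
      change _ = (g.app F).symm _
      rw [LinearEquiv.eq_symm_apply, ← g.naturality]
      congr 1
      exact (g.app E).apply_symm_apply x
    tensor := fun {E F G} m hm x y => by
      change (g.app G).symm _ = _
      rw [LinearEquiv.symm_apply_eq, g.tensor m hm]
      congr 1
      · congr 1
        exact ((g.app E).apply_symm_apply x).symm
      · exact ((g.app F).apply_symm_apply y).symm
    unit := fun x => by
      change (g.app ω.unit).symm x = x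
      rw [LinearEquiv.symm_apply_eq, g.unit] }⟩

@[simp] lemma mul_app (g h : ω.Aut R) (E : C) : (g * h).app E = g.app E * h.app E := rfl
@[simp] lemma one_app (E : C) : (1 : ω.Aut R).app E = 1 := rfl
@[simp] lemma inv_app (g : ω.Aut R) (E : C) : (g⁻¹).app E = (g.app E)⁻¹ := rfl

instance : Group (ω.Aut R) where
  mul_assoc a b c := Aut.ext (funext fun E => mul_assoc _ _ _)
  one_mul a := Aut.ext (funext fun E => one_mul _)
  mul_one a := Aut.ext (funext fun E => mul_one _)
  inv_mul_cancel a := Aut.ext (funext fun E => inv_mul_cancel _)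

/-- Base change of a tensor automorphism along `R → S`. -/
def push (f : R →ₐ[ℂ] S) : ω.Aut R →* ω.Aut S where
  toFun g :=
    { app := fun E => pushEquiv f (g.app E)
      naturality := fun {E F} φ x => by
        refine LinearMap.congr_fun (ext_coeffMap f
          (A := (ω.functor.map φ).hom.baseChange S ∘ₗ (pushEquiv f (g.app E)).toLinearMap)
          (B := (pushEquiv f (g.app F)).toLinearMap ∘ₗ (ω.functor.map φ).hom.baseChange S)
          fun x => ?_) x
        simp [baseChange_coeffMap, g.naturality]
      tensor := fun {E F G} m hm x y => by
        have h1 : ∀ x y, pushEquiv f (g.app G) (bilinBaseChange S m (coeffMap _ f x) y) =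
            bilinBaseChange S m (pushEquiv f (g.app E) (coeffMap _ f x))
              (pushEquiv f (g.app F) y) := fun x y => by
          refine LinearMap.congr_fun (ext_coeffMap f
            (A := (pushEquiv f (g.app G)).toLinearMap ∘ₗ bilinBaseChange S m (coeffMap _ f x))
            (B := bilinBaseChange S m (pushEquiv f (g.app E) (coeffMap _ f x)) ∘ₗ
              (pushEquiv f (g.app F)).toLinearMap) fun y => ?_) y
          simp [bilinBaseChange_coeffMap, g.tensor m hm]
        refine LinearMap.congr_fun (ext_coeffMap f
          (A := (pushEquiv f (g.app G)).toLinearMap ∘ₗ (bilinBaseChange S m).flip y)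
          (B := (bilinBaseChange S m).flip (pushEquiv f (g.app F) y) ∘ₗ
            (pushEquiv f (g.app E)).toLinearMap) fun x => ?_) x
        exact h1 x y
      unit := fun x => by
        have : pushEquiv f (g.app ω.unit) = 1 := equiv_ext_coeffMap f fun x => by simp [g.unit]
        rw [this]
        rfl }
  map_one' := Aut.ext (funext fun E => equiv_ext_coeffMap f fun x => by simp)
  map_mul' g h := Aut.ext (funext fun E => equiv_ext_coeffMap f fun x => by simp)

lemma push_app (f : R →ₐ[ℂ] S) (g : ω.Aut R) (E : C) (x : R ⊗[ℂ] ω.functor.obj E) :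
    (push f g).app E (coeffMap _ f x) = coeffMap _ f (g.app E x) := pushEquiv_coeffMap f _ x

end Aut

/-- The group scheme `Aut^⊗(ω)` of tensor automorphisms of `ω`, as a functor from commutative
`ℂ`-algebras to groups. -/
def autGroup : CommAlgCat.{0} ℂ ⥤ GrpCat.{1} where
  obj R := GrpCat.of (ω.Aut R)
  map f := GrpCat.ofHom (Aut.push f.hom)
  map_id R := by
    refine GrpCat.hom_ext (MonoidHom.ext fun g => ?_)
    refine Aut.ext (funext fun E => equiv_ext_coeffMap (AlgHom.id ℂ R) fun x => ?_)
    exact (Aut.push_app (AlgHom.id ℂ R) g E x).trans (by simp [coeffMap])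
  map_comp {R S T} f h := by
    refine GrpCat.hom_ext (MonoidHom.ext fun g => ?_)
    refine Aut.ext (funext fun E => equiv_ext_coeffMap (h.hom.comp f.hom) fun x => ?_)
    have hc : ∀ x, coeffMap (ω.functor.obj E) (h.hom.comp f.hom) x =
        coeffMap _ h.hom (coeffMap _ f.hom x) := fun x => by
      simp only [coeffMap, AlgHom.comp_toLinearMap, LinearMap.rTensor_comp, LinearMap.comp_apply]
    refine (Aut.push_app (h.hom.comp f.hom) g E x).trans ?_
    rw [hc, hc]
    change _ = (Aut.push h.hom (Aut.push f.hom g)).app E _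
    rw [Aut.push_app, Aut.push_app]

end TensorFunctor

/-- A group-valued functor on commutative `ℂ`-algebras is an affine group scheme if it is
represented by a commutative `ℂ`-algebra. -/
def IsAffineGroupScheme (G : CommAlgCat.{0} ℂ ⥤ GrpCat.{1}) : Prop :=
  ∃ H : CommAlgCat.{0} ℂ, Nonempty
    (G ⋙ CategoryTheory.forget GrpCat.{1} ≅ coyoneda.obj (Opposite.op H) ⋙ uliftFunctor.{1, 0})

/-! ## The fundamental group of a differential graded algebra -/

/-- The fibre functor at `p` on the tensor category of flat connections. -/
def DGA.fibre (Ω : DGA) (p : Ω.BasePoint) : TensorFunctor (FlatBimodule Ω) where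
  functor := FlatBimodule.fibreFunctor p
  unit := FlatBimodule.unit Ω
  IsTensor E F G m := ∃ (μ : E.carrier →ₗ[ℂ] F.carrier →ₗ[ℂ] G.carrier)
    (h : FlatBimodule.IsTensor E F G μ), m = h.fibreMap p

/-- The fundamental group `π¹(Ω, p)`: the group scheme of tensor automorphisms of the fibre functor
at `p` on the category of flat connections. -/
def DGA.fundamentalGroup (Ω : DGA) (p : Ω.BasePoint) : CommAlgCat.{0} ℂ ⥤ GrpCat.{1} :=
  (Ω.fibre p).autGroup

/-! ## The algebraic hull of a topological group -/

/-- A continuous representation of a topological group on a finite-dimensional complex vector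
space. Continuity is expressed by the continuity of all matrix coefficients. -/
structure ContRep (K : Type) [Group K] [TopologicalSpace K] where
  carrier : Type
  [addCommGroup : AddCommGroup carrier]
  [module : Module ℂ carrier]
  [finite : FiniteDimensional ℂ carrier]
  ρ : Representation ℂ K carrier
  cont : ∀ (v : carrier) (l : carrier →ₗ[ℂ] ℂ), Continuous fun t => l (ρ t v)

attribute [instance] ContRep.addCommGroup ContRep.module ContRep.finite

namespace ContRep

variable (K : Type) [Group K] [TopologicalSpace K]

instance : Category (ContRep K) where
  Hom V W := Representation.IntertwiningMap V.ρ W.ρ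
  id V := Representation.IntertwiningMap.id V.ρ
  comp f g := g.comp f

/-- The forgetful functor on the tensor category of continuous representations. -/
def forget : TensorFunctor (ContRep K) where
  functor :=
    { obj := fun V => ModuleCat.of ℂ V.carrier
      map := fun f => ModuleCat.ofHom (Representation.IntertwiningMap.toLinearMap f)
      map_id := fun _ => rfl
      map_comp := fun _ _ => rfl }
  unit := { carrier := ℂ, ρ := 1, cont := fun v l => continuous_const (y := l v) }
  IsTensor V W U m := IsTensorProduct m ∧ ∀ t v w, m (V.ρ t v) (W.ρ t w) = U.ρ t (m v w)

end ContRep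

/-- The algebraic hull of a topological group `K`: the group scheme of tensor automorphisms of the
forgetful functor on the category of continuous representations of `K` on finite-dimensional
complex vector spaces. -/
def algebraicHull (K : Type) [Group K] [TopologicalSpace K] : CommAlgCat.{0} ℂ ⥤ GrpCat.{1} :=
  (ContRep.forget K).autGroup

end

noncomputable section

/-- The graded centre `Z_g(Ω)` of a differential graded algebra. -/
def DGA.gradedCentre (Ω : DGA) : Submodule ℂ Ω.carrier := (GradedBimodule.self Ω).gradedCentre

namespace NCTorus

/-- The differential graded algebra `Ω𝒜_θ` of the noncommutative torus. -/
@[reducible] def dga (θ : ℝ) : DGA where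
  carrier := Forms θ
  deg := Forms.deg θ
  d := Forms.d
  d_mem := Forms.d_mem
  d_mul := Forms.d_mul
  d_d := Forms.d_d

/-- The subspace `(Ω𝒜_θ)^{𝕋²}` of forms that are invariant under the action of `𝕋²`. -/
def invariants (θ : ℝ) : Submodule ℂ (Forms θ) where
  carrier := {w | ∀ t, Forms.rot t w = w}
  zero_mem' t := map_zero _
  add_mem' ha hb t := by rw [map_add, ha t, hb t]
  smul_mem' c a ha t := by rw [map_smul, ha t]

/-- The span `V` of `u⁻¹du` and `v⁻¹dv`. -/
def invOneForms (θ : ℝ) : Submodule ℂ (Forms θ) :=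
  Submodule.span ℂ {Forms.uForm θ, Forms.vForm θ}

end NCTorus

end

/-!
The proof determines the graded centre of `Ω𝒜_θ` by comparing Fourier coefficients: since `θ` is
irrational, only the constant multiples of `1`, `u⁻¹du`, `v⁻¹dv` and `u⁻¹du v⁻¹dv` graded-commute
with `u` and `v` (`NCTorus.Forms.gradedCentre_eq`). These are exactly the torus invariants, they
are closed, and they form the exterior algebra on `u⁻¹du` and `v⁻¹dv`.

Since `Z_g(Ω)⁰ = ℂ`, a finitely generated projective graded bimodule `E` is `Ω ⊗ V` with
`V = Z_g(E)⁰` finite-dimensional (`GradedBimodule.centreEquiv`), and morphisms and tensor products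
over `Ω` are the same as those of the spaces `V`. The two Leibniz rules show that `∇` maps `V` to
the degree one part of the graded centre, so that `∇ε = u⁻¹du A₁ε + v⁻¹dv A₂ε` for endomorphisms
`A₁, A₂` of `V`, which commute because `∇² = 0` (`FlatBimodule.conn_comm`). Conversely every
commuting pair occurs, on a free bimodule (`FlatBimodule.exists_of_commute`). A commuting pair
`A₁, A₂` is the pair of infinitesimal generators of a unique continuous representation
`(s, t) ↦ exp(s A₁) exp(t A₂)` of `ℝ²`; linear maps intertwine the generators if and only if they
intertwine the representations, and bilinear maps satisfy the Leibniz rule for the generators if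
and only if they are equivariant (`ContRep.intertwining_iff`, `ContRep.bilin_iff`).

So the fibre functor on flat connections and the forgetful functor on representations of `ℝ²` have
the same objects, morphisms, tensor products and unit over vector spaces. A relation between
objects is enough to express this, and gives an isomorphism of the group schemes of tensor
automorphisms (`TensorFunctor.Correspondence.autGroupIso`). Representability is proved for the
algebraic hull (`isAffineGroupScheme_algebraicHull`): the generic family of pairs of matrices,
indexed by the representations on `ℂⁿ`, becomes a universal tensor automorphism modulo the smallest
ideal over which it is one.
-/

noncomputable section

/-! ### Comparing the tensor automorphisms of two tensor functors -/

namespace TensorFunctor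

section BaseChangeLemmas

variable {R : Type} [CommRing R] [Algebra ℂ R]
variable {V W U V' W' U' : Type} [AddCommGroup V] [Module ℂ V] [AddCommGroup W] [Module ℂ W]
  [AddCommGroup U] [Module ℂ U] [AddCommGroup V'] [Module ℂ V'] [AddCommGroup W'] [Module ℂ W']
  [AddCommGroup U'] [Module ℂ U']

lemma baseChange_bilinBaseChange (φ : V →ₗ[ℂ] V') (ψ : W →ₗ[ℂ] W') (χ : U →ₗ[ℂ] U')
    (m : V →ₗ[ℂ] W →ₗ[ℂ] U) (m' : V' →ₗ[ℂ] W' →ₗ[ℂ] U')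
    (h : ∀ v w, m' (φ v) (ψ w) = χ (m v w)) (x : R ⊗[ℂ] V) (y : R ⊗[ℂ] W) :
    χ.baseChange R (bilinBaseChange R m x y) =
      bilinBaseChange R m' (φ.baseChange R x) (ψ.baseChange R y) := by
  induction x with
  | zero => simp
  | tmul r v =>
    induction y with
    | zero => simp
    | tmul s w => simp [h]
    | add x y hx hy => simp only [map_add, hx, hy]
  | add x y hx hy => simp only [map_add, LinearMap.add_apply, hx, hy]

lemma baseChange_comm_square {f : V →ₗ[ℂ] W} {f' : V' →ₗ[ℂ] W'} {φ : V →ₗ[ℂ] V'}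
    {ψ : W →ₗ[ℂ] W'} (h : ∀ x, f' (φ x) = ψ (f x)) (x : R ⊗[ℂ] V) :
    f'.baseChange R (φ.baseChange R x) = ψ.baseChange R (f.baseChange R x) := by
  rw [← LinearMap.comp_apply, ← LinearMap.comp_apply, ← LinearMap.baseChange_comp,
    ← LinearMap.baseChange_comp]
  congr 2
  exact LinearMap.ext h

end BaseChangeLemmas

/-- A correspondence between two tensor functors: a relation between the objects of the two
categories, each instance of which comes with an identification of the underlying vector spaces.
It is total on both sides, morphisms on either side lift along it, and it respects the unit and the
tensor structure. It plays the role of an equivalence of tensor categories over vector spaces, and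
avoids the choice of a functor. -/
structure Correspondence {C C' : Type 1} [Category.{0} C] [Category.{0} C']
    (ω : TensorFunctor C) (ω' : TensorFunctor C') where
  Rel : ∀ (E : C) (E' : C'), (ω.functor.obj E ≃ₗ[ℂ] ω'.functor.obj E') → Prop
  exists_right : ∀ E, ∃ E' φ, Rel E E' φ
  exists_left : ∀ E', ∃ E φ, Rel E E' φ
  lift_right : ∀ {E F E' F' φ ψ}, Rel E E' φ → Rel F F' ψ → ∀ f : E ⟶ F, ∃ f' : E' ⟶ F',
    ∀ x, (ω'.functor.map f').hom (φ x) = ψ ((ω.functor.map f).hom x)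
  lift_left : ∀ {E F E' F' φ ψ}, Rel E E' φ → Rel F F' ψ → ∀ f' : E' ⟶ F', ∃ f : E ⟶ F,
    ∀ x, (ω'.functor.map f').hom (φ x) = ψ ((ω.functor.map f).hom x)
  tensor_iff : ∀ {E F G E' F' G' φ ψ χ}, Rel E E' φ → Rel F F' ψ → Rel G G' χ →
    ∀ (m : ω.functor.obj E →ₗ[ℂ] ω.functor.obj F →ₗ[ℂ] ω.functor.obj G)
      (m' : ω'.functor.obj E' →ₗ[ℂ] ω'.functor.obj F' →ₗ[ℂ] ω'.functor.obj G'),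
      (∀ x y, m' (φ x) (ψ y) = χ (m x y)) → (ω.IsTensor E F G m ↔ ω'.IsTensor E' F' G' m')
  unit : ∃ φ, Rel ω.unit ω'.unit φ

namespace Correspondence

variable {C C' : Type 1} [Category.{0} C] [Category.{0} C']
  {ω : TensorFunctor C} {ω' : TensorFunctor C'}

/-- The inverse correspondence. -/
def swap (c : Correspondence ω ω') : Correspondence ω' ω where
  Rel E' E φ := c.Rel E E' φ.symm
  exists_right E' := by
    obtain ⟨E, φ, h⟩ := c.exists_left E'
    exact ⟨E, φ.symm, by simpa using h⟩
  exists_left E := by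
    obtain ⟨E', φ, h⟩ := c.exists_right E
    exact ⟨E', φ.symm, by simpa using h⟩
  lift_right {_ _ _ _ φ ψ} h k f' := by
    obtain ⟨f, hf⟩ := c.lift_left h k f'
    exact ⟨f, fun x => by simpa using (congrArg ψ (hf (φ x))).symm⟩
  lift_left {_ _ _ _ φ ψ} h k f := by
    obtain ⟨f', hf⟩ := c.lift_right h k f
    exact ⟨f', fun x => by simpa using (congrArg ψ (hf (φ x))).symm⟩
  tensor_iff {_ _ _ _ _ _ φ ψ χ} h k l m' m e := by
    refine (c.tensor_iff h k l m m' fun x y => ?_).symm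
    have := e (φ.symm x) (ψ.symm y)
    simp only [LinearEquiv.apply_symm_apply] at this
    rw [this]
    simp
  unit := by
    obtain ⟨φ, h⟩ := c.unit
    exact ⟨φ.symm, by simpa using h⟩

variable (c : Correspondence ω ω') {R : Type} [CommRing R] [Algebra ℂ R]

/-- An automorphism of `R ⊗ ω(E)`, carried over to `R ⊗ ω'(E')`. -/
def conj {V V' : Type} [AddCommGroup V] [Module ℂ V] [AddCommGroup V'] [Module ℂ V']
    (φ : V ≃ₗ[ℂ] V') (A : (R ⊗[ℂ] V) ≃ₗ[R] (R ⊗[ℂ] V)) : (R ⊗[ℂ] V') ≃ₗ[R] (R ⊗[ℂ] V') :=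
  (φ.baseChange ℂ R V V').symm ≪≫ₗ A ≪≫ₗ φ.baseChange ℂ R V V'

lemma conj_baseChange {V V' : Type} [AddCommGroup V] [Module ℂ V] [AddCommGroup V'] [Module ℂ V']
    (φ : V ≃ₗ[ℂ] V') (A : (R ⊗[ℂ] V) ≃ₗ[R] (R ⊗[ℂ] V)) (x : R ⊗[ℂ] V) :
    conj φ A (φ.toLinearMap.baseChange R x) = φ.toLinearMap.baseChange R (A x) := by
  have : φ.toLinearMap.baseChange R x = φ.baseChange ℂ R V V' x := rfl
  rw [this]
  simp only [conj, LinearEquiv.trans_apply, LinearEquiv.symm_apply_apply]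
  rfl

lemma baseChange_surjective {V V' : Type} [AddCommGroup V] [Module ℂ V] [AddCommGroup V']
    [Module ℂ V'] (φ : V ≃ₗ[ℂ] V') : Function.Surjective (φ.toLinearMap.baseChange R) :=
  (φ.baseChange ℂ R V V').surjective

lemma conj_natural (c : Correspondence ω ω') (g : ω.Aut R) {E F E' F' φ ψ}
    (h : c.Rel E E' φ) (k : c.Rel F F' ψ)
    (f' : E' ⟶ F') (x : R ⊗[ℂ] ω'.functor.obj E') :
    (ω'.functor.map f').hom.baseChange R (conj φ (g.app E) x) =
      conj ψ (g.app F) ((ω'.functor.map f').hom.baseChange R x) := by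
  obtain ⟨f, hf⟩ := c.lift_left h k f'
  obtain ⟨x, rfl⟩ := baseChange_surjective φ x
  rw [conj_baseChange, baseChange_comm_square (φ := φ.toLinearMap) (ψ := ψ.toLinearMap) hf,
    g.naturality, baseChange_comm_square (φ := φ.toLinearMap) (ψ := ψ.toLinearMap) hf,
    conj_baseChange]

lemma conj_unique (g : ω.Aut R) {E F E' φ ψ} (h : c.Rel E E' φ) (k : c.Rel F E' ψ) :
    conj φ (g.app E) = conj ψ (g.app F) := by
  refine LinearEquiv.ext fun x => ?_
  simpa using c.conj_natural g h k (𝟙 E') x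

/-- The tensor automorphism of `ω'` that corresponds to a tensor automorphism of `ω`. -/
def transfer (g : ω.Aut R) : ω'.Aut R where
  app E' := conj (c.exists_left E').choose_spec.choose (g.app (c.exists_left E').choose)
  naturality {E' F'} f' x := c.conj_natural g (c.exists_left E').choose_spec.choose_spec
    (c.exists_left F').choose_spec.choose_spec f' x
  tensor {E' F' G'} m' hm' x y := by
    have hE := (c.exists_left E').choose_spec.choose_spec
    have hF := (c.exists_left F').choose_spec.choose_spec
    have hG := (c.exists_left G').choose_spec.choose_spec
    generalize (c.exists_left E').choose_spec.choose = φ at *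
    generalize (c.exists_left F').choose_spec.choose = ψ at *
    generalize (c.exists_left G').choose_spec.choose = χ at *
    obtain ⟨x, rfl⟩ := baseChange_surjective φ x
    obtain ⟨y, rfl⟩ := baseChange_surjective ψ y
    have e : ∀ x y, m' (φ x) (ψ y) =
        χ (((m'.compl₁₂ φ.toLinearMap ψ.toLinearMap).compr₂ χ.symm.toLinearMap) x y) := by
      intro x y; simp
    have hm := (c.tensor_iff hE hF hG _ m' e).2 hm'
    rw [conj_baseChange, conj_baseChange, ← baseChange_bilinBaseChange φ.toLinearMap ψ.toLinearMap
      χ.toLinearMap _ m' e, ← baseChange_bilinBaseChange φ.toLinearMap ψ.toLinearMap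
      χ.toLinearMap _ m' e, conj_baseChange, g.tensor _ hm]
  unit x := by
    obtain ⟨φ, h⟩ := c.unit
    rw [c.conj_unique g (c.exists_left ω'.unit).choose_spec.choose_spec h]
    obtain ⟨x, rfl⟩ := baseChange_surjective φ x
    rw [conj_baseChange, g.unit]

lemma transfer_app (g : ω.Aut R) {E E' φ} (h : c.Rel E E' φ) :
    (c.transfer g).app E' = conj φ (g.app E) :=
  c.conj_unique g (c.exists_left E').choose_spec.choose_spec h

lemma transfer_app_baseChange (g : ω.Aut R) {E E' φ} (h : c.Rel E E' φ)
    (x : R ⊗[ℂ] ω.functor.obj E) : (c.transfer g).app E' (φ.toLinearMap.baseChange R x) =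
      φ.toLinearMap.baseChange R (g.app E x) := by
  rw [c.transfer_app g h, conj_baseChange]

lemma swap_transfer_transfer (g : ω.Aut R) : c.swap.transfer (c.transfer g) = g := by
  refine Aut.ext (funext fun E => LinearEquiv.ext fun x => ?_)
  obtain ⟨E', φ, h⟩ := c.exists_right E
  have h' : c.swap.Rel E' E φ.symm := by
    change c.Rel E E' φ.symm.symm
    simpa using h
  refine (φ.baseChange ℂ R _ _).injective ?_
  change φ.toLinearMap.baseChange R _ = φ.toLinearMap.baseChange R _
  rw [← c.transfer_app_baseChange g h]
  have e : ∀ y, φ.symm.toLinearMap.baseChange R (φ.toLinearMap.baseChange R y) = y := fun y =>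
    (φ.baseChange ℂ R _ _).symm_apply_apply y
  have e' : ∀ y, φ.toLinearMap.baseChange R (φ.symm.toLinearMap.baseChange R y) = y := fun y =>
    (φ.baseChange ℂ R _ _).apply_symm_apply y
  conv_lhs => rw [← e x, c.swap.transfer_app_baseChange _ h', e']

lemma transfer_swap_transfer (g : ω'.Aut R) : c.transfer (c.swap.transfer g) = g := by
  exact c.swap.swap_transfer_transfer g

lemma transfer_mul (g h : ω.Aut R) : c.transfer (g * h) = c.transfer g * c.transfer h := by
  refine Aut.ext (funext fun E' => LinearEquiv.ext fun x => ?_)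
  obtain ⟨E, φ, k⟩ := c.exists_left E'
  obtain ⟨x, rfl⟩ := baseChange_surjective φ x
  simp only [Aut.mul_app, LinearEquiv.mul_apply]
  rw [c.transfer_app_baseChange _ k, c.transfer_app_baseChange _ k, c.transfer_app_baseChange _ k]
  rfl

lemma transfer_push {S : Type} [CommRing S] [Algebra ℂ S] (f : R →ₐ[ℂ] S) (g : ω.Aut R) :
    c.transfer (Aut.push f g) = Aut.push f (c.transfer g) := by
  refine Aut.ext (funext fun E' => equiv_ext_coeffMap f fun x => ?_)
  obtain ⟨E, φ, k⟩ := c.exists_left E'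
  obtain ⟨x, rfl⟩ := baseChange_surjective φ x
  rw [Aut.push_app, ← baseChange_coeffMap, c.transfer_app_baseChange _ k,
    c.transfer_app_baseChange _ k, Aut.push_app, baseChange_coeffMap]

/-- Tensor functors in correspondence have isomorphic group schemes of tensor automorphisms. -/
def autGroupIso : ω.autGroup ≅ ω'.autGroup :=
  NatIso.ofComponents
    (fun R => MulEquiv.toGrpIso
      (X := GrpCat.of (ω.Aut R)) (Y := GrpCat.of (ω'.Aut R))
      { toFun := c.transfer
        invFun := c.swap.transfer
        left_inv := c.swap_transfer_transfer
        right_inv := c.transfer_swap_transfer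
        map_mul' := c.transfer_mul })
    (fun f => GrpCat.hom_ext (MonoidHom.ext fun g => c.transfer_push f.hom g))

end Correspondence

end TensorFunctor

end

noncomputable section

/-! ### Representability of the group of tensor automorphisms -/

section Coordinates

variable {V : Type} [AddCommGroup V] [Module ℂ V] {R S : Type} [CommRing R] [Algebra ℂ R]
  [CommRing S] [Algebra ℂ S] {ι : Type}

lemma repr_coeffMap (b : Module.Basis ι ℂ V) (f : R →ₐ[ℂ] S) (x : R ⊗[ℂ] V) (i : ι) :
    (Algebra.TensorProduct.basis S b).repr (coeffMap V f x) i =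
      f ((Algebra.TensorProduct.basis R b).repr x i) := by
  induction x with
  | zero => simp
  | tmul r v => simp [Algebra.TensorProduct.basis_repr_tmul]
  | add x y hx hy => simp only [map_add, Finsupp.add_apply, hx, hy]

lemma eq_of_coeffMap_eq {κ : Type} {T : κ → Type} [∀ k, CommRing (T k)] [∀ k, Algebra ℂ (T k)]
    (f : ∀ k, R →ₐ[ℂ] T k) (hf : ∀ r, (∀ k, f k r = 0) → r = 0) {x y : R ⊗[ℂ] V}
    (h : ∀ k, coeffMap V (f k) x = coeffMap V (f k) y) : x = y := by
  let b := Module.Basis.ofVectorSpace ℂ V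
  refine (Algebra.TensorProduct.basis R b).repr.injective (Finsupp.ext fun i => ?_)
  refine sub_eq_zero.1 (hf _ fun k => ?_)
  rw [map_sub, ← repr_coeffMap, ← repr_coeffMap, h, sub_self]

lemma toMatrix_pushEnd [Fintype ι] [DecidableEq ι] (b : Module.Basis ι ℂ V) (f : R →ₐ[ℂ] S)
    (A : R ⊗[ℂ] V →ₗ[R] R ⊗[ℂ] V) (i j : ι) :
    LinearMap.toMatrix (Algebra.TensorProduct.basis S b) (Algebra.TensorProduct.basis S b)
      (pushEnd f A) i j =
    f (LinearMap.toMatrix (Algebra.TensorProduct.basis R b) (Algebra.TensorProduct.basis R b)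
      A i j) := by
  have : (1 : S) ⊗ₜ[ℂ] b j = coeffMap V f (1 ⊗ₜ b j) := by simp
  rw [LinearMap.toMatrix_apply, LinearMap.toMatrix_apply, Algebra.TensorProduct.basis_apply,
    Algebra.TensorProduct.basis_apply, this, pushEnd_coeffMap, repr_coeffMap]

lemma pushEnd_pushEnd {T : Type} [CommRing T] [Algebra ℂ T] (f : R →ₐ[ℂ] S) (h : S →ₐ[ℂ] T)
    (A : R ⊗[ℂ] V →ₗ[R] R ⊗[ℂ] V) : pushEnd h (pushEnd f A) = pushEnd (h.comp f) A := by
  have hc : ∀ x : R ⊗[ℂ] V, coeffMap V (h.comp f) x = coeffMap V h (coeffMap V f x) := fun x => by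
    simp only [coeffMap, AlgHom.comp_toLinearMap, LinearMap.rTensor_comp, LinearMap.comp_apply]
  refine ext_coeffMap (h.comp f) fun x => ?_
  rw [pushEnd_coeffMap, hc, pushEnd_coeffMap, pushEnd_coeffMap, hc]

end Coordinates

namespace TensorFunctor

variable {C : Type 1} [Category.{0} C] (ω : TensorFunctor C) {I : Type} (X : I → C)
  {R S T : Type} [CommRing R] [Algebra ℂ R] [CommRing S] [Algebra ℂ S] [CommRing T] [Algebra ℂ T]

/-- Families, indexed by `i : I`, of pairs of `R`-linear endomorphisms of `R ⊗ ω(X i)`. A tensor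
automorphism is recorded by the family of its components at the `X i` and their inverses. -/
def Fam (R : Type) [CommRing R] [Algebra ℂ R] : Type :=
  ∀ i, (R ⊗[ℂ] ω.functor.obj (X i) →ₗ[R] R ⊗[ℂ] ω.functor.obj (X i)) ×
    (R ⊗[ℂ] ω.functor.obj (X i) →ₗ[R] R ⊗[ℂ] ω.functor.obj (X i))

variable {ω X}

/-- Base change of a family along `R → S`. -/
def Fam.push (f : R →ₐ[ℂ] S) (F : ω.Fam X R) : ω.Fam X S :=
  fun i => (pushEnd f (F i).1, pushEnd f (F i).2)

lemma Fam.push_push (f : R →ₐ[ℂ] S) (h : S →ₐ[ℂ] T) (F : ω.Fam X R) :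
    (F.push f).push h = F.push (h.comp f) :=
  funext fun _ => Prod.ext (pushEnd_pushEnd f h _) (pushEnd_pushEnd f h _)

variable (X) in
/-- The family of components of a tensor automorphism. -/
def Aut.fam (g : ω.Aut R) : ω.Fam X R :=
  fun i => ((g.app (X i)).toLinearMap, (g.app (X i)).symm.toLinearMap)

lemma Aut.fam_push (f : R →ₐ[ℂ] S) (g : ω.Aut R) : (Aut.push f g).fam X = (g.fam X).push f := rfl

lemma Aut.app_eq_conj (g : ω.Aut R) {E F : C} (e : E ≅ F) :
    g.app F = Correspondence.conj (ω.functor.mapIso e).toLinearEquiv (g.app E) := by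
  refine LinearEquiv.ext fun x => ?_
  obtain ⟨x, rfl⟩ := Correspondence.baseChange_surjective (ω.functor.mapIso e).toLinearEquiv x
  rw [Correspondence.conj_baseChange]
  exact (g.naturality e.hom x).symm

lemma Aut.fam_injective (hX : ∀ E, ∃ i, Nonempty (X i ≅ E)) :
    Function.Injective (Aut.fam X : ω.Aut R → ω.Fam X R) := by
  intro g h e
  refine Aut.ext (funext fun E => ?_)
  obtain ⟨i, ⟨φ⟩⟩ := hX E
  rw [g.app_eq_conj φ, h.app_eq_conj φ]
  congr 1
  exact LinearEquiv.toLinearMap_injective (congrArg Prod.fst (congrFun e i))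

/-- Whether a family comes from a tensor automorphism can be tested after base change along a
jointly injective family of homomorphisms. -/
lemma exists_aut_of_jointly_injective (hX : ∀ E, ∃ i, Nonempty (X i ≅ E)) {κ : Type}
    {T : κ → Type} [∀ k, CommRing (T k)] [∀ k, Algebra ℂ (T k)] (f : ∀ k, R →ₐ[ℂ] T k)
    (hf : ∀ r, (∀ k, f k r = 0) → r = 0) (F : ω.Fam X R)
    (h : ∀ k, ∃ g : ω.Aut (T k), g.fam X = F.push (f k)) : ∃ g : ω.Aut R, g.fam X = F := by
  choose g hg using h
  choose i φ using hX
  have h1 : ∀ k i x, coeffMap _ (f k) ((F i).1 x) = (g k).app (X i) (coeffMap _ (f k) x) := by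
    intro k i x
    rw [← pushEnd_coeffMap]
    exact (LinearMap.congr_fun (congrArg Prod.fst (congrFun (hg k) i)) _).symm
  have h2 : ∀ k i x, coeffMap _ (f k) ((F i).2 x) =
      ((g k).app (X i)).symm (coeffMap _ (f k) x) := by
    intro k i x
    rw [← pushEnd_coeffMap]
    exact (LinearMap.congr_fun (congrArg Prod.snd (congrFun (hg k) i)) _).symm
  let A : ∀ i, (R ⊗[ℂ] ω.functor.obj (X i)) ≃ₗ[R] (R ⊗[ℂ] ω.functor.obj (X i)) := fun i =>
    LinearEquiv.ofLinearMap (F i).1 (F i).2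
      (LinearMap.ext fun x => eq_of_coeffMap_eq f hf fun k => by simp [h1, h2])
      (LinearMap.ext fun x => eq_of_coeffMap_eq f hf fun k => by simp [h1, h2])
  let B : ∀ E, (R ⊗[ℂ] ω.functor.obj E) ≃ₗ[R] (R ⊗[ℂ] ω.functor.obj E) := fun E =>
    Correspondence.conj (ω.functor.mapIso (φ E).some).toLinearEquiv (A (i E))
  have hB : ∀ k E x, coeffMap _ (f k) (B E x) = (g k).app E (coeffMap _ (f k) x) := by
    intro k E x
    obtain ⟨x, rfl⟩ := Correspondence.baseChange_surjective
      (ω.functor.mapIso (φ E).some).toLinearEquiv x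
    rw [(g k).app_eq_conj (φ E).some, Correspondence.conj_baseChange, ← baseChange_coeffMap,
      ← baseChange_coeffMap, Correspondence.conj_baseChange]
    exact congrArg _ (h1 k (i E) x)
  refine ⟨⟨B, fun φ x => ?_, fun m hm x y => ?_, fun x => ?_⟩, funext fun i => Prod.ext ?_ ?_⟩
  · refine eq_of_coeffMap_eq f hf fun k => ?_
    rw [← baseChange_coeffMap, hB, hB, (g k).naturality, baseChange_coeffMap]
  · refine eq_of_coeffMap_eq f hf fun k => ?_
    rw [hB, ← bilinBaseChange_coeffMap, (g k).tensor m hm, ← bilinBaseChange_coeffMap, hB, hB]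
  · refine eq_of_coeffMap_eq f hf fun k => ?_
    rw [hB, (g k).unit]
  · refine LinearMap.ext fun x => eq_of_coeffMap_eq f hf fun k => ?_
    exact (hB k _ x).trans (h1 k i x).symm
  · refine LinearMap.ext fun x => eq_of_coeffMap_eq f hf fun k => ?_
    rw [h2, LinearEquiv.eq_symm_apply]
    change (g k).app (X i) (coeffMap _ (f k) ((B (X i)).symm x)) = _
    rw [← hB, LinearEquiv.apply_symm_apply]

section Generic

variable (ω X) [∀ i, Module.Finite ℂ (ω.functor.obj (X i))]

/-- The polynomial ring in the matrix entries of a generic family. -/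
abbrev FamRing : Type :=
  MvPolynomial (Σ i, Bool × Fin (Module.finrank ℂ (ω.functor.obj (X i))) ×
    Fin (Module.finrank ℂ (ω.functor.obj (X i)))) ℂ

/-- The basis of `R ⊗ ω(X i)` in which matrices are taken. -/
def famBasis (R : Type) [CommRing R] [Algebra ℂ R] (i : I) :
    Module.Basis (Fin (Module.finrank ℂ (ω.functor.obj (X i)))) R (R ⊗[ℂ] ω.functor.obj (X i)) :=
  Algebra.TensorProduct.basis R (Module.finBasis ℂ (ω.functor.obj (X i)))

/-- The generic family. -/
def genericFam : ω.Fam X (ω.FamRing X) := fun i =>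
  (Matrix.toLin (ω.famBasis X _ i) (ω.famBasis X _ i)
      (Matrix.of fun r s => MvPolynomial.X ⟨i, true, r, s⟩),
    Matrix.toLin (ω.famBasis X _ i) (ω.famBasis X _ i)
      (Matrix.of fun r s => MvPolynomial.X ⟨i, false, r, s⟩))

lemma toMatrix_push_genericFam (x : ω.FamRing X →ₐ[ℂ] R) (i : I)
    (r s : Fin (Module.finrank ℂ (ω.functor.obj (X i)))) :
    LinearMap.toMatrix (ω.famBasis X R i) (ω.famBasis X R i) (((ω.genericFam X).push x) i).1 r s =
      x (MvPolynomial.X ⟨i, true, r, s⟩) ∧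
    LinearMap.toMatrix (ω.famBasis X R i) (ω.famBasis X R i) (((ω.genericFam X).push x) i).2 r s =
      x (MvPolynomial.X ⟨i, false, r, s⟩) := by
  constructor
  · refine (toMatrix_pushEnd _ x _ r s).trans ?_
    change x (LinearMap.toMatrix (ω.famBasis X _ i) (ω.famBasis X _ i) (ω.genericFam X i).1 r s) = _
    simp [genericFam]
  · refine (toMatrix_pushEnd _ x _ r s).trans ?_
    change x (LinearMap.toMatrix (ω.famBasis X _ i) (ω.famBasis X _ i) (ω.genericFam X i).2 r s) = _
    simp [genericFam]

lemma push_genericFam_injective {x y : ω.FamRing X →ₐ[ℂ] R}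
    (h : (ω.genericFam X).push x = (ω.genericFam X).push y) : x = y := by
  refine MvPolynomial.algHom_ext fun ⟨i, c, r, s⟩ => ?_
  cases c
  · rw [← (toMatrix_push_genericFam ω X x i r s).2, h, (toMatrix_push_genericFam ω X y i r s).2]
  · rw [← (toMatrix_push_genericFam ω X x i r s).1, h, (toMatrix_push_genericFam ω X y i r s).1]

lemma exists_push_genericFam (F : ω.Fam X R) :
    ∃ x : ω.FamRing X →ₐ[ℂ] R, (ω.genericFam X).push x = F := by
  refine ⟨MvPolynomial.aeval fun v => LinearMap.toMatrix (ω.famBasis X R v.1) (ω.famBasis X R v.1)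
    (bif v.2.1 then (F v.1).1 else (F v.1).2) v.2.2.1 v.2.2.2, funext fun i => Prod.ext ?_ ?_⟩
  · refine (LinearMap.toMatrix (ω.famBasis X R i) (ω.famBasis X R i)).injective
      (Matrix.ext fun r s => ?_)
    rw [(toMatrix_push_genericFam ω X _ i r s).1]
    simp
  · refine (LinearMap.toMatrix (ω.famBasis X R i) (ω.famBasis X R i)).injective
      (Matrix.ext fun r s => ?_)
    rw [(toMatrix_push_genericFam ω X _ i r s).2]
    simp

/-- The intersection of all ideals modulo which the generic family comes from a tensor
automorphism. It is itself such an ideal, hence the smallest one. -/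
def autIdeal : Ideal (ω.FamRing X) :=
  sInf {K | ∃ g : ω.Aut (ω.FamRing X ⧸ K),
    g.fam X = (ω.genericFam X).push (Ideal.Quotient.mkₐ ℂ K)}

variable {ω X}

/-- The universal tensor automorphism. -/
lemma exists_universal_aut (hX : ∀ E, ∃ i, Nonempty (X i ≅ E)) :
    ∃ g : ω.Aut (ω.FamRing X ⧸ ω.autIdeal X),
      g.fam X = (ω.genericFam X).push (Ideal.Quotient.mkₐ ℂ (ω.autIdeal X)) := by
  let κ := {K : Ideal (ω.FamRing X) // ∃ g : ω.Aut (ω.FamRing X ⧸ K),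
    g.fam X = (ω.genericFam X).push (Ideal.Quotient.mkₐ ℂ K)}
  refine exists_aut_of_jointly_injective hX (κ := κ) (T := fun K => ω.FamRing X ⧸ K.1)
    (fun K => Ideal.Quotient.factorₐ ℂ (show ω.autIdeal X ≤ K.1 from sInf_le K.2))
    (fun r hr => ?_) _ fun K => ?_
  · obtain ⟨r, rfl⟩ := Ideal.Quotient.mk_surjective r
    refine Ideal.Quotient.eq_zero_iff_mem.2 (Submodule.mem_sInf.2 fun K hK => ?_)
    exact Ideal.Quotient.eq_zero_iff_mem.1 (hr ⟨K, hK⟩)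
  · obtain ⟨g, hg⟩ := K.2
    refine ⟨g, ?_⟩
    rw [hg, Fam.push_push]
    rfl

lemma autIdeal_le_ker (hX : ∀ E, ∃ i, Nonempty (X i ≅ E)) (g : ω.Aut R)
    (x : ω.FamRing X →ₐ[ℂ] R) (hx : (ω.genericFam X).push x = g.fam X) :
    ω.autIdeal X ≤ RingHom.ker x := by
  refine sInf_le ?_
  refine exists_aut_of_jointly_injective hX (κ := Unit) (T := fun _ => R)
    (fun _ => Ideal.kerLiftAlg x) (fun r hr => ?_) _ fun K => ⟨g, ?_⟩
  · exact (injective_iff_map_eq_zero _).1 (Ideal.kerLiftAlg_injective x) r (hr ())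
  · rw [Fam.push_push, ← hx]
    rfl

end Generic

/-- If the isomorphism classes of objects form a set and the fibres are finite-dimensional, then
the tensor automorphisms form an affine group scheme. -/
theorem isAffineGroupScheme_autGroup (ω : TensorFunctor C) (X : I → C)
    [∀ i, Module.Finite ℂ (ω.functor.obj (X i))]
    (hX : ∀ E, ∃ i, Nonempty (X i ≅ E)) : IsAffineGroupScheme ω.autGroup := by
  obtain ⟨u, hu⟩ := exists_universal_aut (ω := ω) (X := X) hX
  refine ⟨CommAlgCat.of ℂ (ω.FamRing X ⧸ ω.autIdeal X), ⟨(NatIso.ofComponents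
    (fun R => Equiv.toIso (Equiv.ofBijective
      (fun h : ULift.{1} (CommAlgCat.of ℂ (ω.FamRing X ⧸ ω.autIdeal X) ⟶ R) =>
        (Aut.push h.down.hom u : ω.Aut R)) ⟨?_, ?_⟩)) ?_).symm⟩⟩
  · rintro ⟨h⟩ ⟨k⟩ e
    have e' := congrArg (Aut.fam X) e
    simp only [Aut.fam_push, hu, Fam.push_push] at e'
    have := push_genericFam_injective ω X e'
    congr 1
    refine CommAlgCat.hom_ext (AlgHom.ext fun r => ?_)
    obtain ⟨r, rfl⟩ := Ideal.Quotient.mk_surjective r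
    exact AlgHom.congr_fun this r
  · intro g
    obtain ⟨x, hx⟩ := exists_push_genericFam ω X (g.fam X)
    have hle := autIdeal_le_ker hX g x hx
    refine ⟨⟨CommAlgCat.ofHom (Ideal.Quotient.liftₐ (ω.autIdeal X) x fun a ha => hle ha)⟩,
      Aut.fam_injective hX ?_⟩
    simp only [Aut.fam_push, hu, Fam.push_push, ← hx]
    rfl
  · intro R S f
    ext ⟨h⟩
    exact congrArg (fun k => k.hom u) (ω.autGroup.map_comp h f)

end TensorFunctor

/-- The algebraic hull of a topological group is an affine group scheme: every representation is
isomorphic to one on some `ℂⁿ`. -/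
theorem isAffineGroupScheme_algebraicHull (K : Type) [Group K] [TopologicalSpace K] :
    IsAffineGroupScheme (algebraicHull K) := by
  let X : (Σ n, {ρ : Representation ℂ K (Fin n → ℂ) //
      ∀ (v : Fin n → ℂ) (l : (Fin n → ℂ) →ₗ[ℂ] ℂ), Continuous fun t => l (ρ t v)}) → ContRep K :=
    fun i => { carrier := Fin i.1 → ℂ, ρ := i.2.1, cont := i.2.2 }
  have : ∀ i, Module.Finite ℂ ((ContRep.forget K).functor.obj (X i)) := fun i =>
    inferInstanceAs (FiniteDimensional ℂ (Fin i.1 → ℂ))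
  refine TensorFunctor.isAffineGroupScheme_autGroup (ContRep.forget K) X fun E => ?_
  let b := (Module.finBasis ℂ E.carrier).equivFun
  let ρ : Representation ℂ K (Fin (Module.finrank ℂ E.carrier) → ℂ) :=
    { toFun := fun t => b.toLinearMap ∘ₗ E.ρ t ∘ₗ b.symm.toLinearMap
      map_one' := by ext; simp
      map_mul' := fun s t => LinearMap.ext fun v => by simp }
  refine ⟨⟨_, ρ, fun v l => E.cont (b.symm v) (l ∘ₗ b.toLinearMap)⟩, ⟨⟨?_, ?_, ?_, ?_⟩⟩⟩
  · exact ⟨b.symm.toLinearMap, fun t => LinearMap.ext fun v => by simp [X, ρ]⟩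
  · exact ⟨b.toLinearMap, fun t => LinearMap.ext fun v => by simp [X, ρ]⟩
  · exact Representation.IntertwiningMap.ext (LinearMap.ext fun v => b.apply_symm_apply v)
  · exact Representation.IntertwiningMap.ext (LinearMap.ext fun v => b.symm_apply_apply v)

end

noncomputable section

/-! ### One-parameter groups of linear maps -/

/-- A one-parameter group of endomorphisms. -/
structure IsOneParam {V : Type} [AddCommGroup V] [Module ℂ V] (U : ℝ → V →ₗ[ℂ] V) : Prop where
  zero : U 0 = 1
  add : ∀ s t, U (s + t) = U s * U t

/-- `A` is the infinitesimal generator of `U`. The derivative is taken weakly, that is, after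
applying linear functionals, so that no norm on `V` has to be chosen. -/
def IsGen {V : Type} [AddCommGroup V] [Module ℂ V] (U : ℝ → V →ₗ[ℂ] V) (A : V →ₗ[ℂ] V) : Prop :=
  ∀ (v : V) (l : V →ₗ[ℂ] ℂ), HasDerivAt (fun s => l (U s v)) (l (A v)) 0

section

variable {V W Y : Type} [AddCommGroup V] [Module ℂ V] [AddCommGroup W] [Module ℂ W]
  [AddCommGroup Y] [Module ℂ Y]

lemma eq_of_forall_functional {v w : V} (h : ∀ l : V →ₗ[ℂ] ℂ, l v = l w) : v = w := by
  rw [← sub_eq_zero, ← Module.forall_dual_apply_eq_zero_iff ℂ]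
  intro l
  rw [map_sub, h, sub_self]

/-- The product rule for weak derivatives and bilinear maps. -/
lemma hasDerivAt_bilin [FiniteDimensional ℂ V] {c : ℝ → V} {d : ℝ → W} {c' : V} {d' : W} {s : ℝ}
    (m : V →ₗ[ℂ] W →ₗ[ℂ] ℂ)
    (hc : ∀ l : V →ₗ[ℂ] ℂ, HasDerivAt (fun s => l (c s)) (l c') s)
    (hd : ∀ l : W →ₗ[ℂ] ℂ, HasDerivAt (fun s => l (d s)) (l d') s) :
    HasDerivAt (fun s => m (c s) (d s)) (m c' (d s) + m (c s) d') s := by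
  let b := Module.finBasis ℂ V
  have e : ∀ x y, m x y = ∑ i, b.coord i x * m (b i) y := by
    intro x y
    conv_lhs => rw [← b.sum_repr x]
    simp only [map_sum, map_smul, LinearMap.sum_apply, LinearMap.smul_apply, smul_eq_mul]
    rfl
  have h : HasDerivAt (fun s => ∑ i, b.coord i (c s) * m (b i) (d s))
      (∑ i, (b.coord i c' * m (b i) (d s) + b.coord i (c s) * m (b i) d')) s := by
    refine HasDerivAt.fun_sum fun i _ => ?_
    exact (hc (b.coord i)).mul (hd (m (b i)))
  rw [e c', e (c s), ← Finset.sum_add_distrib]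
  simpa only [← e] using h

namespace IsOneParam

variable {U : ℝ → V →ₗ[ℂ] V} {A : V →ₗ[ℂ] V}

lemma add_apply (h : IsOneParam U) (s t : ℝ) (v : V) : U (s + t) v = U s (U t v) := by
  rw [h.add]; rfl

lemma neg_apply (h : IsOneParam U) (s : ℝ) (v : V) : U (-s) (U s v) = v := by
  rw [← h.add_apply, neg_add_cancel, h.zero]; rfl

lemma hasDerivAt (h : IsOneParam U) (hA : IsGen U A) (v : V) (l : V →ₗ[ℂ] ℂ) (s : ℝ) :
    HasDerivAt (fun s => l (U s v)) (l (U s (A v))) s := by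
  have h1 := hA v (l ∘ₗ U s)
  have h2 : HasDerivAt (fun t : ℝ => t - s) 1 s := (hasDerivAt_id s).sub_const s
  have h3 := HasDerivAt.scomp_of_eq s h1 h2 (sub_self s).symm
  simp only [one_smul] at h3
  refine h3.congr_of_eventuallyEq (Filter.Eventually.of_forall fun t => ?_)
  simp only [Function.comp, LinearMap.comp_apply]
  rw [← h.add_apply, add_sub_cancel]

lemma gen_comm (h : IsOneParam U) (hA : IsGen U A) (s : ℝ) (v : V) : U s (A v) = A (U s v) := by
  refine eq_of_forall_functional fun l => ?_
  have h1 := hA v (l ∘ₗ U s)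
  have h2 := hA (U s v) l
  refine h1.unique (h2.congr_of_eventuallyEq (Filter.Eventually.of_forall fun t => ?_))
  simp only [LinearMap.comp_apply]
  rw [← h.add_apply, ← h.add_apply, add_comm]

/-- A bilinear map for which the generators satisfy the Leibniz rule is compatible with the
one-parameter groups. -/
lemma bilin_of_gen [FiniteDimensional ℂ V] [FiniteDimensional ℂ W] [FiniteDimensional ℂ Y]
    {U : ℝ → V →ₗ[ℂ] V} {U' : ℝ → W →ₗ[ℂ] W} {U'' : ℝ → Y →ₗ[ℂ] Y}
    {A : V →ₗ[ℂ] V} {A' : W →ₗ[ℂ] W} {A'' : Y →ₗ[ℂ] Y}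
    (h : IsOneParam U) (h' : IsOneParam U') (h'' : IsOneParam U'')
    (hA : IsGen U A) (hA' : IsGen U' A') (hA'' : IsGen U'' A'') (m : V →ₗ[ℂ] W →ₗ[ℂ] Y)
    (hm : ∀ v w, m (A v) w + m v (A' w) = A'' (m v w)) (s : ℝ) (v : V) (w : W) :
    m (U s v) (U' s w) = U'' s (m v w) := by
  have h1 : ∀ (l : Y →ₗ[ℂ] ℂ) s, HasDerivAt (fun s => l (m (U s v) (U' s w)))
      (l (A'' (m (U s v) (U' s w)))) s := by
    intro l s
    refine (hasDerivAt_bilin (s := s) (m.compr₂ l) (fun l => h.hasDerivAt hA v l s)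
      (fun l => h'.hasDerivAt hA' w l s)).congr_deriv ?_
    change l (m _ _) + l (m _ _) = _
    rw [← map_add, h.gen_comm hA, h'.gen_comm hA', hm]
  have h2 : ∀ (y : Y) (l : Y →ₗ[ℂ] ℂ) s, HasDerivAt (fun s => l (U'' (-s) y))
      (l (-U'' (-s) (A'' y))) s := by
    intro y l s
    have := (h''.hasDerivAt hA'' y l (-s)).scomp s (hasDerivAt_neg s)
    simpa [Function.comp_def] using this
  -- the curve `U''(-s) m(U(s)v, U'(s)w)` is constant
  have h3 : ∀ (l : Y →ₗ[ℂ] ℂ) s, HasDerivAt (fun s => l (U'' (-s) (m (U s v) (U' s w)))) 0 s := by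
    intro l s
    let b := Module.finBasis ℂ Y
    have e : ∀ x s, l (U'' (-s) x) = ∑ i, b.coord i x * l (U'' (-s) (b i)) := by
      intro x s
      conv_lhs => rw [← b.sum_repr x]
      simp only [map_sum, map_smul, smul_eq_mul]
      rfl
    have h4 := HasDerivAt.fun_sum fun (i : Fin _) (_ : i ∈ Finset.univ) =>
      (h1 (b.coord i) s).mul (h2 (b i) l s)
    refine (h4.congr_deriv ?_).congr_of_eventuallyEq
      (Filter.Eventually.of_forall fun t => e _ t)
    have e' : ∀ x, l (U'' (-s) (A'' x)) = ∑ i, b.coord i x * l (U'' (-s) (A'' (b i))) := by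
      intro x
      conv_lhs => rw [← b.sum_repr x]
      simp only [map_sum, map_smul, smul_eq_mul]
      rfl
    rw [Finset.sum_add_distrib]
    simp only [map_neg, mul_neg, Finset.sum_neg_distrib]
    rw [← e', ← e, add_neg_cancel]
  refine eq_of_forall_functional fun l => ?_
  have h6 : (l ∘ₗ U'' s) (U'' (-s) (m (U s v) (U' s w))) =
      (l ∘ₗ U'' s) (U'' (-0) (m (U 0 v) (U' 0 w))) :=
    is_const_of_deriv_eq_zero (fun t => (h3 (l ∘ₗ U'' s) t).differentiableAt)
      (fun t => (h3 (l ∘ₗ U'' s) t).deriv) s 0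
  have h7 := h''.neg_apply (-s) (m (U s v) (U' s w))
  rw [neg_neg] at h7
  simpa [h7, h.zero, h'.zero, h''.zero] using h6

lemma gen_of_bilin [FiniteDimensional ℂ V]
    {U : ℝ → V →ₗ[ℂ] V} {U' : ℝ → W →ₗ[ℂ] W} {U'' : ℝ → Y →ₗ[ℂ] Y}
    {A : V →ₗ[ℂ] V} {A' : W →ₗ[ℂ] W} {A'' : Y →ₗ[ℂ] Y}
    (h : IsOneParam U) (h' : IsOneParam U')
    (hA : IsGen U A) (hA' : IsGen U' A') (hA'' : IsGen U'' A'') (m : V →ₗ[ℂ] W →ₗ[ℂ] Y)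
    (hm : ∀ s v w, m (U s v) (U' s w) = U'' s (m v w)) (v : V) (w : W) :
    m (A v) w + m v (A' w) = A'' (m v w) := by
  refine eq_of_forall_functional fun l => ?_
  have := hasDerivAt_bilin (s := 0) (m.compr₂ l) (fun l => hA v l) (fun l => hA' w l)
  simp only [LinearMap.compr₂_apply, hm, h.zero, h'.zero] at this
  have h3 := this.unique (hA'' (m v w) l)
  simpa using h3

lemma linear_of_gen [FiniteDimensional ℂ V] [FiniteDimensional ℂ W]
    {U : ℝ → V →ₗ[ℂ] V} {U' : ℝ → W →ₗ[ℂ] W} {A : V →ₗ[ℂ] V} {A' : W →ₗ[ℂ] W}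
    (h : IsOneParam U) (h' : IsOneParam U') (hA : IsGen U A) (hA' : IsGen U' A')
    (f : V →ₗ[ℂ] W) (hf : ∀ v, f (A v) = A' (f v)) (s : ℝ) (v : V) :
    f (U s v) = U' s (f v) := by
  have h0 : IsOneParam (fun _ => 1 : ℝ → ℂ →ₗ[ℂ] ℂ) := ⟨rfl, fun _ _ => rfl⟩
  have hA0 : IsGen (fun _ => 1 : ℝ → ℂ →ₗ[ℂ] ℂ) 0 := fun v l => by
    simpa using hasDerivAt_const (0 : ℝ) (l v)
  have := bilin_of_gen h0 h h' hA0 hA hA' ((LinearMap.lsmul ℂ W).flip.comp f).flip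
    (fun c v => by simp [hf]) s 1 v
  simpa using this

lemma gen_of_linear {U : ℝ → V →ₗ[ℂ] V} {U' : ℝ → W →ₗ[ℂ] W} {A : V →ₗ[ℂ] V} {A' : W →ₗ[ℂ] W}
    (hA : IsGen U A) (hA' : IsGen U' A')
    (f : V →ₗ[ℂ] W) (hf : ∀ s v, f (U s v) = U' s (f v)) (v : V) : f (A v) = A' (f v) := by
  refine eq_of_forall_functional fun l => ?_
  have h1 := hA v (l ∘ₗ f)
  simp only [LinearMap.comp_apply, hf] at h1
  exact h1.unique (hA' (f v) l)

/-- A continuous one-parameter group of endomorphisms of a finite-dimensional space is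
differentiable. If `K(ε) = ∫₀^ε U`, then `U(s) K(ε) = ∫ₛ^{s+ε} U` is differentiable in `s`, and
`K(ε)` is invertible for small `ε ≠ 0`, as `K(ε)/ε → 1`. -/
theorem exists_gen [FiniteDimensional ℂ V] (h : IsOneParam U)
    (hU : ∀ (v : V) (l : V →ₗ[ℂ] ℂ), Continuous fun s => l (U s v)) : ∃ A, IsGen U A := by
  let b := Module.finBasis ℂ V
  let M : ℝ → Matrix (Fin _) (Fin _) ℂ := fun s => LinearMap.toMatrix b b (U s)
  have hM : ∀ s i j, M s i j = b.coord i (U s (b j)) := fun s i j => by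
    simp [M, LinearMap.toMatrix_apply]
  have hcont : ∀ i j, Continuous fun s => M s i j := fun i j => by
    simp only [hM]; exact hU _ _
  have hint : ∀ i j s t, IntervalIntegrable (fun s => M s i j) MeasureTheory.volume s t :=
    fun i j s t => (hcont i j).intervalIntegrable s t
  have hMadd : ∀ s t, M (s + t) = M s * M t := fun s t => by
    simp only [M, h.add, LinearMap.toMatrix_mul]
  have hM0 : M 0 = 1 := by simp only [M, h.zero, LinearMap.toMatrix_one]
  let K : ℝ → Matrix (Fin _) (Fin _) ℂ := fun ε => Matrix.of fun i j => ∫ t in (0 : ℝ)..ε, M t i j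
  have hK : ∀ i j s, HasDerivAt (fun s => K s i j) (M s i j) s := fun i j s =>
    intervalIntegral.integral_hasDerivAt_right (f := fun s => M s i j) (hint i j 0 s)
      ((hcont i j).stronglyMeasurableAtFilter _ _) (hcont i j).continuousAt
  obtain ⟨ε, hε⟩ : ∃ ε, IsUnit (K ε).det := by
    have h1 : Filter.Tendsto (fun t : ℝ => t⁻¹ • K t) (nhdsWithin 0 {0}ᶜ) (nhds 1) := by
      refine tendsto_pi_nhds.2 fun i => tendsto_pi_nhds.2 fun j => ?_
      have := (hasDerivAt_iff_tendsto_slope_zero.1 (hK i j 0))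
      rw [hM0] at this
      refine this.congr fun t => ?_
      simp [K]
    have h2 := ((continuous_id.matrix_det).tendsto (1 : Matrix (Fin _) (Fin _) ℂ)).comp h1
    simp only [id, Matrix.det_one] at h2
    have h3 := h2.eventually (isOpen_ne.mem_nhds (one_ne_zero : (1 : ℂ) ≠ 0))
    obtain ⟨t, ht, ht0⟩ := (h3.and self_mem_nhdsWithin).exists
    refine ⟨t, isUnit_iff_ne_zero.2 fun h0 => ht ?_⟩
    have : t⁻¹ • K t = ((t⁻¹ : ℝ) : ℂ) • K t := by ext; simp
    simp [Function.comp, this, h0]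
  have hN : ∀ s i j, (M s * K ε) i j = K (s + ε) i j - K s i j := by
    intro s i j
    have e1 : K (s + ε) i j - K s i j = ∫ t in s..(s + ε), M t i j :=
      intervalIntegral.integral_interval_sub_left (hint i j 0 _) (hint i j 0 _)
    have e2 := intervalIntegral.integral_comp_add_left (a := 0) (b := ε) (fun t => M t i j) s
    rw [add_zero] at e2
    rw [e1, ← e2]
    simp only [hMadd, Matrix.mul_apply]
    rw [intervalIntegral.integral_finsetSum fun k _ => (hint k j 0 ε).const_mul _]
    simp only [intervalIntegral.integral_const_mul]
    rfl
  have hdiff : ∀ i j, DifferentiableAt ℝ (fun s => M s i j) 0 := by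
    intro i j
    have e : ∀ s, M s i j = ∑ k, (K (s + ε) i k - K s i k) * (K ε)⁻¹ k j := by
      intro s
      conv_lhs => rw [← Matrix.mul_nonsing_inv_cancel_right (A := K ε) (M s) hε]
      rw [Matrix.mul_apply]
      simp only [hN]
    simp only [e]
    refine DifferentiableAt.fun_sum fun k _ => DifferentiableAt.mul_const ?_ _
    refine DifferentiableAt.sub ?_ (hK i k 0).differentiableAt
    have h4 : DifferentiableAt ℝ (fun s => K s i k) (0 + ε) := (hK i k (0 + ε)).differentiableAt
    exact h4.comp 0 (differentiableAt_id.add_const ε)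
  refine ⟨Matrix.toLin b b (Matrix.of fun i j => _root_.deriv (fun s => M s i j) 0), fun v l => ?_⟩
  have e : ∀ s, l (U s v) = ∑ i, ∑ j, l (b i) * (M s i j * b.repr v j) := by
    intro s
    have : U s v = Matrix.toLin b b (M s) v := by simp [M]
    rw [this, Matrix.toLin_apply]
    simp [Matrix.mulVec, dotProduct, mul_comm, Finset.mul_sum]
  simp only [e]
  have e' : l (Matrix.toLin b b (Matrix.of fun i j => _root_.deriv (fun s => M s i j) 0) v) =
      ∑ i, ∑ j, l (b i) * (_root_.deriv (fun s => M s i j) 0 * b.repr v j) := by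
    rw [Matrix.toLin_apply]
    simp [Matrix.mulVec, dotProduct, mul_comm, Finset.mul_sum]
  rw [e']
  refine HasDerivAt.fun_sum fun i _ => HasDerivAt.fun_sum fun j _ => ?_
  exact ((hdiff i j).hasDerivAt.mul_const _).const_mul _

end IsOneParam

section Exponential

variable {𝔸 : Type} [NormedRing 𝔸] [NormedAlgebra ℂ 𝔸] [CompleteSpace 𝔸]

lemma continuous_exp_add (a b : 𝔸) :
    Continuous fun t : ℝ × ℝ => NormedSpace.exp ((t.1 : ℂ) • a + (t.2 : ℂ) • b) := by
  let _ : NormedAlgebra ℚ 𝔸 := NormedAlgebra.restrictScalars ℚ ℂ _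
  refine NormedSpace.exp_continuous.comp ?_
  fun_prop

lemma exp_add_of_commute {a b : 𝔸} (h : Commute a b) (s t : ℝ × ℝ) :
    NormedSpace.exp (((s + t).1 : ℂ) • a + ((s + t).2 : ℂ) • b) =
      NormedSpace.exp ((s.1 : ℂ) • a + (s.2 : ℂ) • b) *
        NormedSpace.exp ((t.1 : ℂ) • a + (t.2 : ℂ) • b) := by
  let _ : NormedAlgebra ℚ 𝔸 := NormedAlgebra.restrictScalars ℚ ℂ _
  have h1 : ∀ c d : ℂ, Commute (c • a) (d • b) := fun c d => (h.smul_left c).smul_right d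
  have h2 : ∀ (x : 𝔸) (c d : ℂ), Commute (c • x) (d • x) :=
    fun x c d => ((Commute.refl x).smul_left c).smul_right d
  rw [← NormedSpace.exp_add_of_commute
    (((h2 _ _ _).add_right (h1 _ _)).add_left (((h1 _ _).symm).add_right (h2 _ _ _)))]
  congr 1
  simp only [Prod.fst_add, Prod.snd_add, Complex.ofReal_add]
  module

lemma hasDerivAt_exp_functional (x : 𝔸) (L : 𝔸 →L[ℂ] ℂ) :
    HasDerivAt (fun s : ℝ => L (NormedSpace.exp ((s : ℂ) • x))) (L x) 0 := by
  have h1 := hasDerivAt_exp_smul_const (𝕂 := ℂ) x ((0 : ℝ) : ℂ)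
  have h2 := (L.hasFDerivAt.comp_hasDerivAt ((0 : ℝ) : ℂ) h1).comp_ofReal
  simpa [Function.comp_def] using h2

end Exponential

/-- Commuting endomorphisms `A, B` of `ℂⁿ` generate the continuous representation
`(s, t) ↦ exp(sA + tB)` of `ℝ²`. -/
theorem exists_rep_of_commute {n : ℕ} (A B : (Fin n → ℂ) →ₗ[ℂ] (Fin n → ℂ)) (h : Commute A B) :
    ∃ ρ : Representation ℂ (Multiplicative (ℝ × ℝ)) (Fin n → ℂ),
      (∀ (v : Fin n → ℂ) (l : (Fin n → ℂ) →ₗ[ℂ] ℂ), Continuous fun t => l (ρ t v)) ∧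
      IsGen (fun s => ρ (Multiplicative.ofAdd (s, 0))) A ∧
      IsGen (fun t => ρ (Multiplicative.ofAdd (0, t))) B := by
  let c := LinearMap.toContinuousLinearMap (𝕜 := ℂ) (E := Fin n → ℂ) (F' := Fin n → ℂ)
  have hc : Commute (c A) (c B) := by
    ext v : 1
    exact LinearMap.congr_fun h v
  let E : ℝ × ℝ → ((Fin n → ℂ) →L[ℂ] (Fin n → ℂ)) := fun t =>
    NormedSpace.exp ((t.1 : ℂ) • c A + (t.2 : ℂ) • c B)
  have hE : Continuous E := continuous_exp_add (c A) (c B)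
  have hadd : ∀ s t, E (s + t) = E s * E t := exp_add_of_commute hc
  have hE0 : E 0 = 1 := by
    have : (((0 : ℝ × ℝ).1 : ℂ) • c A + ((0 : ℝ × ℝ).2 : ℂ) • c B) = 0 := by ext; simp
    simp only [E, this, NormedSpace.exp_zero]
  have hE1 : ∀ s, E (s, 0) = NormedSpace.exp ((s : ℂ) • c A) := by
    intro s
    have : (((s, 0) : ℝ × ℝ).1 : ℂ) • c A + (((s, 0) : ℝ × ℝ).2 : ℂ) • c B = (s : ℂ) • c A := by
      ext; simp
    simp only [E, this]
  have hE2 : ∀ s, E (0, s) = NormedSpace.exp ((s : ℂ) • c B) := by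
    intro s
    have : (((0, s) : ℝ × ℝ).1 : ℂ) • c A + (((0, s) : ℝ × ℝ).2 : ℂ) • c B = (s : ℂ) • c B := by
      ext; simp
    simp only [E, this]
  refine ⟨{ toFun := fun t => (E t.toAdd).toLinearMap, map_one' := ?_, map_mul' := ?_ },
    fun v l => ?_, fun v l => ?_, fun v l => ?_⟩
  · exact congrArg ContinuousLinearMap.toLinearMap hE0
  · intro s t
    rw [toAdd_mul, hadd]
    rfl
  · have : Continuous fun t => E t v := hE.clm_apply continuous_const
    exact ((LinearMap.toContinuousLinearMap l).continuous.comp this).comp continuous_toAdd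
  · refine (hasDerivAt_exp_functional (c A) ((LinearMap.toContinuousLinearMap l).comp
      (ContinuousLinearMap.apply ℂ (Fin n → ℂ) v))).congr_of_eventuallyEq
      (Filter.Eventually.of_forall fun s => ?_)
    exact congrArg (fun x : (Fin n → ℂ) →L[ℂ] (Fin n → ℂ) => l (x v)) (hE1 s)
  · refine (hasDerivAt_exp_functional (c B) ((LinearMap.toContinuousLinearMap l).comp
      (ContinuousLinearMap.apply ℂ (Fin n → ℂ) v))).congr_of_eventuallyEq
      (Filter.Eventually.of_forall fun s => ?_)
    exact congrArg (fun x : (Fin n → ℂ) →L[ℂ] (Fin n → ℂ) => l (x v)) (hE2 s)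

end

end

noncomputable section

/-! ### Representations of the plane and pairs of commuting endomorphisms -/

lemma IsGen.unique {V : Type} [AddCommGroup V] [Module ℂ V] {U : ℝ → V →ₗ[ℂ] V}
    {A B : V →ₗ[ℂ] V} (hA : IsGen U A) (hB : IsGen U B) : A = B :=
  LinearMap.ext fun v => eq_of_forall_functional fun l => (hA v l).unique (hB v l)

namespace ContRep

variable (V W Y : ContRep (Multiplicative (ℝ × ℝ)))

/-- The action of the first coordinate axis. -/
abbrev axis₁ (s : ℝ) : V.carrier →ₗ[ℂ] V.carrier := V.ρ (Multiplicative.ofAdd (s, 0))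

/-- The action of the second coordinate axis. -/
abbrev axis₂ (t : ℝ) : V.carrier →ₗ[ℂ] V.carrier := V.ρ (Multiplicative.ofAdd (0, t))

lemma isOneParam₁ : IsOneParam V.axis₁ :=
  ⟨V.ρ.map_one, fun s t => by rw [← map_mul, ← ofAdd_add, Prod.mk_add_mk, add_zero]⟩

lemma isOneParam₂ : IsOneParam V.axis₂ :=
  ⟨V.ρ.map_one, fun s t => by rw [← map_mul, ← ofAdd_add, Prod.mk_add_mk, add_zero]⟩

lemma exists_gen₁ : ∃ A, IsGen V.axis₁ A := V.isOneParam₁.exists_gen fun v l =>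
  (V.cont v l).comp (continuous_ofAdd.comp (by fun_prop : Continuous fun s : ℝ => (s, (0 : ℝ))))

lemma exists_gen₂ : ∃ A, IsGen V.axis₂ A := V.isOneParam₂.exists_gen fun v l =>
  (V.cont v l).comp (continuous_ofAdd.comp (by fun_prop : Continuous fun s : ℝ => ((0 : ℝ), s)))

/-- The infinitesimal generator of the first coordinate axis. -/
def gen₁ : V.carrier →ₗ[ℂ] V.carrier := V.exists_gen₁.choose

/-- The infinitesimal generator of the second coordinate axis. -/
def gen₂ : V.carrier →ₗ[ℂ] V.carrier := V.exists_gen₂.choose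

lemma isGen₁ : IsGen V.axis₁ V.gen₁ := V.exists_gen₁.choose_spec
lemma isGen₂ : IsGen V.axis₂ V.gen₂ := V.exists_gen₂.choose_spec

lemma rho_eq (t : Multiplicative (ℝ × ℝ)) (v : V.carrier) :
    V.ρ t v = V.axis₁ t.toAdd.1 (V.axis₂ t.toAdd.2 v) := by
  rw [← Module.End.mul_apply, ← map_mul, ← ofAdd_add, Prod.mk_add_mk, add_zero, zero_add]
  rfl

lemma gen_comm (v : V.carrier) : V.gen₁ (V.gen₂ v) = V.gen₂ (V.gen₁ v) := by
  have h : ∀ s t v, V.axis₁ s (V.axis₂ t v) = V.axis₂ t (V.axis₁ s v) := by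
    intro s t v
    have := congrArg (fun k => V.ρ k v)
      (mul_comm (Multiplicative.ofAdd (s, (0 : ℝ))) (Multiplicative.ofAdd ((0 : ℝ), t)))
    simp only [map_mul] at this
    exact this
  have h1 : ∀ t v, V.axis₂ t (V.gen₁ v) = V.gen₁ (V.axis₂ t v) := fun t v =>
    IsOneParam.gen_of_linear V.isGen₁ V.isGen₁ (V.axis₂ t) (fun s v => (h s t v).symm) v
  exact (IsOneParam.gen_of_linear V.isGen₂ V.isGen₂ V.gen₁ (fun t v => (h1 t v).symm) v)

variable {V W Y}

lemma intertwining_iff (f : V.carrier →ₗ[ℂ] W.carrier) :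
    (∀ t, f ∘ₗ V.ρ t = W.ρ t ∘ₗ f) ↔
      (∀ v, f (V.gen₁ v) = W.gen₁ (f v)) ∧ ∀ v, f (V.gen₂ v) = W.gen₂ (f v) := by
  constructor
  · intro h
    exact ⟨IsOneParam.gen_of_linear V.isGen₁ W.isGen₁ f fun s v => LinearMap.congr_fun (h _) v,
      IsOneParam.gen_of_linear V.isGen₂ W.isGen₂ f fun s v => LinearMap.congr_fun (h _) v⟩
  · rintro ⟨h1, h2⟩ t
    refine LinearMap.ext fun v => ?_
    rw [LinearMap.comp_apply, LinearMap.comp_apply, V.rho_eq t v, W.rho_eq t (f v),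
      IsOneParam.linear_of_gen V.isOneParam₁ W.isOneParam₁ V.isGen₁ W.isGen₁ f h1,
      IsOneParam.linear_of_gen V.isOneParam₂ W.isOneParam₂ V.isGen₂ W.isGen₂ f h2]

lemma bilin_iff (m : V.carrier →ₗ[ℂ] W.carrier →ₗ[ℂ] Y.carrier) :
    (∀ t v w, m (V.ρ t v) (W.ρ t w) = Y.ρ t (m v w)) ↔
      (∀ v w, m (V.gen₁ v) w + m v (W.gen₁ w) = Y.gen₁ (m v w)) ∧
      ∀ v w, m (V.gen₂ v) w + m v (W.gen₂ w) = Y.gen₂ (m v w) := by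
  constructor
  · intro h
    exact ⟨IsOneParam.gen_of_bilin V.isOneParam₁ W.isOneParam₁ V.isGen₁ W.isGen₁ Y.isGen₁ m
        fun s v w => h _ v w,
      IsOneParam.gen_of_bilin V.isOneParam₂ W.isOneParam₂ V.isGen₂ W.isGen₂ Y.isGen₂ m
        fun s v w => h _ v w⟩
  · rintro ⟨h1, h2⟩ t v w
    rw [V.rho_eq t v, W.rho_eq t w, Y.rho_eq t (m v w),
      IsOneParam.bilin_of_gen V.isOneParam₁ W.isOneParam₁ Y.isOneParam₁
      V.isGen₁ W.isGen₁ Y.isGen₁ m h1, IsOneParam.bilin_of_gen V.isOneParam₂ W.isOneParam₂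
      Y.isOneParam₂ V.isGen₂ W.isGen₂ Y.isGen₂ m h2]

/-- Every pair of commuting endomorphisms is the pair of generators of a representation. -/
lemma exists_of_commute {E : Type} [AddCommGroup E] [Module ℂ E] [FiniteDimensional ℂ E]
    (A B : E →ₗ[ℂ] E) (h : ∀ e, A (B e) = B (A e)) :
    ∃ (V : ContRep (Multiplicative (ℝ × ℝ))) (φ : E ≃ₗ[ℂ] V.carrier),
      (∀ e, φ (A e) = V.gen₁ (φ e)) ∧ ∀ e, φ (B e) = V.gen₂ (φ e) := by
  let b := (Module.finBasis ℂ E).equivFun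
  obtain ⟨ρ, hρ, hA, hB⟩ := exists_rep_of_commute (b.toLinearMap ∘ₗ A ∘ₗ b.symm.toLinearMap)
    (b.toLinearMap ∘ₗ B ∘ₗ b.symm.toLinearMap) (LinearMap.ext fun v => by simp [h])
  let V : ContRep (Multiplicative (ℝ × ℝ)) := { carrier := _, ρ := ρ, cont := hρ }
  refine ⟨V, b, fun e => ?_, fun e => ?_⟩
  · rw [V.isGen₁.unique hA]
    simp
  · rw [V.isGen₂.unique hB]
    simp

end ContRep

end

noncomputable section

/-! ### Finitely generated projective bimodules over an algebra with trivial centre -/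

open scoped RightActions

section Projections

variable {M N : Type} [AddCommGroup M] [Module ℂ M] [AddCommGroup N] [Module ℂ N]
  (ℳ : ℕ → Submodule ℂ M) [DirectSum.Decomposition ℳ] (𝒩 : ℕ → Submodule ℂ N)
  [DirectSum.Decomposition 𝒩]

/-- The projection onto the component of degree `k`. -/
def projDeg (k : ℕ) : M →ₗ[ℂ] M :=
  (ℳ k).subtype ∘ₗ DirectSum.component ℂ ℕ (fun i => ℳ i) k ∘ₗ
    (DirectSum.decomposeLinearEquiv ℳ).toLinearMap

lemma projDeg_apply (k : ℕ) (e : M) : projDeg ℳ k e = (DirectSum.decompose ℳ e k : M) := rfl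

variable {ℳ 𝒩}

lemma projDeg_of_mem {k : ℕ} {e : M} (h : e ∈ ℳ k) : projDeg ℳ k e = e := by
  rw [projDeg_apply, DirectSum.decompose_of_mem_same _ h]

lemma projDeg_of_ne {i k : ℕ} (hik : i ≠ k) {e : M} (h : e ∈ ℳ i) : projDeg ℳ k e = 0 := by
  rw [projDeg_apply, DirectSum.decompose_of_mem_ne _ h hik]

lemma projDeg_mem (k : ℕ) (e : M) : projDeg ℳ k e ∈ ℳ k := (DirectSum.decompose ℳ e k).2

lemma mem_of_projDeg_eq_zero {k : ℕ} {e : M} (h : ∀ i, i ≠ k → projDeg ℳ i e = 0) : e ∈ ℳ k := by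
  classical
  rw [← DirectSum.sum_support_decompose ℳ e]
  refine Submodule.sum_mem _ fun i _ => ?_
  rcases eq_or_ne i k with rfl | hi
  · exact projDeg_mem i e
  · rw [← projDeg_apply, h i hi]
    exact Submodule.zero_mem _

lemma projDeg_comm (g : M →ₗ[ℂ] N) (hg : ∀ i, ∀ e ∈ ℳ i, g e ∈ 𝒩 i) (k : ℕ) (e : M) :
    projDeg 𝒩 k (g e) = g (projDeg ℳ k e) := by
  induction e using DirectSum.Decomposition.inductionOn ℳ with
  | zero => simp
  | @homogeneous i e =>
    rcases eq_or_ne i k with rfl | h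
    · rw [projDeg_of_mem e.2, projDeg_of_mem (hg i _ e.2)]
    · rw [projDeg_of_ne h e.2, projDeg_of_ne h (hg i _ e.2), map_zero]
  | add x y hx hy => simp only [map_add, hx, hy]

end Projections

namespace GradedBimodule

variable {Ω : DGA} (E F G : GradedBimodule Ω)

/-- The map `Ω ⊗ Z_g(E)⁰ → E`, `ω ⊗ v ↦ ω v`. -/
def ofCentre : Ω.carrier ⊗[ℂ] E.centreZero →ₗ[ℂ] E.carrier :=
  TensorProduct.lift (LinearMap.mk₂ ℂ
    (fun (a : Ω.carrier) (v : E.centreZero) => a • (v : E.carrier))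
    (fun a b _ => add_smul a b _) (fun c a _ => smul_assoc c a _) (fun a _ _ => smul_add a _ _)
    (fun c a _ => smul_comm a c _))

@[simp] lemma ofCentre_tmul (a : Ω.carrier) (v : E.centreZero) :
    E.ofCentre (a ⊗ₜ v) = a • (v : E.carrier) := rfl

section Structure

variable {E}

lemma exists_algebraMap (hΩ : Ω.centreZero = ⊥) {a : Ω.carrier} (h0 : a ∈ Ω.deg 0)
    (h : ∀ ν : Ω.carrier, a * ν = ν * a) : ∃ c : ℂ, algebraMap ℂ Ω.carrier c = a := by
  have : a ∈ Ω.centreZero := mem_centreZero.2 ⟨h0, h⟩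
  rw [hΩ] at this
  exact Algebra.mem_bot.1 this

/-- An embedding of `Z_g(E)⁰` into `Z_g(Ωⁿ)⁰ = ℂⁿ`, obtained from an embedding of `E` as a direct
summand of `Ωⁿ`. -/
lemma exists_centre_embedding (hΩ : Ω.centreZero = ⊥) [Nontrivial Ω.carrier] (hE : E.IsFGP) :
    ∃ (n : ℕ) (ψ : E.carrier →ₗ[ℂ] (Fin n → Ω.carrier)) (κ : E.centreZero →ₗ[ℂ] (Fin n → ℂ)),
      (∀ (a : Ω.carrier) e, ψ (a • e) = a • ψ e) ∧
      (∀ (v : E.centreZero) j, ψ v j = algebraMap ℂ _ (κ v j)) ∧ Function.Injective κ := by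
  obtain ⟨F, n, φ, hl, hr, hd⟩ := hE
  obtain ⟨l, hlinv⟩ := (Algebra.linearMap ℂ Ω.carrier).exists_leftInverse_of_injective
    (LinearMap.ker_eq_bot.2 (algebraMap ℂ Ω.carrier).injective)
  have hlinv : ∀ c, l (algebraMap ℂ _ c) = c := LinearMap.congr_fun hlinv
  let ψ : E.carrier →ₗ[ℂ] (Fin n → Ω.carrier) := φ.toLinearMap ∘ₗ LinearMap.inl ℂ _ _
  have hψl : ∀ (a : Ω.carrier) e, ψ (a • e) = a • ψ e := fun a e => by
    have := hl a (e, 0)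
    rwa [Prod.smul_mk, smul_zero] at this
  have hψr : ∀ (a : Ω.carrier) e, ψ (e <• a) = ψ e <• a := fun a e => by
    have := hr a (e, 0)
    rwa [Prod.smul_mk, smul_zero] at this
  have key : ∀ (v : E.centreZero) j, ψ v j = algebraMap ℂ _ (l (ψ v j)) := by
    intro v j
    obtain ⟨h0, hc⟩ := mem_centreZero.1 v.2
    obtain ⟨c, hc⟩ := exists_algebraMap hΩ (a := ψ v j)
      (hd 0 v h0 0 (Submodule.zero_mem _) j) fun ν => by
        have := congrFun (congrArg ψ (hc ν)) j
        rw [hψl, hψr] at this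
        exact this
    rw [← hc, hlinv]
  refine ⟨n, ψ, LinearMap.pi fun j => l ∘ₗ
    (LinearMap.proj j : (Fin n → Ω.carrier) →ₗ[ℂ] Ω.carrier) ∘ₗ ψ ∘ₗ E.centreZero.subtype, hψl,
    key, ?_⟩
  rw [injective_iff_map_eq_zero]
  intro v hv
  have h0 : ψ v = 0 := funext fun j => by
    rw [key, show l (ψ v j) = 0 from congrFun hv j, map_zero]
    rfl
  have h1 : ((v : E.carrier), (0 : F.carrier)) = 0 := φ.injective (by rw [map_zero]; exact h0)
  exact Subtype.ext (congrArg Prod.fst h1)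

/-- By the embedding of `Z_g(E)⁰` into `ℂⁿ` this follows from the flatness of `Ω` over `ℂ`. -/
lemma ofCentre_injective (hΩ : Ω.centreZero = ⊥) [Nontrivial Ω.carrier] (hE : E.IsFGP) :
    Function.Injective E.ofCentre := by
  obtain ⟨n, ψ, κ, hψ, hκ, hinj⟩ := exists_centre_embedding hΩ hE
  have h : ∀ t, ψ (E.ofCentre t) =
      TensorProduct.piScalarRight ℂ ℂ Ω.carrier (Fin n) (κ.lTensor Ω.carrier t) := by
    intro t
    induction t with
    | zero => simp
    | tmul a v =>
      funext j
      simp [hψ, hκ, Algebra.smul_def, Algebra.commutes]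
    | add x y hx hy => simp only [map_add, hx, hy]
  intro x y hxy
  refine Module.Flat.lTensor_preserves_injective_linearMap κ hinj
    ((TensorProduct.piScalarRight ℂ ℂ Ω.carrier (Fin n)).injective ?_)
  rw [← h, ← h, hxy]

lemma ofCentre_surjective (hE : E.IsFGP) : Function.Surjective E.ofCentre := by
  obtain ⟨F, n, φ, hl, hr, hd⟩ := hE
  -- the generators are the components in `E` of the standard basis of `Ωⁿ`
  let w : Fin n → E.carrier × F.carrier := fun j => φ.symm (Pi.single j 1)
  have hw : ∀ j, (w j).1 ∈ E.centreZero := by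
    intro j
    refine mem_centreZero.2 ⟨mem_of_projDeg_eq_zero fun i hi => ?_, fun ν => ?_⟩
    · have h1 : ∀ j', φ (projDeg E.deg i (w j).1, projDeg F.deg i (w j).2) j' = 0 := by
        intro j'
        let π : (Fin n → Ω.carrier) →ₗ[ℂ] Ω.carrier := LinearMap.proj j'
        have e1 : projDeg Ω.deg i (φ ((w j).1, 0) j') = φ (projDeg E.deg i (w j).1, 0) j' :=
          projDeg_comm (π ∘ₗ φ.toLinearMap ∘ₗ LinearMap.inl ℂ E.carrier F.carrier)
            (fun i e he => hd i e he 0 (Submodule.zero_mem _) j') i (w j).1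
        have e2 : projDeg Ω.deg i (φ (0, (w j).2) j') = φ (0, projDeg F.deg i (w j).2) j' :=
          projDeg_comm (π ∘ₗ φ.toLinearMap ∘ₗ LinearMap.inr ℂ E.carrier F.carrier)
            (fun i f hf => hd i 0 (Submodule.zero_mem _) f hf j') i (w j).2
        have s1 : ∀ x : E.carrier × F.carrier, φ x j' = φ (x.1, 0) j' + φ (0, x.2) j' := by
          intro x
          rw [← Pi.add_apply, ← map_add]
          simp
        have e3 : φ (projDeg E.deg i (w j).1, projDeg F.deg i (w j).2) j' =
            projDeg Ω.deg i (φ (w j) j') := by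
          rw [s1, s1 (w j), map_add, e1, e2]
        have e4 : φ (w j) = Pi.single j 1 := φ.apply_symm_apply _
        rw [e3, e4]
        refine projDeg_of_ne hi.symm ?_
        rcases eq_or_ne j' j with rfl | hj
        · rw [Pi.single_eq_same]; exact SetLike.one_mem_graded Ω.deg
        · rw [Pi.single_eq_of_ne hj]; exact Submodule.zero_mem _
      have h2 : (projDeg E.deg i (w j).1, projDeg F.deg i (w j).2) = 0 :=
        φ.injective (by rw [map_zero]; exact funext h1)
      exact congrArg Prod.fst h2
    · have h1 : w j <• ν = ν • w j := by
        refine φ.injective ?_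
        rw [hl, hr]
        have e4 : φ (w j) = Pi.single j 1 := φ.apply_symm_apply _
        rw [e4]
        funext j'
        rcases eq_or_ne j' j with rfl | hj
        · simp
        · simp [Pi.single_eq_of_ne hj]
      exact congrArg Prod.fst h1
  intro e
  refine ⟨∑ j, φ (e, 0) j ⊗ₜ ⟨(w j).1, hw j⟩, ?_⟩
  have h1 : (e, (0 : F.carrier)) = ∑ j, φ (e, 0) j • w j := by
    refine φ.injective ?_
    rw [map_sum]
    have e4 : ∀ j, φ (φ (e, 0) j • w j) = Pi.single j (φ (e, 0) j) := by
      intro j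
      have e5 : φ (w j) = Pi.single j 1 := φ.apply_symm_apply _
      rw [hl, e5]
      funext j'
      rcases eq_or_ne j' j with rfl | hj
      · simp
      · simp [Pi.single_eq_of_ne hj]
    simp only [e4]
    exact (Finset.univ_sum_single _).symm
  have h2 := congrArg Prod.fst h1
  rw [Prod.fst_sum] at h2
  rw [map_sum]
  exact h2.symm

lemma finiteDimensional_centreZero (hΩ : Ω.centreZero = ⊥) [Nontrivial Ω.carrier]
    (hE : E.IsFGP) : FiniteDimensional ℂ E.centreZero := by
  obtain ⟨n, ψ, κ, -, -, hinj⟩ := exists_centre_embedding hΩ hE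
  exact FiniteDimensional.of_injective κ hinj

/-- A finitely generated projective graded bimodule `E` is `Ω ⊗ Z_g(E)⁰`, if `Z_g(Ω)⁰ = ℂ`. -/
def centreEquiv (hΩ : Ω.centreZero = ⊥) [Nontrivial Ω.carrier] (hE : E.IsFGP) :
    Ω.carrier ⊗[ℂ] E.centreZero ≃ₗ[ℂ] E.carrier :=
  LinearEquiv.ofBijective E.ofCentre ⟨ofCentre_injective hΩ hE, ofCentre_surjective hE⟩

@[simp] lemma centreEquiv_tmul (hΩ : Ω.centreZero = ⊥) [Nontrivial Ω.carrier] (hE : E.IsFGP)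
    (a : Ω.carrier) (v : E.centreZero) : centreEquiv hΩ hE (a ⊗ₜ v) = a • (v : E.carrier) := rfl

@[simp] lemma centreEquiv_symm_smul (hΩ : Ω.centreZero = ⊥) [Nontrivial Ω.carrier]
    (hE : E.IsFGP) (a : Ω.carrier) (v : E.centreZero) :
    (centreEquiv hΩ hE).symm (a • (v : E.carrier)) = a ⊗ₜ v := by
  rw [LinearEquiv.symm_apply_eq, centreEquiv_tmul]

lemma induction_centre (hE : E.IsFGP) {P : E.carrier → Prop} (zero : P 0)
    (smul : ∀ (a : Ω.carrier) (v : E.centreZero), P (a • (v : E.carrier)))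
    (add : ∀ x y, P x → P y → P (x + y)) (e : E.carrier) : P e := by
  obtain ⟨t, rfl⟩ := ofCentre_surjective hE e
  induction t with
  | zero => simpa using zero
  | tmul a v => exact smul a v
  | add x y hx hy => rw [map_add]; exact add _ _ hx hy

/-- The induction principle with homogeneous coefficients. -/
lemma induction_homogeneous (hE : E.IsFGP) {P : E.carrier → Prop} (zero : P 0)
    (smul : ∀ (i : ℕ) (a : Ω.carrier) (v : E.centreZero), a ∈ Ω.deg i → P (a • (v : E.carrier)))
    (add : ∀ x y, P x → P y → P (x + y)) (e : E.carrier) : P e := by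
  refine induction_centre hE zero (fun a v => ?_) add e
  induction a using DirectSum.Decomposition.inductionOn Ω.deg with
  | zero => simpa using zero
  | homogeneous a => exact smul _ _ v a.2
  | add x y hx hy => rw [add_smul]; exact add _ _ hx hy

lemma smul_op_smul_centre (a b : Ω.carrier) (v : E.centreZero) :
    (a • (v : E.carrier)) <• b = (a * b) • (v : E.carrier) := by
  rw [← smul_comm, (mem_centreZero.1 v.2).2, smul_smul]

lemma projDeg_smul_centre (k : ℕ) (a : Ω.carrier) (v : E.centreZero) :
    projDeg E.deg k (a • (v : E.carrier)) = projDeg Ω.deg k a • (v : E.carrier) :=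
  projDeg_comm (𝒩 := E.deg) (E.ofCentre ∘ₗ (TensorProduct.mk ℂ _ _).flip v)
    (fun i a ha => E.smul_mem i 0 a v ha (mem_centreZero.1 v.2).1) k a

lemma induction_pair {F : GradedBimodule Ω} {P : E.carrier → F.carrier → Prop}
    (zero_left : ∀ f, P 0 f) (zero_right : ∀ e, P e 0)
    (smul : ∀ (a b : Ω.carrier) (v : E.centreZero) (w : F.centreZero), P (a • v.1) (b • w.1))
    (add_left : ∀ x y f, P x f → P y f → P (x + y) f)
    (add_right : ∀ e x y, P e x → P e y → P e (x + y)) (hE : E.IsFGP) (hF : F.IsFGP)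
    (e : E.carrier) (f : F.carrier) : P e f := by
  induction e using induction_centre hE with
  | zero => exact zero_left f
  | smul a v =>
    induction f using induction_centre hF with
    | zero => exact zero_right _
    | smul b w => exact smul a b v w
    | add x y hx hy => exact add_right _ _ _ hx hy
  | add x y hx hy => exact add_left _ _ _ hx hy

section Extension

variable (hΩ : Ω.centreZero = ⊥) [Nontrivial Ω.carrier] (hE : E.IsFGP) {F : GradedBimodule Ω}
  (hF : F.IsFGP) {G : GradedBimodule Ω} (hG : G.IsFGP)

/-- The contraction `E = Ω ⊗ Z_g(E)⁰ → Ω` with a functional on `Z_g(E)⁰`. -/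
def contract (l : E.centreZero →ₗ[ℂ] ℂ) : E.carrier →ₗ[ℂ] Ω.carrier :=
  (TensorProduct.rid ℂ Ω.carrier).toLinearMap ∘ₗ l.lTensor Ω.carrier ∘ₗ
    (centreEquiv hΩ hE).symm.toLinearMap

@[simp] lemma contract_smul_centre (l : E.centreZero →ₗ[ℂ] ℂ) (a : Ω.carrier)
    (v : E.centreZero) : contract hΩ hE l (a • (v : E.carrier)) = l v • a := by
  simp [contract]

lemma contract_smul (l : E.centreZero →ₗ[ℂ] ℂ) (a : Ω.carrier) (e : E.carrier) :
    contract hΩ hE l (a • e) = a * contract hΩ hE l e := by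
  induction e using induction_centre hE with
  | zero => simp
  | smul b v => rw [smul_smul]; simp
  | add x y hx hy => simp only [smul_add, map_add, hx, hy, mul_add]

lemma contract_op_smul (l : E.centreZero →ₗ[ℂ] ℂ) (a : Ω.carrier) (e : E.carrier) :
    contract hΩ hE l (e <• a) = contract hΩ hE l e * a := by
  induction e using induction_centre hE with
  | zero => simp
  | smul b v => rw [smul_op_smul_centre]; simp
  | add x y hx hy => simp only [smul_add, map_add, hx, hy, add_mul]

lemma projDeg_contract (l : E.centreZero →ₗ[ℂ] ℂ) (k : ℕ) (e : E.carrier) :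
    projDeg Ω.deg k (contract hΩ hE l e) = contract hΩ hE l (projDeg E.deg k e) := by
  induction e using induction_centre hE with
  | zero => simp
  | smul b v => rw [projDeg_smul_centre, contract_smul_centre, contract_smul_centre, map_smul]
  | add x y hx hy => simp only [map_add, hx, hy]

lemma contract_mem (l : E.centreZero →ₗ[ℂ] ℂ) {k : ℕ} {e : E.carrier} (h : e ∈ E.deg k) :
    contract hΩ hE l e ∈ Ω.deg k := by
  have := projDeg_contract hΩ hE l k e
  rw [projDeg_of_mem h] at this
  rw [← this]
  exact projDeg_mem k _

lemma sum_contract {ι : Type} [Fintype ι] (b : Module.Basis ι ℂ E.centreZero) (e : E.carrier) :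
    ∑ i, contract hΩ hE (b.coord i) e • (b i : E.carrier) = e := by
  induction e using induction_centre hE with
  | zero => simp
  | smul a v =>
    have h : ∀ i, contract hΩ hE (b.coord i) (a • (v : E.carrier)) • (b i : E.carrier) =
        a • ((b.repr v i • b i : E.centreZero) : E.carrier) := by
      intro i
      rw [contract_smul_centre, Submodule.coe_smul, smul_assoc, smul_comm]
      rfl
    simp only [h]
    rw [← Finset.smul_sum, ← Submodule.coe_sum, b.sum_repr]
  | add x y hx hy => simp only [map_add, add_smul, Finset.sum_add_distrib, hx, hy]

/-- The bimodule map `E → F` that extends a linear map `Z_g(E)⁰ → Z_g(F)⁰`. -/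
def extend (f : E.centreZero →ₗ[ℂ] F.centreZero) : E.carrier →ₗ[ℂ] F.carrier :=
  F.ofCentre ∘ₗ f.lTensor Ω.carrier ∘ₗ (centreEquiv hΩ hE).symm.toLinearMap

@[simp] lemma extend_smul_centre (f : E.centreZero →ₗ[ℂ] F.centreZero) (a : Ω.carrier)
    (v : E.centreZero) : extend hΩ hE f (a • (v : E.carrier)) = a • (f v : F.carrier) := by
  simp [extend]

@[simp] lemma extend_centre (f : E.centreZero →ₗ[ℂ] F.centreZero) (v : E.centreZero) :
    extend hΩ hE f (v : E.carrier) = (f v : F.carrier) := by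
  simpa using extend_smul_centre hΩ hE f 1 v

lemma extend_smul (f : E.centreZero →ₗ[ℂ] F.centreZero) (a : Ω.carrier) (e : E.carrier) :
    extend hΩ hE f (a • e) = a • extend hΩ hE f e := by
  induction e using induction_centre hE with
  | zero => simp
  | smul b v => rw [smul_smul]; simp [smul_smul]
  | add x y hx hy => simp only [smul_add, map_add, hx, hy]

lemma extend_op_smul (f : E.centreZero →ₗ[ℂ] F.centreZero) (a : Ω.carrier) (e : E.carrier) :
    extend hΩ hE f (e <• a) = extend hΩ hE f e <• a := by
  induction e using induction_centre hE with
  | zero => simp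
  | smul b v =>
    rw [smul_op_smul_centre, extend_smul_centre, extend_smul_centre, smul_op_smul_centre]
  | add x y hx hy => simp only [smul_add, map_add, hx, hy]

lemma extend_mem (f : E.centreZero →ₗ[ℂ] F.centreZero) {k : ℕ} {e : E.carrier}
    (h : e ∈ E.deg k) : extend hΩ hE f e ∈ F.deg k := by
  have := finiteDimensional_centreZero hΩ hE
  rw [← sum_contract hΩ hE (Module.finBasis ℂ E.centreZero) e, map_sum]
  refine Submodule.sum_mem _ fun i _ => ?_
  rw [extend_smul_centre]
  exact F.smul_mem k 0 _ _ (contract_mem hΩ hE _ h) (mem_centreZero.1 (f _).2).1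

/-- The extension `E × F → G`, `(ω v, η w) ↦ ω η m(v, w)`, of a bilinear map `m` on the parts of
degree zero of the graded centres. -/
def bilinExtend (m : E.centreZero →ₗ[ℂ] F.centreZero →ₗ[ℂ] G.centreZero) :
    E.carrier →ₗ[ℂ] F.carrier →ₗ[ℂ] G.carrier :=
  ((TensorProduct.map₂ (LinearMap.mul ℂ Ω.carrier) m).compl₁₂
    (centreEquiv hΩ hE).symm.toLinearMap (centreEquiv hΩ hF).symm.toLinearMap).compr₂ G.ofCentre

variable (m : E.centreZero →ₗ[ℂ] F.centreZero →ₗ[ℂ] G.centreZero)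

@[simp] lemma bilinExtend_smul_smul (a b : Ω.carrier) (v : E.centreZero) (w : F.centreZero) :
    bilinExtend hΩ hE hF m (a • (v : E.carrier)) (b • (w : F.carrier)) =
      (a * b) • (m v w : G.carrier) := by
  simp [bilinExtend]

@[simp] lemma bilinExtend_centre (v : E.centreZero) (w : F.centreZero) :
    bilinExtend hΩ hE hF m (v : E.carrier) (w : F.carrier) = (m v w : G.carrier) := by
  simpa using bilinExtend_smul_smul hΩ hE hF m 1 1 v w

lemma bilinExtend_smul (a : Ω.carrier) (e : E.carrier) (f : F.carrier) :
    bilinExtend hΩ hE hF m (a • e) f = a • bilinExtend hΩ hE hF m e f := by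
  refine induction_pair (P := fun e f => bilinExtend hΩ hE hF m (a • e) f =
    a • bilinExtend hΩ hE hF m e f) ?_ ?_ ?_ ?_ ?_ hE hF e f
  · intro f; simp
  · intro e; simp
  · intro b c v w; rw [smul_smul]; simp [smul_smul, mul_assoc]
  · intro x y f hx hy; simp only [smul_add, map_add, LinearMap.add_apply, hx, hy]
  · intro e x y hx hy; simp only [smul_add, map_add, hx, hy]

lemma bilinExtend_op_smul (a : Ω.carrier) (e : E.carrier) (f : F.carrier) :
    bilinExtend hΩ hE hF m e (f <• a) = bilinExtend hΩ hE hF m e f <• a := by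
  refine induction_pair (P := fun e f => bilinExtend hΩ hE hF m e (f <• a) =
    bilinExtend hΩ hE hF m e f <• a) ?_ ?_ ?_ ?_ ?_ hE hF e f
  · intro f; simp
  · intro e; simp
  · intro b c v w
    rw [smul_op_smul_centre, bilinExtend_smul_smul, bilinExtend_smul_smul, smul_op_smul_centre,
      mul_assoc]
  · intro x y f hx hy; simp only [smul_add, map_add, LinearMap.add_apply, hx, hy]
  · intro e x y hx hy; simp only [smul_add, map_add, hx, hy]

lemma bilinExtend_mem {i j : ℕ} {e : E.carrier} {f : F.carrier} (he : e ∈ E.deg i)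
    (hf : f ∈ F.deg j) : bilinExtend hΩ hE hF m e f ∈ G.deg (i + j) := by
  have := finiteDimensional_centreZero hΩ hE
  have := finiteDimensional_centreZero hΩ hF
  rw [← sum_contract hΩ hE (Module.finBasis ℂ E.centreZero) e,
    ← sum_contract hΩ hF (Module.finBasis ℂ F.centreZero) f, map_sum]
  refine Submodule.sum_mem _ fun k _ => ?_
  rw [map_sum, LinearMap.sum_apply]
  refine Submodule.sum_mem _ fun l _ => ?_
  rw [bilinExtend_smul_smul]
  exact G.smul_mem (i + j) 0 _ _ (SetLike.mul_mem_graded (contract_mem hΩ hE _ he)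
    (contract_mem hΩ hF _ hf)) (mem_centreZero.1 (m _ _).2).1

/-- The relations `εα ⊗ ζ = ε ⊗ αζ` of the tensor product over `Ω`. -/
abbrev tensorRel (E F : GradedBimodule Ω) : Submodule ℂ (E.carrier ⊗[ℂ] F.carrier) :=
  Submodule.span ℂ {x | ∃ (e : E.carrier) (a : Ω.carrier) (f : F.carrier),
    x = (e <• a) ⊗ₜ[ℂ] f - e ⊗ₜ[ℂ] (a • f)}

/-- The map `Ω ⊗ (Z_g(E)⁰ ⊗ Z_g(F)⁰) → E ⊗_Ω F`. -/
def toQuot (E F : GradedBimodule Ω) : Ω.carrier ⊗[ℂ] (E.centreZero ⊗[ℂ] F.centreZero) →ₗ[ℂ]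
    (E.carrier ⊗[ℂ] F.carrier) ⧸ tensorRel E F :=
  (tensorRel E F).mkQ ∘ₗ TensorProduct.map E.ofCentre F.centreZero.subtype ∘ₗ
    (TensorProduct.assoc ℂ _ _ _).symm.toLinearMap

/-- The multiplication map `E ⊗ F → Ω ⊗ (Z_g(E)⁰ ⊗ Z_g(F)⁰)`, `ω v ⊗ η w ↦ ω η ⊗ (v ⊗ w)`. -/
def fromTensor : E.carrier ⊗[ℂ] F.carrier →ₗ[ℂ]
    Ω.carrier ⊗[ℂ] (E.centreZero ⊗[ℂ] F.centreZero) :=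
  TensorProduct.lift ((TensorProduct.map₂ (LinearMap.mul ℂ Ω.carrier)
    (TensorProduct.mk ℂ _ _)).compl₁₂
    (centreEquiv hΩ hE).symm.toLinearMap (centreEquiv hΩ hF).symm.toLinearMap)

@[simp] lemma fromTensor_smul_smul (a b : Ω.carrier) (v : E.centreZero) (w : F.centreZero) :
    fromTensor hΩ hE hF ((a • (v : E.carrier)) ⊗ₜ (b • (w : F.carrier))) =
      (a * b) ⊗ₜ (v ⊗ₜ w) := by
  simp [fromTensor]

lemma toQuot_fromTensor (x : E.carrier ⊗[ℂ] F.carrier) :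
    toQuot E F (fromTensor hΩ hE hF x) = (tensorRel E F).mkQ x := by
  induction x with
  | zero => simp
  | add x y hx hy => simp only [map_add, hx, hy]
  | tmul e f =>
    refine induction_pair (P := fun e f => toQuot E F (fromTensor hΩ hE hF (e ⊗ₜ f)) =
      (tensorRel E F).mkQ (e ⊗ₜ f)) ?_ ?_ ?_ ?_ ?_ hE hF e f
    · intro f; simp
    · intro e; simp
    · intro a b v w
      rw [fromTensor_smul_smul, toQuot]
      simp only [LinearMap.comp_apply, LinearEquiv.coe_coe, TensorProduct.assoc_symm_tmul,
        TensorProduct.map_tmul, ofCentre_tmul, Submodule.subtype_apply, Submodule.mkQ_apply]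
      refine (Submodule.Quotient.eq _).2 (Submodule.subset_span ⟨a • v.1, b, w.1, ?_⟩)
      rw [smul_op_smul_centre]
    · intro x y f hx hy; simp only [TensorProduct.add_tmul, map_add, hx, hy]
    · intro e x y hx hy; simp only [TensorProduct.tmul_add, map_add, hx, hy]

lemma fromTensor_rel {x : E.carrier ⊗[ℂ] F.carrier} (hx : x ∈ tensorRel E F) :
    fromTensor hΩ hE hF x = 0 := by
  suffices h : tensorRel E F ≤ LinearMap.ker (fromTensor hΩ hE hF) from h hx
  refine Submodule.span_le.2 ?_
  rintro x ⟨e, a, f, rfl⟩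
  change fromTensor hΩ hE hF _ = 0
  rw [map_sub, sub_eq_zero]
  refine induction_pair (P := fun e f => fromTensor hΩ hE hF ((e <• a) ⊗ₜ f) =
      fromTensor hΩ hE hF (e ⊗ₜ (a • f))) ?_ ?_ ?_ ?_ ?_ hE hF e f
  · intro f; simp
  · intro e; simp
  · intro b c v w
    rw [smul_op_smul_centre, smul_smul, fromTensor_smul_smul, fromTensor_smul_smul, mul_assoc]
  · intro x y f hx hy; simp only [smul_add, TensorProduct.add_tmul, map_add, hx, hy]
  · intro e x y hx hy; simp only [smul_add, TensorProduct.tmul_add, map_add, hx, hy]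

/-- The bilinear map induced by `m` is `Ω ⊗ m` under the identifications of `E ⊗_Ω F` with
`Ω ⊗ (Z_g(E)⁰ ⊗ Z_g(F)⁰)` and of `G` with `Ω ⊗ Z_g(G)⁰`. -/
lemma lift_bilinExtend (x : E.carrier ⊗[ℂ] F.carrier) :
    TensorProduct.lift (bilinExtend hΩ hE hF m) x =
      G.ofCentre ((TensorProduct.lift m).lTensor Ω.carrier (fromTensor hΩ hE hF x)) := by
  induction x with
  | zero => simp
  | add x y hx hy => simp only [map_add, hx, hy]
  | tmul e f =>
    refine induction_pair (P := fun e f => TensorProduct.lift (bilinExtend hΩ hE hF m) (e ⊗ₜ f) =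
      G.ofCentre ((TensorProduct.lift m).lTensor Ω.carrier (fromTensor hΩ hE hF (e ⊗ₜ f))))
      ?_ ?_ ?_ ?_ ?_ hE hF e f
    · intro f; simp
    · intro e; simp
    · intro a b v w; rw [fromTensor_smul_smul]; simp
    · intro x y f hx hy; simp only [TensorProduct.add_tmul, map_add, hx, hy]
    · intro e x y hx hy; simp only [TensorProduct.tmul_add, map_add, hx, hy]

lemma fromTensor_surjective : Function.Surjective (fromTensor hΩ hE hF) := by
  rw [← LinearMap.range_eq_top, eq_top_iff]
  rintro t -
  induction t with
  | zero => exact Submodule.zero_mem _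
  | add x y hx hy => exact Submodule.add_mem _ hx hy
  | tmul a t =>
    induction t with
    | zero => rw [TensorProduct.tmul_zero]; exact Submodule.zero_mem _
    | add x y hx hy => rw [TensorProduct.tmul_add]; exact Submodule.add_mem _ hx hy
    | tmul v w =>
      refine ⟨(a • v.1) ⊗ₜ ((1 : Ω.carrier) • w.1), ?_⟩
      rw [fromTensor_smul_smul, mul_one]

/-- The extension of a tensor product `Z_g(E)⁰ × Z_g(F)⁰ → Z_g(G)⁰` is a tensor product over `Ω`. -/
lemma bilinExtend_isTensor (hG : G.IsFGP) (hm : IsTensorProduct m) :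
    LinearMap.range (TensorProduct.lift (bilinExtend hΩ hE hF m)) = ⊤ ∧
      LinearMap.ker (TensorProduct.lift (bilinExtend hΩ hE hF m)) = tensorRel E F := by
  have hb := (Module.FaithfullyFlat.lTensor_bijective_iff_bijective ℂ Ω.carrier
    (TensorProduct.lift m)).2 hm
  constructor
  · rw [LinearMap.range_eq_top]
    intro g
    obtain ⟨t, rfl⟩ := ofCentre_surjective hG g
    obtain ⟨t, rfl⟩ := hb.2 t
    obtain ⟨x, rfl⟩ := fromTensor_surjective hΩ hE hF t
    exact ⟨x, lift_bilinExtend hΩ hE hF m x⟩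
  · refine le_antisymm (fun x hx => ?_) (fun x hx => ?_)
    · rw [LinearMap.mem_ker, lift_bilinExtend] at hx
      have h1 := (injective_iff_map_eq_zero _).1 (ofCentre_injective hΩ hG) _ hx
      have h2 := (injective_iff_map_eq_zero _).1 hb.1 _ h1
      have h3 := toQuot_fromTensor hΩ hE hF x
      rw [h2, map_zero] at h3
      exact (Submodule.Quotient.mk_eq_zero _).1 h3.symm
    · rw [LinearMap.mem_ker, lift_bilinExtend, fromTensor_rel hΩ hE hF hx]
      simp

/-- A tensor product over `Ω` restricts to a tensor product `Z_g(E)⁰ × Z_g(F)⁰ → Z_g(G)⁰`. -/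
lemma isTensorProduct_restrict (hΩ : Ω.centreZero = ⊥) (hE : E.IsFGP) (hF : F.IsFGP)
    (hG : G.IsFGP) (μ : E.carrier →ₗ[ℂ] F.carrier →ₗ[ℂ] G.carrier)
    (surj : LinearMap.range (TensorProduct.lift μ) = ⊤)
    (ker : LinearMap.ker (TensorProduct.lift μ) = tensorRel E F)
    (hμ : ∀ (a : Ω.carrier) e f, μ (a • e) f = a • μ e f)
    (hm : ∀ (v : E.centreZero) (w : F.centreZero),
      μ (v : E.carrier) (w : F.carrier) = (m v w : G.carrier)) :
    IsTensorProduct m := by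
  have hbal : ∀ (e : E.carrier) (a : Ω.carrier) (f : F.carrier), μ (e <• a) f = μ e (a • f) := by
    intro e a f
    have : (e <• a) ⊗ₜ[ℂ] f - e ⊗ₜ[ℂ] (a • f) ∈ LinearMap.ker (TensorProduct.lift μ) := by
      rw [ker]; exact Submodule.subset_span ⟨e, a, f, rfl⟩
    simpa [sub_eq_zero] using this
  have hext : μ = bilinExtend hΩ hE hF m := by
    refine LinearMap.ext fun e => LinearMap.ext fun f => ?_
    refine induction_pair (P := fun e f => μ e f = bilinExtend hΩ hE hF m e f)
      ?_ ?_ ?_ ?_ ?_ hE hF e f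
    · intro f; simp
    · intro e; simp
    · intro a b v w
      rw [← hbal, smul_op_smul_centre, hμ, hm, bilinExtend_smul_smul]
    · intro x y f hx hy; simp only [map_add, LinearMap.add_apply, hx, hy]
    · intro e x y hx hy; simp only [map_add, hx, hy]
  subst hext
  refine (Module.FaithfullyFlat.lTensor_bijective_iff_bijective ℂ Ω.carrier
    (TensorProduct.lift m)).1 ⟨?_, fun t => ?_⟩
  · rw [injective_iff_map_eq_zero]
    intro t ht
    obtain ⟨x, rfl⟩ := fromTensor_surjective hΩ hE hF t
    refine fromTensor_rel hΩ hE hF ?_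
    rw [← ker, LinearMap.mem_ker, lift_bilinExtend, ht, map_zero]
  · obtain ⟨x, hx⟩ := LinearMap.range_eq_top.1 surj (G.ofCentre t)
    refine ⟨fromTensor hΩ hE hF x, ofCentre_injective hΩ hG ?_⟩
    rw [← lift_bilinExtend, hx]

end Extension

end Structure

end GradedBimodule

end

noncomputable section

/-! ### The centre of the noncommutative torus -/

namespace NCTorus

variable {θ : ℝ}

namespace Alg

lemma coeff_mono_mul (m n : ℤ) (a : Alg θ) (w : ℤ × ℤ) :
    (mono θ m n * a).coeff ((m, n) + w) = cocycle θ (m, n) w * a.coeff w := by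
  rw [coeff_mul, conv, tsum_eq_single (m, n) fun x hx => by simp [mono, Pi.single_eq_of_ne hx]]
  simp [mono, mul_comm]

lemma coeff_mul_mono (m n : ℤ) (a : Alg θ) (w : ℤ × ℤ) :
    (a * mono θ m n).coeff ((m, n) + w) = cocycle θ w (m, n) * a.coeff w := by
  rw [coeff_mul, conv, tsum_eq_single w fun x hx => by
    have : (m, n) + w - x ≠ (m, n) := fun h => hx (by
      rw [sub_eq_iff_eq_add] at h; exact (add_left_cancel h).symm)
    simp [mono, Pi.single_eq_of_ne this]]
  simp [mono, mul_comm]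

/-- As `θ` is irrational, `λᵏ ≠ 1` for `k ≠ 0`. -/
lemma cexp_ne_one (hθ : Irrational θ) {k : ℤ} (hk : k ≠ 0) :
    Complex.exp (2 * Real.pi * Complex.I * θ * (k : ℂ)) ≠ 1 := by
  rw [Ne, Complex.exp_eq_one_iff]
  rintro ⟨n, hn⟩
  have h1 : (2 * Real.pi * Complex.I : ℂ) * (θ * k) = 2 * Real.pi * Complex.I * n := by
    linear_combination hn
  have h2 := mul_left_cancel₀ Complex.two_pi_I_ne_zero h1
  have h3 : θ * k = n := by exact_mod_cast h2
  exact (hθ.mul_intCast hk).ne_int n h3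

lemma eq_algebraMap_of_coeff {a : Alg θ} (h : ∀ x, x ≠ 0 → a.coeff x = 0) :
    a = algebraMap ℂ (Alg θ) (a.coeff 0) := by
  rw [Algebra.algebraMap_eq_smul_one]
  ext x
  rcases eq_or_ne x 0 with rfl | hx
  · simp
  · simp [h x hx, Pi.single_eq_of_ne hx]

/-- An element that commutes with `u` and `v` is a scalar. -/
lemma eq_algebraMap_of_commute (hθ : Irrational θ) {a : Alg θ} (h : ∀ b, a * b = b * a) :
    a = algebraMap ℂ (Alg θ) (a.coeff 0) := by
  refine eq_algebraMap_of_coeff fun w hw => ?_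
  by_contra ha
  refine hw (Prod.ext ?_ ?_)
  · have h1 := congrArg (fun b => b.coeff ((0, 1) + w)) (h (mono θ 0 1))
    simp only [coeff_mono_mul, coeff_mul_mono] at h1
    have h2 := mul_right_cancel₀ ha h1
    by_contra hk
    refine cexp_ne_one hθ (neg_ne_zero.2 hk) ?_
    simpa [cocycle] using h2.symm
  · have h1 := congrArg (fun b => b.coeff ((1, 0) + w)) (h (mono θ 1 0))
    simp only [coeff_mono_mul, coeff_mul_mono] at h1
    have h2 := mul_right_cancel₀ ha h1
    by_contra hk
    refine cexp_ne_one hθ (neg_ne_zero.2 hk) ?_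
    simpa [cocycle] using h2

lemma center_eq_bot (hθ : Irrational θ) : Subalgebra.center ℂ (Alg θ) = ⊥ := by
  refine eq_bot_iff.2 fun a ha => Algebra.mem_bot.2 ⟨a.coeff 0, ?_⟩
  exact (eq_algebraMap_of_commute hθ fun b => (Subalgebra.mem_center_iff.1 ha b).symm).symm

/-- An element fixed by the torus action is a scalar. -/
lemma eq_algebraMap_of_rot {a : Alg θ} (h : ∀ t, rot t a = a) :
    a = algebraMap ℂ (Alg θ) (a.coeff 0) := by
  refine eq_algebraMap_of_coeff fun x hx => ?_
  have key : ∀ t : ℝ × ℝ, x.1 * t.1 + x.2 * t.2 = Real.pi → a.coeff x = 0 := by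
    intro t ht
    have h1 := congrArg (fun b => b.coeff x) (h t)
    simp only [coeff_rot, ht, Complex.exp_pi_mul_I] at h1
    linear_combination (-1 / 2 : ℂ) * h1
  by_cases h1 : x.1 = 0
  · have h2 : (x.2 : ℝ) ≠ 0 := fun h2 => hx (Prod.ext h1 (by exact_mod_cast h2))
    exact key (0, Real.pi / x.2) (by field_simp; simp)
  · have h2 : (x.1 : ℝ) ≠ 0 := by exact_mod_cast h1
    exact key (Real.pi / x.1, 0) (by field_simp; simp)

lemma rot_algebraMap (t : ℝ × ℝ) (c : ℂ) :
    rot t (algebraMap ℂ (Alg θ) c) = algebraMap ℂ (Alg θ) c := AlgHom.commutes _ _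

lemma δ₁_algebraMap (c : ℂ) : δ₁ (algebraMap ℂ (Alg θ) c) = 0 := by
  have : δ₁ (1 : Alg θ) = 0 := by simpa using δ₁_mul (1 : Alg θ) 1
  rw [Algebra.algebraMap_eq_smul_one, map_smul, this, smul_zero]

lemma δ₂_algebraMap (c : ℂ) : δ₂ (algebraMap ℂ (Alg θ) c) = 0 := by
  have : δ₂ (1 : Alg θ) = 0 := by simpa using δ₂_mul (1 : Alg θ) 1
  rw [Algebra.algebraMap_eq_smul_one, map_smul, this, smul_zero]

instance : Nontrivial (Alg θ) := ⟨1, 0, fun h => by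
  have := congrArg (fun b => b.coeff 0) h
  simp at this⟩

end Alg

namespace Forms

/-- The form `c₀ + c₁ u⁻¹du + c₂ v⁻¹dv + c₁₂ u⁻¹du v⁻¹dv` with constant coefficients. -/
def const (θ : ℝ) : (ℂ × ℂ × ℂ × ℂ) →ₗ[ℂ] Forms θ where
  toFun c := ⟨algebraMap ℂ _ c.1, algebraMap ℂ _ c.2.1, algebraMap ℂ _ c.2.2.1,
    algebraMap ℂ _ c.2.2.2⟩
  map_add' c c' := by ext1 <;> simp
  map_smul' a c := by ext1 <;> simp [Algebra.algebraMap_eq_smul_one, mul_smul]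

@[simp] lemma const_f₀ (c : ℂ × ℂ × ℂ × ℂ) : (const θ c).f₀ = algebraMap ℂ _ c.1 := rfl
@[simp] lemma const_f₁ (c : ℂ × ℂ × ℂ × ℂ) : (const θ c).f₁ = algebraMap ℂ _ c.2.1 := rfl
@[simp] lemma const_f₂ (c : ℂ × ℂ × ℂ × ℂ) : (const θ c).f₂ = algebraMap ℂ _ c.2.2.1 := rfl
@[simp] lemma const_f₁₂ (c : ℂ × ℂ × ℂ × ℂ) : (const θ c).f₁₂ = algebraMap ℂ _ c.2.2.2 := rfl

lemma const_injective : Function.Injective (const θ) := by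
  intro c c' h
  have hinj := (algebraMap ℂ (Alg θ)).injective
  exact Prod.ext (hinj (congrArg f₀ h)) (Prod.ext (hinj (congrArg f₁ h))
    (Prod.ext (hinj (congrArg f₂ h)) (hinj (congrArg f₁₂ h))))

lemma mem_range_const {w : Forms θ} : w ∈ LinearMap.range (const θ) ↔
    w.f₀ = algebraMap ℂ _ (w.f₀.coeff 0) ∧ w.f₁ = algebraMap ℂ _ (w.f₁.coeff 0) ∧
    w.f₂ = algebraMap ℂ _ (w.f₂.coeff 0) ∧ w.f₁₂ = algebraMap ℂ _ (w.f₁₂.coeff 0) := by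
  have h0 : ∀ c : ℂ, (algebraMap ℂ (Alg θ) c).coeff 0 = c := by
    intro c; rw [Algebra.algebraMap_eq_smul_one]; simp
  constructor
  · rintro ⟨c, rfl⟩
    simp [h0]
  · rintro ⟨h1, h2, h3, h4⟩
    exact ⟨(w.f₀.coeff 0, w.f₁.coeff 0, w.f₂.coeff 0, w.f₁₂.coeff 0),
      Forms.ext h1.symm h2.symm h3.symm h4.symm⟩

lemma const_eq (c : ℂ × ℂ × ℂ × ℂ) : const θ c = algebraMap ℂ _ c.1 + c.2.1 • uForm θ +
    c.2.2.1 • vForm θ + c.2.2.2 • (uForm θ * vForm θ) := by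
  rw [uForm_eq, vForm_eq]
  ext1 <;> simp [Algebra.algebraMap_eq_smul_one]

lemma d_const (c : ℂ × ℂ × ℂ × ℂ) : d (const θ c) = 0 := by
  ext1 <;> simp [Alg.δ₁_algebraMap, Alg.δ₂_algebraMap]

instance : Nontrivial (Forms θ) := ⟨1, 0, fun h => one_ne_zero (congrArg f₀ h)⟩

lemma rot_eq (t : ℝ × ℝ) (w : Forms θ) : rot t w =
    ⟨Alg.rot t w.f₀, Alg.rot t w.f₁, Alg.rot t w.f₂, Alg.rot t w.f₁₂⟩ := rfl

lemma invariants_eq : invariants θ = LinearMap.range (const θ) := by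
  ext w
  rw [mem_range_const]
  constructor
  · intro h
    exact ⟨Alg.eq_algebraMap_of_rot fun t => congrArg f₀ (h t),
      Alg.eq_algebraMap_of_rot fun t => congrArg f₁ (h t),
      Alg.eq_algebraMap_of_rot fun t => congrArg f₂ (h t),
      Alg.eq_algebraMap_of_rot fun t => congrArg f₁₂ (h t)⟩
  · rintro ⟨h1, h2, h3, h4⟩ t
    rw [rot_eq]
    ext1
    · dsimp only; rw [h1, Alg.rot_algebraMap]
    · dsimp only; rw [h2, Alg.rot_algebraMap]
    · dsimp only; rw [h3, Alg.rot_algebraMap]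
    · dsimp only; rw [h4, Alg.rot_algebraMap]

lemma projDeg_zero (w : Forms θ) : projDeg (deg θ) 0 w = ⟨w.f₀, 0, 0, 0⟩ := by
  have e : w = ⟨w.f₀, 0, 0, 0⟩ + ⟨0, w.f₁, w.f₂, 0⟩ + ⟨0, 0, 0, w.f₁₂⟩ := by ext1 <;> simp
  conv_lhs => rw [e]
  rw [map_add, map_add, projDeg_of_mem (by simp [mem_deg_zero]),
    projDeg_of_ne (i := 1) (by norm_num) (by simp [mem_deg_one]),
    projDeg_of_ne (i := 2) (by norm_num) (by simp [mem_deg_two]), add_zero, add_zero]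

lemma projDeg_one (w : Forms θ) : projDeg (deg θ) 1 w = ⟨0, w.f₁, w.f₂, 0⟩ := by
  have e : w = ⟨w.f₀, 0, 0, 0⟩ + ⟨0, w.f₁, w.f₂, 0⟩ + ⟨0, 0, 0, w.f₁₂⟩ := by ext1 <;> simp
  conv_lhs => rw [e]
  rw [map_add, map_add, projDeg_of_ne (i := 0) (by norm_num) (by simp [mem_deg_zero]),
    projDeg_of_mem (by simp [mem_deg_one]),
    projDeg_of_ne (i := 2) (by norm_num) (by simp [mem_deg_two]), add_zero, zero_add]

lemma projDeg_two (w : Forms θ) : projDeg (deg θ) 2 w = ⟨0, 0, 0, w.f₁₂⟩ := by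
  have e : w = ⟨w.f₀, 0, 0, 0⟩ + ⟨0, w.f₁, w.f₂, 0⟩ + ⟨0, 0, 0, w.f₁₂⟩ := by ext1 <;> simp
  conv_lhs => rw [e]
  rw [map_add, map_add, projDeg_of_ne (i := 0) (by norm_num) (by simp [mem_deg_zero]),
    projDeg_of_ne (i := 1) (by norm_num) (by simp [mem_deg_one]),
    projDeg_of_mem (by simp [mem_deg_two]), zero_add, zero_add]

lemma projDeg_add_three (n : ℕ) (w : Forms θ) : projDeg (deg θ) (n + 3) w = 0 :=
  mem_deg_add_three.1 (projDeg_mem (n + 3) w)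

lemma mem_gradedCentre {w : Forms θ} : w ∈ (dga θ).gradedCentre ↔ ∀ i j, ∀ ν ∈ deg θ j,
    projDeg (deg θ) i w * ν = (-1 : ℂ) ^ (i * j) • (ν * projDeg (deg θ) i w) := Iff.rfl

/-- The graded centre consists of the forms with constant coefficients: the coefficients commute
with `𝒜_θ`, which is contained in degree zero. -/
lemma gradedCentre_eq (hθ : Irrational θ) :
    (dga θ).gradedCentre = LinearMap.range (const θ) := by
  refine le_antisymm (fun w h => ?_) ?_
  · rw [mem_gradedCentre] at h
    have hb : ∀ b : Alg θ, (⟨b, 0, 0, 0⟩ : Forms θ) ∈ deg θ 0 := fun b => by simp [mem_deg_zero]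
    rw [mem_range_const]
    refine ⟨Alg.eq_algebraMap_of_commute hθ fun b => ?_,
      Alg.eq_algebraMap_of_commute hθ fun b => ?_, Alg.eq_algebraMap_of_commute hθ fun b => ?_,
      Alg.eq_algebraMap_of_commute hθ fun b => ?_⟩
    · simpa [projDeg_zero] using congrArg f₀ (h 0 0 _ (hb b))
    · simpa [projDeg_one] using congrArg f₁ (h 1 0 _ (hb b))
    · simpa [projDeg_one] using congrArg f₂ (h 1 0 _ (hb b))
    · simpa [projDeg_two] using congrArg f₁₂ (h 2 0 _ (hb b))
  · rintro _ ⟨c, rfl⟩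
    rw [mem_gradedCentre]
    intro i j ν hν
    have hc : ∀ (c : ℂ) (b : Alg θ), algebraMap ℂ _ c * b = b * algebraMap ℂ _ c := fun c b =>
      Algebra.commutes c b
    match i, j, hν with
    | 0, j, hν => rw [projDeg_zero]; ext1 <;> simp [hc]
    | 1, 0, hν =>
      rw [mem_deg_zero] at hν
      rw [projDeg_one]; ext1 <;> simp [hν, hc]
    | 1, 1, hν =>
      rw [mem_deg_one] at hν
      rw [projDeg_one]; ext1 <;> simp [hν, hc]
    | 1, 2, hν =>
      rw [mem_deg_two] at hν
      rw [projDeg_one]; ext1 <;> simp [hν, hc]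
    | 2, 0, hν =>
      rw [mem_deg_zero] at hν
      rw [projDeg_two]; ext1 <;> simp [hν, hc]
    | 2, 1, hν =>
      rw [mem_deg_one] at hν
      rw [projDeg_two]; ext1 <;> simp [hν, hc]
    | 2, 2, hν =>
      rw [mem_deg_two] at hν
      rw [projDeg_two]; ext1 <;> simp [hν, hc]
    | i + 3, j, hν => rw [projDeg_add_three]; simp
    | i, j + 3, hν => rw [mem_deg_add_three] at hν; simp [hν]

lemma algebraMap_mem_const (c : ℂ) : algebraMap ℂ (Forms θ) c ∈ LinearMap.range (const θ) :=
  ⟨(c, 0, 0, 0), by rw [const_eq]; simp⟩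

lemma centreZero_eq_bot (hθ : Irrational θ) : (dga θ).centreZero = ⊥ := by
  refine eq_bot_iff.2 fun w hw => ?_
  have h1 : w ∈ LinearMap.range (const θ) := by
    rw [← gradedCentre_eq hθ]
    exact hw.1
  have h2 : w ∈ deg θ 0 := hw.2
  obtain ⟨c, rfl⟩ := h1
  rw [mem_deg_zero] at h2
  simp only [const_f₁, const_f₂, const_f₁₂, FaithfulSMul.algebraMap_eq_zero_iff] at h2
  refine Algebra.mem_bot.2 ⟨c.1, ?_⟩
  rw [const_eq, h2.1, h2.2.1, h2.2.2]
  simp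

/-- The algebra `Z_g(Ω)⁰ = ℂ` has exactly one character. -/
lemma nonempty_unique_basePoint (hθ : Irrational θ) : Nonempty (Unique (dga θ).BasePoint) := by
  have h : ∀ x : (dga θ).centreZero, ∃ c : ℂ, algebraMap ℂ _ c = x := by
    intro x
    obtain ⟨c, hc⟩ := Algebra.mem_bot.1 ((centreZero_eq_bot hθ).le x.2)
    exact ⟨c, Subtype.ext hc⟩
  have hb : Function.Bijective (algebraMap ℂ (dga θ).centreZero) :=
    ⟨(algebraMap ℂ _).injective, h⟩
  let e : ℂ ≃ₐ[ℂ] (dga θ).centreZero := AlgEquiv.ofBijective (Algebra.ofId ℂ _) hb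
  refine ⟨⟨⟨e.symm.toAlgHom⟩, fun p => AlgHom.ext fun x => ?_⟩⟩
  obtain ⟨c, rfl⟩ := h x
  rw [AlgHom.commutes, AlgHom.commutes]

/-! ### The exterior algebra of the invariant one-forms -/

lemma linearIndependent_uForm_vForm : LinearIndependent ℂ ![uForm θ, vForm θ] := by
  rw [LinearIndependent.pair_iff]
  intro a b h
  have : const θ (0, a, b, 0) = 0 := by rw [const_eq]; simpa using h
  have := const_injective (this.trans (map_zero (const θ)).symm)
  simp only [Prod.mk_eq_zero] at this
  exact ⟨this.2.1, this.2.2.1⟩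

lemma mem_invOneForms {w : Forms θ} :
    w ∈ invOneForms θ ↔ ∃ a b : ℂ, const θ (0, a, b, 0) = w := by
  rw [invOneForms, Submodule.mem_span_pair]
  simp [const_eq]

lemma const_one_mul_self (a b : ℂ) : const θ (0, a, b, 0) * const θ (0, a, b, 0) = 0 := by
  ext1 <;> simp [Algebra.commutes b]

/-- The algebra homomorphism `⋀ V → Ω𝒜_θ` that extends the inclusion of the span `V` of `u⁻¹du` and
`v⁻¹dv`. -/
def exterior (θ : ℝ) : ExteriorAlgebra ℂ (invOneForms θ) →ₐ[ℂ] Forms θ :=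
  ExteriorAlgebra.lift ℂ ⟨(invOneForms θ).subtype, fun v => by
    obtain ⟨a, b, h⟩ := mem_invOneForms.1 v.2
    rw [Submodule.subtype_apply, ← h, const_one_mul_self]⟩

@[simp] lemma exterior_ι (v : invOneForms θ) : exterior θ (ExteriorAlgebra.ι ℂ v) = v :=
  ExteriorAlgebra.lift_ι_apply ℂ _ _ v

/-- The element `u⁻¹du` of `V`. -/
def uVec (θ : ℝ) : invOneForms θ := ⟨uForm θ, Submodule.subset_span (by simp)⟩

/-- The element `v⁻¹dv` of `V`. -/
def vVec (θ : ℝ) : invOneForms θ := ⟨vForm θ, Submodule.subset_span (by simp)⟩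

/-- The map `ℂ⁴ → ⋀ V` given by the basis `1, u⁻¹du, v⁻¹dv, u⁻¹du ∧ v⁻¹dv`. -/
def extConst (θ : ℝ) : (ℂ × ℂ × ℂ × ℂ) →ₗ[ℂ] ExteriorAlgebra ℂ (invOneForms θ) where
  toFun c := algebraMap ℂ _ c.1 + c.2.1 • ExteriorAlgebra.ι ℂ (uVec θ) +
    c.2.2.1 • ExteriorAlgebra.ι ℂ (vVec θ) +
    c.2.2.2 • (ExteriorAlgebra.ι ℂ (uVec θ) * ExteriorAlgebra.ι ℂ (vVec θ))
  map_add' c c' := by simp only [Prod.fst_add, Prod.snd_add, map_add, add_smul]; abel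
  map_smul' a c := by
    simp [Algebra.smul_def, mul_assoc, mul_add]

lemma exterior_extConst (c : ℂ × ℂ × ℂ × ℂ) : exterior θ (extConst θ c) = const θ c := by
  rw [const_eq]
  simp [extConst, uVec, vVec]

/-- The range of `extConst` is a left ideal that contains `1`. -/
lemma extConst_surjective : Function.Surjective (extConst θ) := by
  let e := ExteriorAlgebra.ι ℂ (uVec θ)
  let f := ExteriorAlgebra.ι ℂ (vVec θ)
  have he : e * e = 0 := ExteriorAlgebra.ι_sq_zero _
  have hf : f * f = 0 := ExteriorAlgebra.ι_sq_zero _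
  have hef : f * e = -(e * f) := by
    have := ExteriorAlgebra.ι_add_mul_swap (R := ℂ) (uVec θ) (vVec θ)
    exact (eq_neg_of_add_eq_zero_right this)
  have hmul : ∀ a x, (∃ c, extConst θ c = x) → ∃ c, extConst θ c = a * x := by
    intro a
    induction a using ExteriorAlgebra.induction with
    | algebraMap r =>
      rintro x ⟨c, rfl⟩
      exact ⟨r • c, by rw [map_smul, Algebra.smul_def]⟩
    | ι v =>
      rintro x ⟨c, rfl⟩
      obtain ⟨a, b, h⟩ := mem_invOneForms.1 v.2
      have hv : v = a • uVec θ + b • vVec θ := by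
        refine Subtype.ext (h.symm.trans ?_)
        rw [const_eq]
        simp [uVec, vVec]
      refine ⟨(0, a * c.1, b * c.1, a * c.2.2.1 - b * c.2.1), ?_⟩
      rw [hv, map_add, map_smul, map_smul]
      change algebraMap ℂ _ 0 + (a * c.1) • e + (b * c.1) • f +
        (a * c.2.2.1 - b * c.2.1) • (e * f) = (a • e + b • f) *
        (algebraMap ℂ _ c.1 + c.2.1 • e + c.2.2.1 • f + c.2.2.2 • (e * f))
      have h1 : e * (e * f) = 0 := by rw [← mul_assoc, he, zero_mul]
      have h2 : f * (e * f) = 0 := by rw [← mul_assoc, hef, neg_mul, mul_assoc, hf]; simp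
      simp only [Algebra.algebraMap_eq_smul_one, mul_add, add_mul, smul_mul_assoc, mul_smul_comm,
        he, hf, hef, h1, h2, mul_one]
      module
    | mul a b ha hb =>
      intro x hx
      rw [mul_assoc]
      exact ha _ (hb x hx)
    | add a b ha hb =>
      intro x hx
      obtain ⟨c, hc⟩ := ha x hx
      obtain ⟨c', hc'⟩ := hb x hx
      exact ⟨c + c', by rw [map_add, hc, hc', add_mul]⟩
  intro x
  obtain ⟨c, hc⟩ := hmul x 1 ⟨(1, 0, 0, 0), by simp [extConst]⟩
  exact ⟨c, by rw [hc, mul_one]⟩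

lemma exterior_injective : Function.Injective (exterior θ) := by
  intro x y h
  obtain ⟨c, rfl⟩ := extConst_surjective x
  obtain ⟨c', rfl⟩ := extConst_surjective y
  rw [exterior_extConst, exterior_extConst] at h
  rw [const_injective h]

lemma range_exterior : LinearMap.range (exterior θ).toLinearMap = LinearMap.range (const θ) := by
  ext w
  constructor
  · rintro ⟨x, rfl⟩
    obtain ⟨c, rfl⟩ := extConst_surjective x
    exact ⟨c, (exterior_extConst c).symm⟩
  · rintro ⟨c, rfl⟩
    exact ⟨extConst θ c, exterior_extConst c⟩

lemma map_exteriorPower (k : ℕ) : (⋀[ℂ]^k (invOneForms θ)).map (exterior θ).toLinearMap =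
    LinearMap.range (const θ) ⊓ deg θ k := by
  have h1 : (⋀[ℂ]^k (invOneForms θ)).map (exterior θ).toLinearMap = invOneForms θ ^ k := by
    have h2 : (LinearMap.range (ExteriorAlgebra.ι ℂ : invOneForms θ →ₗ[ℂ] _)).map
        (exterior θ).toLinearMap = invOneForms θ := by
      rw [← LinearMap.range_comp]
      have : (exterior θ).toLinearMap ∘ₗ ExteriorAlgebra.ι ℂ = (invOneForms θ).subtype :=
        LinearMap.ext fun v => exterior_ι v
      rw [this, Submodule.range_subtype]
    exact (Submodule.map_pow _ _ _).trans (by rw [h2])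
  have hz : ∀ c : ℂ, algebraMap ℂ (Alg θ) c = 0 ↔ c = 0 := fun c =>
    FaithfulSMul.algebraMap_eq_zero_iff ℂ (Alg θ)
  have hmem : ∀ c : ℂ × ℂ × ℂ × ℂ, const θ c ∈ LinearMap.range (const θ) := fun c => ⟨c, rfl⟩
  have hsq : invOneForms θ ^ 2 = LinearMap.range (const θ) ⊓ deg θ 2 := by
    rw [pow_two]
    refine le_antisymm (Submodule.mul_le.2 ?_) ?_
    · intro x hx y hy
      obtain ⟨a, b, rfl⟩ := mem_invOneForms.1 hx
      obtain ⟨a', b', rfl⟩ := mem_invOneForms.1 hy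
      have : const θ (0, a, b, 0) * const θ (0, a', b', 0) =
          const θ (0, 0, 0, a * b' - b * a') := by ext1 <;> simp
      rw [this]
      exact ⟨hmem _, by simp [mem_deg_two]⟩
    · rintro _ ⟨⟨c, rfl⟩, hc⟩
      have hc := mem_deg_two.1 hc
      simp only [const_f₀, const_f₁, const_f₂, hz] at hc
      rw [const_eq, hc.1, hc.2.1, hc.2.2]
      simp only [map_zero, zero_smul, zero_add]
      exact Submodule.smul_mem _ _ (Submodule.mul_mem_mul (uVec θ).2 (vVec θ).2)
  rw [h1]
  match k with
  | 0 =>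
    rw [pow_zero]
    refine le_antisymm ?_ ?_
    · intro x hx
      obtain ⟨c, rfl⟩ := Submodule.mem_one.1 hx
      exact ⟨algebraMap_mem_const c, SetLike.algebraMap_mem_graded (deg θ) c⟩
    · rintro _ ⟨⟨c, rfl⟩, hc⟩
      have hc := mem_deg_zero.1 hc
      simp only [const_f₁, const_f₂, const_f₁₂, hz] at hc
      rw [const_eq, hc.1, hc.2.1, hc.2.2]
      exact Submodule.mem_one.2 ⟨c.1, by simp⟩
  | 1 =>
    rw [pow_one]
    refine le_antisymm ?_ ?_
    · intro x hx
      obtain ⟨a, b, rfl⟩ := mem_invOneForms.1 hx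
      exact ⟨hmem _, by simp [mem_deg_one]⟩
    · rintro _ ⟨⟨c, rfl⟩, hc⟩
      have hc := mem_deg_one.1 hc
      simp only [const_f₀, const_f₁₂, hz] at hc
      refine mem_invOneForms.2 ⟨c.2.1, c.2.2.1, ?_⟩
      congr 1
      exact Prod.ext hc.1.symm (Prod.ext rfl (Prod.ext rfl hc.2.symm))
  | 2 => exact hsq
  | n + 3 =>
    have h3 : invOneForms θ ^ 3 = ⊥ := by
      rw [pow_succ, hsq]
      refine eq_bot_iff.2 (Submodule.mul_le.2 fun x hx y hy => ?_)
      obtain ⟨a, b, rfl⟩ := mem_invOneForms.1 hy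
      have hx := mem_deg_two.1 hx.2
      rw [Submodule.mem_bot]
      ext1 <;> simp [hx]
    rw [pow_add, h3, Submodule.mul_bot]
    exact (eq_bot_iff.2 fun x hx => (Submodule.mem_bot ℂ).2 (mem_deg_add_three.1 hx.2)).symm

end Forms

end NCTorus

end

noncomputable section

/-! ### Central frames -/

open scoped RightActions

namespace NCTorus

variable {θ : ℝ}

namespace Forms

lemma uForm_eq_const : uForm θ = const θ (0, 1, 0, 0) := by rw [const_eq]; simp

lemma vForm_eq_const : vForm θ = const θ (0, 0, 1, 0) := by rw [const_eq]; simp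

lemma d_uForm : d (uForm θ) = 0 := by rw [uForm_eq_const, d_const]

lemma d_vForm : d (vForm θ) = 0 := by rw [vForm_eq_const, d_const]

lemma uForm_mem : uForm θ ∈ deg θ 1 := by rw [uForm_eq]; simp [mem_deg_one]

lemma vForm_mem : vForm θ ∈ deg θ 1 := by rw [vForm_eq]; simp [mem_deg_one]

lemma uForm_mul_vForm_ne_zero : uForm θ * vForm θ ≠ 0 := by
  rw [uForm_eq, vForm_eq]
  intro h
  have := congrArg f₁₂ h
  simp at this

lemma mul_deg (j : ℕ) (ν : Forms θ) (hν : ν ∈ deg θ j) :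
    uForm θ * ν = (-1 : ℂ) ^ j • (ν * uForm θ) ∧ vForm θ * ν = (-1 : ℂ) ^ j • (ν * vForm θ) := by
  rw [uForm_eq, vForm_eq]
  match j, hν with
  | 0, hν => rw [mem_deg_zero] at hν; constructor <;> ext1 <;> simp [hν]
  | 1, hν => rw [mem_deg_one] at hν; constructor <;> ext1 <;> simp [hν]
  | 2, hν => rw [mem_deg_two] at hν; constructor <;> ext1 <;> simp [hν]
  | j + 3, hν => rw [mem_deg_add_three] at hν; simp [hν]

lemma uForm_mul (j : ℕ) (ν : Forms θ) (hν : ν ∈ deg θ j) :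
    uForm θ * ν = (-1 : ℂ) ^ j • (ν * uForm θ) := (mul_deg j ν hν).1

lemma vForm_mul (j : ℕ) (ν : Forms θ) (hν : ν ∈ deg θ j) :
    vForm θ * ν = (-1 : ℂ) ^ j • (ν * vForm θ) := (mul_deg j ν hν).2

/-- A one-form that graded-commutes with all forms is a combination of `u⁻¹du` and `v⁻¹dv`. -/
lemma exists_of_graded_commute (hθ : Irrational θ) {x : Forms θ} (h1 : x ∈ deg θ 1)
    (h : ∀ j, ∀ ν ∈ deg θ j, x * ν = (-1 : ℂ) ^ j • (ν * x)) :
    ∃ a b : ℂ, x = a • uForm θ + b • vForm θ := by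
  have hx : x ∈ LinearMap.range (const θ) := by
    rw [← gradedCentre_eq hθ, mem_gradedCentre]
    intro i j ν hν
    rcases eq_or_ne i 1 with rfl | hi
    · rw [projDeg_of_mem h1, one_mul]
      exact h j ν hν
    · rw [projDeg_of_ne hi.symm h1]
      simp
  obtain ⟨c, rfl⟩ := hx
  have hc := mem_deg_one.1 h1
  simp only [const_f₀, const_f₁₂, FaithfulSMul.algebraMap_eq_zero_iff] at hc
  exact ⟨c.2.1, c.2.2.1, by rw [const_eq, hc.1, hc.2]; simp⟩

end Forms

end NCTorus

/-- Two closed one-forms `u, v` that graded-commute with all forms and span the degree one part of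
the graded centre of `Ω`, with `uv ≠ 0`, where the degree zero part of the graded centre is `ℂ`. -/
structure CentralFrame (Ω : DGA) where
  u : Ω.carrier
  v : Ω.carrier
  centreZero_eq_bot : Ω.centreZero = ⊥
  u_mem : u ∈ Ω.deg 1
  v_mem : v ∈ Ω.deg 1
  d_u : Ω.d u = 0
  d_v : Ω.d v = 0
  u_mul : ∀ j, ∀ ν ∈ Ω.deg j, u * ν = (-1 : ℂ) ^ j • (ν * u)
  v_mul : ∀ j, ∀ ν ∈ Ω.deg j, v * ν = (-1 : ℂ) ^ j • (ν * v)
  u_mul_v_ne_zero : u * v ≠ 0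
  exists_of_graded_commute : ∀ x ∈ Ω.deg 1,
    (∀ j, ∀ ν ∈ Ω.deg j, x * ν = (-1 : ℂ) ^ j • (ν * x)) → ∃ a b : ℂ, x = a • u + b • v

namespace CentralFrame

variable {Ω : DGA} (c : CentralFrame Ω)

lemma u_mul_u : c.u * c.u = 0 := by
  have h := c.u_mul 1 c.u c.u_mem
  rw [pow_one, neg_one_smul] at h
  have h2 : (2 : ℂ) • (c.u * c.u) = 0 := by
    rw [two_smul]
    nth_rewrite 1 [h]
    exact neg_add_cancel _
  exact (smul_eq_zero.1 h2).resolve_left two_ne_zero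

lemma v_mul_v : c.v * c.v = 0 := by
  have h := c.v_mul 1 c.v c.v_mem
  rw [pow_one, neg_one_smul] at h
  have h2 : (2 : ℂ) • (c.v * c.v) = 0 := by
    rw [two_smul]
    nth_rewrite 1 [h]
    exact neg_add_cancel _
  exact (smul_eq_zero.1 h2).resolve_left two_ne_zero

lemma v_mul_u : c.v * c.u = -(c.u * c.v) := by
  rw [c.v_mul 1 c.u c.u_mem, pow_one, neg_one_smul]

lemma unique {a b a' b' : ℂ} (h : a • c.u + b • c.v = a' • c.u + b' • c.v) :
    a = a' ∧ b = b' := by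
  constructor
  · have h1 := congrArg (· * c.v) h
    simp only [add_mul, smul_mul_assoc, c.v_mul_v, smul_zero, add_zero] at h1
    exact smul_left_injective ℂ c.u_mul_v_ne_zero h1
  · have h1 := congrArg (c.u * ·) h
    simp only [mul_add, mul_smul_comm, c.u_mul_u, smul_zero, zero_add] at h1
    exact smul_left_injective ℂ c.u_mul_v_ne_zero h1

lemma nontrivial (c : CentralFrame Ω) : Nontrivial Ω.carrier :=
  ⟨⟨_, _, c.u_mul_v_ne_zero⟩⟩

end CentralFrame

/-- The frame `u⁻¹du, v⁻¹dv` of the noncommutative torus. -/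
def NCTorus.frame {θ : ℝ} (hθ : Irrational θ) : CentralFrame (NCTorus.dga θ) where
  u := Forms.uForm θ
  v := Forms.vForm θ
  centreZero_eq_bot := Forms.centreZero_eq_bot hθ
  u_mem := Forms.uForm_mem
  v_mem := Forms.vForm_mem
  d_u := Forms.d_uForm
  d_v := Forms.d_vForm
  u_mul := Forms.uForm_mul
  v_mul := Forms.vForm_mul
  u_mul_v_ne_zero := Forms.uForm_mul_vForm_ne_zero
  exists_of_graded_commute _ h1 h := Forms.exists_of_graded_commute hθ h1 h

/-! ### The endomorphisms given by a flat connection -/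

namespace FlatBimodule

open GradedBimodule

variable {Ω : DGA} (c : CentralFrame Ω) (E F G : FlatBimodule Ω)

section

variable {E}

lemma uv_smul_unique {a b a' b' : E.centreZero}
    (h : c.u • (a : E.carrier) + c.v • (b : E.carrier) =
      c.u • (a' : E.carrier) + c.v • (b' : E.carrier)) :
    a = a' ∧ b = b' := by
  have := c.nontrivial
  have key : ∀ l : E.centreZero →ₗ[ℂ] ℂ, l a = l a' ∧ l b = l b' := by
    intro l
    have h1 := congrArg (contract (c.centreZero_eq_bot) E.fgp l) h
    simp only [map_add, contract_smul_centre] at h1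
    exact c.unique h1
  exact ⟨eq_of_forall_functional fun l => (key l).1, eq_of_forall_functional fun l => (key l).2⟩

/-- For `ε ∈ Z_g(E)⁰`, the Leibniz rules show that `∇ε` graded-commutes with all forms, so that it
lies in the degree one part of the graded centre of `E`. -/
lemma nabla_graded_commute (v : E.centreZero) (j : ℕ) (ν : Ω.carrier) (hν : ν ∈ Ω.deg j) :
    E.nabla v <• ν = (-1 : ℂ) ^ j • (ν • E.nabla v) := by
  obtain ⟨h0, hc⟩ := mem_centreZero.1 v.2
  have h1 := E.nabla_right 0 v ν h0
  have h2 := E.nabla_left j ν v hν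
  rw [hc ν, h2, pow_zero, one_smul] at h1
  have h3 := hc (Ω.d ν)
  rw [h3, add_comm] at h1
  exact (add_right_cancel h1).symm

/-- The contractions of `∇ε` with functionals on `Z_g(E)⁰` are central one-forms in `Ω`, hence
combinations of `u` and `v`. -/
lemma exists_nabla_centre (v : E.centreZero) :
    ∃ a b : E.centreZero,
      E.nabla v = c.u • (a : E.carrier) + c.v • (b : E.carrier) := by
  have hΩ := c.centreZero_eq_bot
  have := c.nontrivial
  have := finiteDimensional_centreZero hΩ E.fgp
  let b := Module.finBasis ℂ E.centreZero
  have h : ∀ i, ∃ s t : ℂ,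
      contract hΩ E.fgp (b.coord i) (E.nabla v) = s • c.u + t • c.v := by
    intro i
    refine c.exists_of_graded_commute _ ?_ fun j ν hν => ?_
    · exact contract_mem hΩ E.fgp _ (E.nabla_mem 0 v (mem_centreZero.1 v.2).1)
    · have h1 := congrArg (contract hΩ E.fgp (b.coord i)) (nabla_graded_commute v j ν hν)
      rw [contract_op_smul, map_smul, contract_smul] at h1
      exact h1
  choose s t hst using h
  refine ⟨∑ i, s i • b i, ∑ i, t i • b i, ?_⟩
  rw [← sum_contract hΩ E.fgp b (E.nabla v), Submodule.coe_sum, Submodule.coe_sum,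
    Finset.smul_sum, Finset.smul_sum, ← Finset.sum_add_distrib]
  refine Finset.sum_congr rfl fun i _ => ?_
  rw [hst, add_smul, Submodule.coe_smul, Submodule.coe_smul, smul_assoc, smul_assoc,
    smul_comm (s i) (c.u), smul_comm (t i) (c.v)]

end

lemma nabla_add_centre {v w a b a' b' : E.centreZero}
    (hv : E.nabla v = c.u • (a : E.carrier) + c.v • (b : E.carrier))
    (hw : E.nabla w = c.u • (a' : E.carrier) + c.v • (b' : E.carrier)) :
    E.nabla ((v + w : E.centreZero) : E.carrier) =
      c.u • ((a + a' : E.centreZero) : E.carrier) +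
      c.v • ((b + b' : E.centreZero) : E.carrier) := by
  rw [Submodule.coe_add, Submodule.coe_add, Submodule.coe_add, map_add, hv, hw, smul_add, smul_add]
  abel

lemma nabla_smul_centre {v a b : E.centreZero} (k : ℂ)
    (hv : E.nabla v = c.u • (a : E.carrier) + c.v • (b : E.carrier)) :
    E.nabla ((k • v : E.centreZero) : E.carrier) =
      c.u • ((k • a : E.centreZero) : E.carrier) +
      c.v • ((k • b : E.centreZero) : E.carrier) := by
  rw [Submodule.coe_smul, Submodule.coe_smul, Submodule.coe_smul, map_smul, hv, smul_add,
    smul_comm k, smul_comm k]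

/-- The endomorphism `A₁` of `Z_g(E)⁰` with `∇ε = u A₁ε + v A₂ε`. -/
def conn₁ : E.centreZero →ₗ[ℂ] E.centreZero where
  toFun v := (exists_nabla_centre c v).choose
  map_add' v w := (uv_smul_unique c
    ((exists_nabla_centre c (v + w)).choose_spec.choose_spec.symm.trans (nabla_add_centre c E
      (exists_nabla_centre c v).choose_spec.choose_spec
      (exists_nabla_centre c w).choose_spec.choose_spec))).1
  map_smul' k v := (uv_smul_unique c
    ((exists_nabla_centre c (k • v)).choose_spec.choose_spec.symm.trans (nabla_smul_centre c E k
      (exists_nabla_centre c v).choose_spec.choose_spec))).1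

/-- The endomorphism `A₂` of `Z_g(E)⁰` with `∇ε = u A₁ε + v A₂ε`. -/
def conn₂ : E.centreZero →ₗ[ℂ] E.centreZero where
  toFun v := (exists_nabla_centre c v).choose_spec.choose
  map_add' v w := (uv_smul_unique c
    ((exists_nabla_centre c (v + w)).choose_spec.choose_spec.symm.trans (nabla_add_centre c E
      (exists_nabla_centre c v).choose_spec.choose_spec
      (exists_nabla_centre c w).choose_spec.choose_spec))).2
  map_smul' k v := (uv_smul_unique c
    ((exists_nabla_centre c (k • v)).choose_spec.choose_spec.symm.trans (nabla_smul_centre c E k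
      (exists_nabla_centre c v).choose_spec.choose_spec))).2

lemma nabla_centre (v : E.centreZero) : E.nabla v =
    c.u • (E.conn₁ c v : E.carrier) + c.v • (E.conn₂ c v : E.carrier) :=
  (exists_nabla_centre c v).choose_spec.choose_spec

variable {E F G}

lemma conn_eq {v a b : E.centreZero}
    (h : E.nabla v = c.u • (a : E.carrier) + c.v • (b : E.carrier)) :
    E.conn₁ c v = a ∧ E.conn₂ c v = b :=
  uv_smul_unique c ((E.nabla_centre c v).symm.trans h)

/-- The endomorphisms commute since the connection is flat. -/
lemma conn_comm (v : E.centreZero) :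
    E.conn₁ c (E.conn₂ c v) = E.conn₂ c (E.conn₁ c v) := by
  have := c.nontrivial
  have h := E.flat v
  have hu : ∀ x, E.nabla (c.u • x) = -(c.u • E.nabla x) := fun x => by
    rw [E.nabla_left 1 (c.u) x c.u_mem]
    rw [c.d_u, zero_smul, pow_one, neg_one_smul, zero_add]
  have hv : ∀ x, E.nabla (c.v • x) = -(c.v • E.nabla x) := fun x => by
    rw [E.nabla_left 1 (c.v) x c.v_mem]
    rw [c.d_v, zero_smul, pow_one, neg_one_smul, zero_add]
  rw [E.nabla_centre c v, map_add, hu, hv, E.nabla_centre c (E.conn₁ c v),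
    E.nabla_centre c (E.conn₂ c v), smul_add, smul_add] at h
  simp only [smul_smul] at h
  rw [c.u_mul_u, c.v_mul_v, c.v_mul_u, zero_smul, zero_smul, zero_add, add_zero,
    neg_smul, neg_neg, neg_add_eq_zero] at h
  refine eq_of_forall_functional fun l => ?_
  have h1 := congrArg (contract (c.centreZero_eq_bot) E.fgp l) h
  rw [contract_smul_centre, contract_smul_centre] at h1
  exact (smul_left_injective ℂ c.u_mul_v_ne_zero h1).symm

/-! ### Morphisms of flat connections -/

lemma centreMap_conn (f : E ⟶ F) (v : E.centreZero) :
    centreMap f (E.conn₁ c v) = F.conn₁ c (centreMap f v) ∧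
      centreMap f (E.conn₂ c v) = F.conn₂ c (centreMap f v) := by
  have h : F.nabla (centreMap f v) = c.u • (centreMap f (E.conn₁ c v) : F.carrier) +
      c.v • (centreMap f (E.conn₂ c v) : F.carrier) := by
    change F.nabla (Hom.toLinearMap f v) = c.u • Hom.toLinearMap f _ +
      c.v • Hom.toLinearMap f _
    rw [← Hom.map_nabla, E.nabla_centre c, map_add, Hom.map_smul, Hom.map_smul]
    rfl
  exact ⟨(conn_eq c h).1.symm, (conn_eq c h).2.symm⟩

/-- A linear map of the degree zero parts of the graded centres that intertwines the endomorphisms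
given by the connections extends to a morphism. -/
lemma exists_hom (f : E.centreZero →ₗ[ℂ] F.centreZero)
    (h1 : ∀ v, f (E.conn₁ c v) = F.conn₁ c (f v))
    (h2 : ∀ v, f (E.conn₂ c v) = F.conn₂ c (f v)) : ∃ g : E ⟶ F, centreMap g = f := by
  have hΩ := c.centreZero_eq_bot
  have := c.nontrivial
  refine ⟨(⟨extend hΩ E.fgp f, extend_smul hΩ E.fgp f, extend_op_smul hΩ E.fgp f,
    fun i e he => extend_mem hΩ E.fgp f he, fun e => ?_⟩ : Hom E F), ?_⟩
  · induction e using induction_homogeneous E.fgp with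
    | zero => simp
    | smul i a v ha =>
      rw [E.nabla_left i a v ha, extend_smul_centre, F.nabla_left i a _ ha, map_add,
        LinearMap.map_smul, extend_smul_centre, extend_smul, E.nabla_centre c,
        F.nabla_centre c, map_add,
        extend_smul_centre, extend_smul_centre, h1, h2]
    | add x y hx hy => simp only [map_add, hx, hy]
  · refine LinearMap.ext fun v => Subtype.ext ?_
    exact extend_centre hΩ E.fgp f v

/-! ### Tensor products of flat connections -/

/-- Tensor products of flat connections correspond to tensor products of the degree zero parts of
the graded centres for which the endomorphisms given by the connections satisfy the Leibniz rule. -/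
lemma exists_isTensor_iff (m : E.centreZero →ₗ[ℂ] F.centreZero →ₗ[ℂ] G.centreZero) :
    (∃ (μ : E.carrier →ₗ[ℂ] F.carrier →ₗ[ℂ] G.carrier), IsTensor E F G μ ∧
      ∀ (v : E.centreZero) (w : F.centreZero), μ (v : E.carrier) (w : F.carrier) = (m v w).1) ↔
    IsTensorProduct m ∧
      (∀ v w, m (E.conn₁ c v) w + m v (F.conn₁ c w) = G.conn₁ c (m v w)) ∧
      ∀ v w, m (E.conn₂ c v) w + m v (F.conn₂ c w) = G.conn₂ c (m v w) := by
  have hΩ := c.centreZero_eq_bot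
  have := c.nontrivial
  constructor
  · rintro ⟨μ, h, hm⟩
    refine ⟨isTensorProduct_restrict m hΩ E.fgp F.fgp G.fgp μ h.surjective h.ker h.smul hm, ?_⟩
    have hr : ∀ (v : E.centreZero) (a : Ω.carrier) (w : F.centreZero),
        μ (v : E.carrier) (a • (w : F.carrier)) = a • (m v w).1 := by
      intro v a w
      rw [← h.balanced, (mem_centreZero.1 v.2).2, h.smul, hm]
    have key : ∀ v w, G.nabla (m v w) =
        c.u • ((m (E.conn₁ c v) w + m v (F.conn₁ c w) : G.centreZero) : G.carrier) +
        c.v • ((m (E.conn₂ c v) w + m v (F.conn₂ c w) : G.centreZero) : G.carrier) := by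
      intro v w
      rw [← hm, h.nabla 0 v (mem_centreZero.1 v.2).1, pow_zero, one_smul, E.nabla_centre c,
        F.nabla_centre c, map_add, map_add, LinearMap.add_apply, h.smul, h.smul, hr, hr, hm, hm,
        Submodule.coe_add, Submodule.coe_add, smul_add, smul_add]
      abel
    exact ⟨fun v w => (conn_eq c (key v w)).1.symm, fun v w => (conn_eq c (key v w)).2.symm⟩
  · rintro ⟨hm, h1, h2⟩
    obtain ⟨hs, hk⟩ := bilinExtend_isTensor hΩ E.fgp F.fgp m G.fgp hm
    refine ⟨bilinExtend hΩ E.fgp F.fgp m, ⟨hs, hk, bilinExtend_smul hΩ E.fgp F.fgp m,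
      bilinExtend_op_smul hΩ E.fgp F.fgp m, fun i j e he f hf =>
      bilinExtend_mem hΩ E.fgp F.fgp m he hf, fun i e he f => ?_⟩,
      bilinExtend_centre hΩ E.fgp F.fgp m⟩
    have := finiteDimensional_centreZero hΩ E.fgp
    set μ := bilinExtend hΩ E.fgp F.fgp m with hμ
    have pure : ∀ (a : Ω.carrier) (v : E.centreZero), a ∈ Ω.deg i → G.nabla (μ (a • v.1) f) =
        μ (E.nabla (a • v.1)) f + (-1 : ℂ) ^ i • μ (a • v.1) (F.nabla f) := by
      intro a v ha
      induction f using induction_homogeneous F.fgp with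
      | zero => simp
      | add x y hx hy =>
        simp only [map_add, hx, hy, smul_add]
        abel
      | smul j b w hb =>
        have hab : a * b ∈ Ω.deg (i + j) := SetLike.mul_mem_graded ha hb
        have hu := c.u_mul j b hb
        have hv := c.v_mul j b hb
        rw [E.nabla_left i a v ha, F.nabla_left j b w hb, hμ, bilinExtend_smul_smul,
          G.nabla_left (i + j) (a * b) _ hab, G.nabla_centre c, E.nabla_centre c,
          F.nabla_centre c, ← h1, ← h2]
        simp only [Submodule.coe_add, smul_add, map_add, LinearMap.add_apply, smul_smul,
          map_smul, LinearMap.smul_apply, bilinExtend_smul_smul]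
        rw [Ω.d_mul i a b ha, mul_assoc a c.u b, hu, mul_assoc a c.v b, hv, mul_smul_comm,
          mul_smul_comm, mul_assoc a b c.u, mul_assoc a b c.v, add_smul]
        simp only [smul_assoc, smul_smul, ← pow_add]
        abel
    rw [← sum_contract hΩ E.fgp (Module.finBasis ℂ E.centreZero) e]
    simp only [map_sum, LinearMap.sum_apply]
    rw [Finset.smul_sum, ← Finset.sum_add_distrib]
    exact Finset.sum_congr rfl fun k _ => pure _ _ (contract_mem hΩ E.fgp _ he)

end FlatBimodule

end

noncomputable section

/-! ### Free bimodules with flat connections -/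

open scoped RightActions

namespace DGA

variable (Ω : DGA)

lemma d_algebraMap (k : ℂ) : Ω.d (algebraMap ℂ Ω.carrier k) = 0 := by
  have h := Ω.d_mul 0 1 1 (SetLike.one_mem_graded Ω.deg)
  simp only [mul_one, one_mul, pow_zero, one_smul, left_eq_add] at h
  rw [Algebra.algebraMap_eq_smul_one, map_smul, h, smul_zero]

/-- The grading of `Ωⁿ`. -/
def freeDeg (n k : ℕ) : Submodule ℂ (Fin n → Ω.carrier) := Submodule.pi Set.univ fun _ => Ω.deg k

lemma mem_freeDeg {n k : ℕ} {x : Fin n → Ω.carrier} :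
    x ∈ Ω.freeDeg n k ↔ ∀ j, x j ∈ Ω.deg k := by
  simp [freeDeg]

lemma single_mem_freeDeg {n k : ℕ} (j : Fin n) {a : Ω.carrier} (ha : a ∈ Ω.deg k) :
    Pi.single j a ∈ Ω.freeDeg n k := by
  rw [mem_freeDeg]
  intro j'
  rcases eq_or_ne j' j with rfl | hj
  · rwa [Pi.single_eq_same]
  · rw [Pi.single_eq_of_ne hj]
    exact Submodule.zero_mem _

/-- The inclusion of the `j`-th summand `Ω → Ωⁿ` on graded pieces. -/
def freeSingle (n : ℕ) (j : Fin n) : (DirectSum ℕ fun k => Ω.deg k) →ₗ[ℂ]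
    DirectSum ℕ fun k => Ω.freeDeg n k :=
  DirectSum.toModule ℂ ℕ _ fun k => DirectSum.lof ℂ ℕ (fun k => Ω.freeDeg n k) k ∘ₗ
    (LinearMap.single ℂ (fun _ : Fin n => Ω.carrier) j).restrict
      fun _ ha => Ω.single_mem_freeDeg j ha

/-- The decomposition of `Ωⁿ` into its graded pieces. -/
def freeDecompose (n : ℕ) : (Fin n → Ω.carrier) →ₗ[ℂ] DirectSum ℕ fun k => Ω.freeDeg n k :=
  ∑ j, Ω.freeSingle n j ∘ₗ (DirectSum.decomposeLinearEquiv Ω.deg).toLinearMap ∘ₗ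
    LinearMap.proj j

lemma coe_freeSingle (n : ℕ) (j : Fin n) (y : DirectSum ℕ fun k => Ω.deg k) :
    DirectSum.coeLinearMap (Ω.freeDeg n) (Ω.freeSingle n j y) =
      Pi.single j (DirectSum.coeLinearMap Ω.deg y) := by
  suffices h : DirectSum.coeLinearMap (Ω.freeDeg n) ∘ₗ Ω.freeSingle n j =
      LinearMap.single ℂ (fun _ : Fin n => Ω.carrier) j ∘ₗ DirectSum.coeLinearMap Ω.deg from
    LinearMap.congr_fun h y
  refine DirectSum.linearMap_ext ℂ fun k => LinearMap.ext fun a => ?_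
  simp only [freeSingle, LinearMap.comp_apply, DirectSum.toModule_lof, DirectSum.coeLinearMap_lof]
  rfl

instance (n : ℕ) : DirectSum.Decomposition (Ω.freeDeg n) :=
  DirectSum.Decomposition.ofLinearMap _ (Ω.freeDecompose n)
    (LinearMap.ext fun x => by
      have h : ∀ a, DirectSum.coeLinearMap Ω.deg (DirectSum.decomposeLinearEquiv Ω.deg a) = a :=
        fun a => (DirectSum.decomposeLinearEquiv Ω.deg).symm_apply_apply a
      simp only [freeDecompose, LinearMap.comp_apply, LinearMap.sum_apply, map_sum,
        coe_freeSingle, LinearEquiv.coe_coe, h, LinearMap.id_apply]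
      exact Finset.univ_sum_single x)
    (DirectSum.linearMap_ext ℂ fun k => LinearMap.ext fun x => by
      have hx := Ω.mem_freeDeg.1 x.2
      have h : ∀ j, DirectSum.decomposeLinearEquiv Ω.deg (x.1 j) =
          DirectSum.lof ℂ ℕ (fun k => Ω.deg k) k ⟨x.1 j, hx j⟩ :=
        fun j => DirectSum.decompose_of_mem Ω.deg (hx j)
      simp only [freeDecompose, LinearMap.comp_apply, LinearMap.sum_apply, 
        LinearEquiv.coe_coe, DirectSum.coeLinearMap_lof, LinearMap.proj_apply, h, freeSingle,
        DirectSum.toModule_lof, LinearMap.id_apply]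
      rw [← map_sum]
      refine congrArg _ (Subtype.ext ?_)
      rw [Submodule.coe_sum]
      exact Finset.univ_sum_single x.1)

end DGA

namespace GradedBimodule

variable (Ω : DGA) (n : ℕ)

/-- The free graded bimodule `Ωⁿ`. -/
def free : GradedBimodule Ω where
  carrier := Fin n → Ω.carrier
  deg := Ω.freeDeg n
  smul_mem _ _ _ _ ha he := Ω.mem_freeDeg.2 fun j =>
    SetLike.mul_mem_graded ha (Ω.mem_freeDeg.1 he j)
  op_smul_mem _ _ _ _ he ha := Ω.mem_freeDeg.2 fun j =>
    SetLike.mul_mem_graded (Ω.mem_freeDeg.1 he j) ha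

lemma free_isFGP : (free Ω n).IsFGP := by
  refine ⟨zero Ω, n, ?_, ?_⟩
  · exact
      { toFun := fun x => x.1
        invFun := fun y => (y, PUnit.unit)
        map_add' := fun _ _ => rfl
        map_smul' := fun _ _ => rfl
        left_inv := fun _ => rfl
        right_inv := fun _ => rfl }
  · exact ⟨fun _ _ => rfl, fun _ _ => rfl, fun k e he _ _ => Ω.mem_freeDeg.1 he⟩

/-- The inclusion `ℂⁿ → Z_g(Ωⁿ)⁰` of the constants. -/
def freeConst : (Fin n → ℂ) →ₗ[ℂ] (free Ω n).centreZero where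
  toFun x := ⟨fun j => algebraMap ℂ Ω.carrier (x j), mem_centreZero.2
    ⟨Ω.mem_freeDeg.2 fun j => SetLike.algebraMap_mem_graded Ω.deg (x j),
      fun ν => funext fun j => Algebra.commutes (x j) ν⟩⟩
  map_add' _ _ := Subtype.ext (funext fun _ => map_add (algebraMap ℂ Ω.carrier) _ _)
  map_smul' k x := Subtype.ext (funext fun j =>
    map_smul (Algebra.linearMap ℂ Ω.carrier) k (x j))

variable {Ω}

lemma freeConst_bijective (hΩ : Ω.centreZero = ⊥) [Nontrivial Ω.carrier] :
    Function.Bijective (freeConst Ω n) := by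
  refine ⟨fun x y h => funext fun j => (algebraMap ℂ Ω.carrier).injective
    (congrFun (congrArg Subtype.val h) j), fun y => ?_⟩
  obtain ⟨h0, hc⟩ := mem_centreZero.1 y.2
  choose k hk using fun j => exists_algebraMap hΩ (Ω.mem_freeDeg.1 h0 j)
    fun ν => congrFun (hc ν) j
  exact ⟨k, Subtype.ext (funext hk)⟩

end GradedBimodule

namespace DGA

variable (Ω : DGA) {n : ℕ} (A B : Matrix (Fin n) (Fin n) ℂ)

/-- The action of complex matrices on `Ωⁿ`. -/
def matrixAct : (Fin n → Ω.carrier) →ₗ[ℂ] (Fin n → Ω.carrier) :=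
  LinearMap.pi fun i => ∑ j, A i j • LinearMap.proj j

lemma matrixAct_apply (x : Fin n → Ω.carrier) (i : Fin n) :
    Ω.matrixAct A x i = ∑ j, A i j • x j := by
  simp [matrixAct]

lemma matrixAct_smul (a : Ω.carrier) (x : Fin n → Ω.carrier) :
    Ω.matrixAct A (a • x) = a • Ω.matrixAct A x := by
  funext i
  simp [matrixAct_apply, Finset.mul_sum]

lemma matrixAct_op_smul (a : Ω.carrier) (x : Fin n → Ω.carrier) :
    Ω.matrixAct A (x <• a) = Ω.matrixAct A x <• a := by
  funext i
  simp [matrixAct_apply, Finset.sum_mul]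

lemma matrixAct_d (x : Fin n → Ω.carrier) :
    Ω.matrixAct A (Ω.d.compLeft (Fin n) x) = Ω.d.compLeft (Fin n) (Ω.matrixAct A x) := by
  funext i
  simp [matrixAct_apply]

lemma matrixAct_matrixAct (x : Fin n → Ω.carrier) :
    Ω.matrixAct A (Ω.matrixAct B x) = Ω.matrixAct (A * B) x := by
  funext i
  simp only [matrixAct_apply, Finset.smul_sum, Matrix.mul_apply, Finset.sum_smul, smul_smul]
  exact Finset.sum_comm

lemma matrixAct_mem {k : ℕ} {x : Fin n → Ω.carrier} (hx : x ∈ Ω.freeDeg n k) :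
    Ω.matrixAct A x ∈ Ω.freeDeg n k := by
  rw [mem_freeDeg] at *
  intro i
  rw [matrixAct_apply]
  exact Submodule.sum_mem _ fun j _ => Submodule.smul_mem _ _ (hx j)

lemma d_smul (i : ℕ) (a : Ω.carrier) (ha : a ∈ Ω.deg i) (x : Fin n → Ω.carrier) :
    Ω.d.compLeft (Fin n) (a • x) =
      Ω.d a • x + (-1 : ℂ) ^ i • a • Ω.d.compLeft (Fin n) x :=
  funext fun j => Ω.d_mul i a (x j) ha

end DGA

namespace FlatBimodule

open GradedBimodule

variable {Ω : DGA} (c : CentralFrame Ω) {n : ℕ}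

/-- The connection `d + uA + vB` on `Ωⁿ`. -/
def freeNabla (A B : Matrix (Fin n) (Fin n) ℂ) :
    (Fin n → Ω.carrier) →ₗ[ℂ] (Fin n → Ω.carrier) where
  toFun x := Ω.d.compLeft (Fin n) x + c.u • Ω.matrixAct A x + c.v • Ω.matrixAct B x
  map_add' x y := by simp only [map_add, smul_add]; abel
  map_smul' k x := by
    simp only [map_smul, smul_add, smul_comm k, RingHom.id_apply]

lemma freeNabla_apply (A B : Matrix (Fin n) (Fin n) ℂ) (x : Fin n → Ω.carrier) :
    freeNabla c A B x =
      Ω.d.compLeft (Fin n) x + c.u • Ω.matrixAct A x + c.v • Ω.matrixAct B x := rfl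

lemma freeNabla_left (A B : Matrix (Fin n) (Fin n) ℂ) (i : ℕ) (a : Ω.carrier)
    (x : Fin n → Ω.carrier) (ha : a ∈ Ω.deg i) :
    freeNabla c A B (a • x) = Ω.d a • x + (-1 : ℂ) ^ i • (a • freeNabla c A B x) := by
  simp only [freeNabla_apply, Ω.d_smul i a ha, Ω.matrixAct_smul, smul_add, smul_smul]
  rw [c.u_mul i a ha, c.v_mul i a ha]
  simp only [smul_assoc]
  abel

lemma freeNabla_right (A B : Matrix (Fin n) (Fin n) ℂ) (i : ℕ) (x : Fin n → Ω.carrier)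
    (a : Ω.carrier) (hx : x ∈ Ω.freeDeg n i) :
    freeNabla c A B (x <• a) = freeNabla c A B x <• a + (-1 : ℂ) ^ i • (x <• Ω.d a) := by
  have hd : Ω.d.compLeft (Fin n) (x <• a) =
      Ω.d.compLeft (Fin n) x <• a + (-1 : ℂ) ^ i • (x <• Ω.d a) :=
    funext fun j => Ω.d_mul i (x j) a (Ω.mem_freeDeg.1 hx j)
  rw [freeNabla_apply, freeNabla_apply, hd, Ω.matrixAct_op_smul, Ω.matrixAct_op_smul,
    smul_comm c.u, smul_comm c.v, smul_add, smul_add]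
  abel

lemma freeNabla_const (A B : Matrix (Fin n) (Fin n) ℂ) (x : Fin n → ℂ) :
    freeNabla c A B (fun j => algebraMap ℂ Ω.carrier (x j)) =
      c.u • (fun j => algebraMap ℂ Ω.carrier (A.mulVec x j)) +
      c.v • (fun j => algebraMap ℂ Ω.carrier (B.mulVec x j)) := by
  have h : ∀ T : Matrix (Fin n) (Fin n) ℂ, Ω.matrixAct T (fun j => algebraMap ℂ Ω.carrier (x j)) =
      fun j => algebraMap ℂ Ω.carrier (T.mulVec x j) := by
    intro T
    funext i
    rw [Ω.matrixAct_apply, Matrix.mulVec, dotProduct, map_sum]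
    exact Finset.sum_congr rfl fun j _ => by rw [map_mul, Algebra.smul_def]
  have hd : Ω.d.compLeft (Fin n) (fun j => algebraMap ℂ Ω.carrier (x j)) = 0 :=
    funext fun j => Ω.d_algebraMap (x j)
  rw [freeNabla_apply, hd, zero_add, h, h]

lemma freeNabla_flat {A B : Matrix (Fin n) (Fin n) ℂ} (h : A * B = B * A)
    (x : Fin n → Ω.carrier) : freeNabla c A B (freeNabla c A B x) = 0 := by
  have hd : ∀ x : Fin n → Ω.carrier,
      freeNabla c A B (Ω.d.compLeft (Fin n) x) =
        c.u • Ω.d.compLeft (Fin n) (Ω.matrixAct A x) +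
        c.v • Ω.d.compLeft (Fin n) (Ω.matrixAct B x) := by
    intro x
    rw [freeNabla_apply, Ω.matrixAct_d, Ω.matrixAct_d]
    have : Ω.d.compLeft (Fin n) (Ω.d.compLeft (Fin n) x) = 0 := funext fun j => Ω.d_d (x j)
    rw [this, zero_add]
  rw [freeNabla_apply c A B x, map_add, map_add, hd, freeNabla_left c A B 1 _ _ c.u_mem,
    freeNabla_left c A B 1 _ _ c.v_mem, c.d_u, c.d_v, freeNabla_apply, freeNabla_apply]
  simp only [smul_add, smul_smul, Ω.matrixAct_matrixAct, c.u_mul_u, c.v_mul_v, c.v_mul_u, h,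
    zero_smul, pow_one, neg_smul, one_smul, neg_neg, zero_add, add_zero]
  abel

/-- The free bimodule `Ωⁿ` with the flat connection `d + uA + vB` for commuting matrices. -/
def free {A B : Matrix (Fin n) (Fin n) ℂ} (h : A * B = B * A) : FlatBimodule Ω where
  __ := GradedBimodule.free Ω n
  fgp := free_isFGP Ω n
  nabla := freeNabla c A B
  nabla_mem i e he := by
    refine Submodule.add_mem _ (Submodule.add_mem _ ?_ ?_) ?_
    · exact Ω.mem_freeDeg.2 fun j => Ω.d_mem i _ (Ω.mem_freeDeg.1 he j)
    · rw [add_comm]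
      exact (GradedBimodule.free Ω n).smul_mem 1 i _ _ c.u_mem (Ω.matrixAct_mem A he)
    · rw [add_comm]
      exact (GradedBimodule.free Ω n).smul_mem 1 i _ _ c.v_mem (Ω.matrixAct_mem B he)
  nabla_right i e a he := freeNabla_right c A B i e a he
  nabla_left i a e ha := freeNabla_left c A B i a e ha
  flat := freeNabla_flat c h

/-- Commuting endomorphisms of a finite-dimensional vector space come from a flat connection. -/
lemma exists_of_commute {V : Type} [AddCommGroup V] [Module ℂ V] [FiniteDimensional ℂ V]
    (A B : V →ₗ[ℂ] V) (h : ∀ x, A (B x) = B (A x)) :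
    ∃ (E : FlatBimodule Ω) (φ : E.centreZero ≃ₗ[ℂ] V),
      (∀ e, φ (E.conn₁ c e) = A (φ e)) ∧ ∀ e, φ (E.conn₂ c e) = B (φ e) := by
  have := c.nontrivial
  let b := Module.finBasis ℂ V
  let M : (V →ₗ[ℂ] V) → Matrix _ _ ℂ := LinearMap.toMatrix b b
  have hM : M A * M B = M B * M A := by
    rw [← LinearMap.toMatrix_comp, ← LinearMap.toMatrix_comp]
    exact congrArg M (LinearMap.ext h)
  let E : FlatBimodule Ω := free c hM
  let ψ : (Fin _ → ℂ) ≃ₗ[ℂ] E.centreZero :=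
    LinearEquiv.ofBijective (freeConst Ω _ : _ →ₗ[ℂ] E.centreZero)
      (freeConst_bijective _ c.centreZero_eq_bot)
  have hconn : ∀ x, E.conn₁ c (ψ x) = ψ ((M A).mulVec x) ∧
      E.conn₂ c (ψ x) = ψ ((M B).mulVec x) := fun x =>
    conn_eq c (freeNabla_const c (M A) (M B) x)
  have hb : ∀ (T : V →ₗ[ℂ] V) x, b.equivFun.symm ((M T).mulVec x) = T (b.equivFun.symm x) := by
    intro T x
    rw [LinearEquiv.symm_apply_eq]
    have := LinearMap.toMatrix_mulVec_repr b b T (b.equivFun.symm x)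
    rw [← b.equivFun_apply, b.equivFun.apply_symm_apply] at this
    exact this
  refine ⟨E, ψ.symm.trans b.equivFun.symm, fun e => ?_, fun e => ?_⟩ <;>
  · obtain ⟨x, rfl⟩ := ψ.surjective e
    simp only [(hconn x).1, (hconn x).2, LinearEquiv.trans_apply, LinearEquiv.symm_apply_apply, hb]

end FlatBimodule

end

noncomputable section

/-! ### Flat connections and representations of the plane -/

open scoped RightActions

section TensorProducts

variable {V W U V' W' U' : Type} [AddCommGroup V] [Module ℂ V] [AddCommGroup W] [Module ℂ W]
  [AddCommGroup U] [Module ℂ U] [AddCommGroup V'] [Module ℂ V'] [AddCommGroup W'] [Module ℂ W']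
  [AddCommGroup U'] [Module ℂ U']

lemma isTensorProduct_congr {m : V →ₗ[ℂ] W →ₗ[ℂ] U} {m' : V' →ₗ[ℂ] W' →ₗ[ℂ] U'}
    (α : V ≃ₗ[ℂ] V') (β : W ≃ₗ[ℂ] W') (γ : U ≃ₗ[ℂ] U')
    (h : ∀ v w, m' (α v) (β w) = γ (m v w)) : IsTensorProduct m ↔ IsTensorProduct m' := by
  have e : ∀ x, TensorProduct.lift m' (TensorProduct.congr α β x) =
      γ (TensorProduct.lift m x) := by
    intro x
    induction x with
    | zero => simp
    | tmul v w => simp [h]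
    | add x y hx hy => simp only [map_add, hx, hy]
  have e' : TensorProduct.lift m' ∘ TensorProduct.congr α β = γ ∘ TensorProduct.lift m := funext e
  rw [IsTensorProduct, IsTensorProduct,
    ← Function.Bijective.of_comp_iff _ (TensorProduct.congr α β).bijective, e',
    Function.Bijective.of_comp_iff' γ.bijective]

end TensorProducts

namespace FlatBimodule

open GradedBimodule

variable {Ω : DGA} (c : CentralFrame Ω)

/-- The representation `V` of `ℝ²` matches the flat connection `E` under `α : Z_g(E)⁰ ≃ V`, if the
infinitesimal generators of `V` are the endomorphisms given by the connection. -/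
structure Matches (E : FlatBimodule Ω) (V : ContRep (Multiplicative (ℝ × ℝ)))
    (α : E.centreZero ≃ₗ[ℂ] V.carrier) : Prop where
  gen₁ : ∀ e, α (E.conn₁ c e) = V.gen₁ (α e)
  gen₂ : ∀ e, α (E.conn₂ c e) = V.gen₂ (α e)

lemma exists_matches_rep (E : FlatBimodule Ω) : ∃ V α, Matches c E V α := by
  have := c.nontrivial
  have := finiteDimensional_centreZero c.centreZero_eq_bot E.fgp
  obtain ⟨V, α, h1, h2⟩ := ContRep.exists_of_commute (E.conn₁ c) (E.conn₂ c) (conn_comm c)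
  exact ⟨V, α, h1, h2⟩

lemma exists_matches_flat (V : ContRep (Multiplicative (ℝ × ℝ))) :
    ∃ E α, Matches c E V α := by
  obtain ⟨E, α, h1, h2⟩ := exists_of_commute c V.gen₁ V.gen₂ V.gen_comm
  exact ⟨E, α, h1, h2⟩

namespace Matches

variable {c} {E F G : FlatBimodule Ω} {V W U : ContRep (Multiplicative (ℝ × ℝ))}
  {α : E.centreZero ≃ₗ[ℂ] V.carrier} {β : F.centreZero ≃ₗ[ℂ] W.carrier}
  {γ : G.centreZero ≃ₗ[ℂ] U.carrier}

lemma exists_rep_hom (h : Matches c E V α) (k : Matches c F W β) (f : E ⟶ F) :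
    ∃ f' : Representation.IntertwiningMap V.ρ W.ρ,
      ∀ e, f'.toLinearMap (α e) = β (centreMap f e) := by
  let g : V.carrier →ₗ[ℂ] W.carrier := β.toLinearMap ∘ₗ centreMap f ∘ₗ α.symm.toLinearMap
  refine ⟨⟨g, (ContRep.intertwining_iff g).2 ⟨fun v => ?_, fun v => ?_⟩⟩, fun e => ?_⟩
  · obtain ⟨e, rfl⟩ := α.surjective v
    simp [g, ← h.gen₁, ← k.gen₁, (centreMap_conn c f e).1]
  · obtain ⟨e, rfl⟩ := α.surjective v
    simp [g, ← h.gen₂, ← k.gen₂, (centreMap_conn c f e).2]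
  · simp [g]

lemma exists_flat_hom (h : Matches c E V α) (k : Matches c F W β)
    (f' : Representation.IntertwiningMap V.ρ W.ρ) :
    ∃ f : E ⟶ F, ∀ e, f'.toLinearMap (α e) = β (centreMap f e) := by
  obtain ⟨h1, h2⟩ := (ContRep.intertwining_iff f'.toLinearMap).1 f'.isIntertwining'
  obtain ⟨f, hf⟩ := exists_hom c (β.symm.toLinearMap ∘ₗ f'.toLinearMap ∘ₗ α.toLinearMap)
    (fun e => β.injective (by simpa [h.gen₁, k.gen₁] using h1 _))
    (fun e => β.injective (by simpa [h.gen₂, k.gen₂] using h2 _))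
  exact ⟨f, fun e => by simp [hf]⟩

lemma isTensor_iff (h : Matches c E V α) (k : Matches c F W β) (l : Matches c G U γ)
    {m : E.centreZero →ₗ[ℂ] F.centreZero →ₗ[ℂ] G.centreZero}
    {m' : V.carrier →ₗ[ℂ] W.carrier →ₗ[ℂ] U.carrier}
    (hm : ∀ e f, m' (α e) (β f) = γ (m e f)) :
    (∃ μ : E.carrier →ₗ[ℂ] F.carrier →ₗ[ℂ] G.carrier, IsTensor E F G μ ∧
      ∀ (e : E.centreZero) (f : F.centreZero), μ (e : E.carrier) (f : F.carrier) = (m e f).1) ↔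
    IsTensorProduct m' ∧ ∀ t v w, m' (V.ρ t v) (W.ρ t w) = U.ρ t (m' v w) := by
  rw [exists_isTensor_iff c, ContRep.bilin_iff, isTensorProduct_congr α β γ hm]
  refine and_congr Iff.rfl (and_congr ?_ ?_)
  · rw [← α.forall_congr_right]
    refine forall_congr' fun e => ?_
    rw [← β.forall_congr_right]
    refine forall_congr' fun f => ?_
    change _ ↔ m' (V.gen₁ (α e)) (β f) + m' (α e) (W.gen₁ (β f)) = U.gen₁ (m' (α e) (β f))
    rw [← h.gen₁, ← k.gen₁, hm, hm, hm, ← l.gen₁, ← map_add, γ.injective.eq_iff]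
  · rw [← α.forall_congr_right]
    refine forall_congr' fun e => ?_
    rw [← β.forall_congr_right]
    refine forall_congr' fun f => ?_
    change _ ↔ m' (V.gen₂ (α e)) (β f) + m' (α e) (W.gen₂ (β f)) = U.gen₂ (m' (α e) (β f))
    rw [← h.gen₂, ← k.gen₂, hm, hm, hm, ← l.gen₂, ← map_add, γ.injective.eq_iff]

end Matches

/-! ### The unit object -/

/-- The inclusion of the constants `ℂ → Z_g(Ω)⁰`, where `Ω` is taken as the unit object. -/
def unitConst : ℂ →ₗ[ℂ] (unit Ω).centreZero where
  toFun k := ⟨algebraMap ℂ Ω.carrier k, mem_centreZero.2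
    ⟨SetLike.algebraMap_mem_graded Ω.deg k, fun ν => Algebra.commutes k ν⟩⟩
  map_add' _ _ := Subtype.ext (map_add (algebraMap ℂ Ω.carrier) _ _)
  map_smul' k x := Subtype.ext (map_smul (Algebra.linearMap ℂ Ω.carrier) k x)

lemma unitConst_bijective (hΩ : Ω.centreZero = ⊥) [Nontrivial Ω.carrier] :
    Function.Bijective (unitConst (Ω := Ω)) := by
  refine ⟨fun x y h => (algebraMap ℂ Ω.carrier).injective (congrArg Subtype.val h), fun y => ?_⟩
  obtain ⟨h0, hc⟩ := mem_centreZero.1 y.2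
  obtain ⟨k, hk⟩ := exists_algebraMap hΩ (a := y.1) h0 hc
  exact ⟨k, Subtype.ext hk⟩

/-- The unit objects match: the connection `d` and the generators of the trivial representation
vanish on the constants. -/
lemma exists_matches_unit : ∃ α : (unit Ω).centreZero ≃ₗ[ℂ] ℂ,
    Matches c (unit Ω) (ContRep.forget (Multiplicative (ℝ × ℝ))).unit α := by
  have := c.nontrivial
  let V := (ContRep.forget (Multiplicative (ℝ × ℝ))).unit
  let κ : ℂ ≃ₗ[ℂ] (unit Ω).centreZero :=
    LinearEquiv.ofBijective _ (unitConst_bijective c.centreZero_eq_bot)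
  have h0 : ∀ k, (unit Ω).conn₁ c (κ k) = 0 ∧ (unit Ω).conn₂ c (κ k) = 0 := fun k =>
    conn_eq c (by
      rw [Submodule.coe_zero, smul_zero, smul_zero, add_zero]
      exact Ω.d_algebraMap k)
  have g1 : V.gen₁ = 0 := V.isGen₁.unique fun v l => by
    rw [LinearMap.zero_apply, map_zero]
    exact hasDerivAt_const 0 (l v)
  have g2 : V.gen₂ = 0 := V.isGen₂.unique fun v l => by
    rw [LinearMap.zero_apply, map_zero]
    exact hasDerivAt_const 0 (l v)
  refine ⟨κ.symm, fun e => ?_, fun e => ?_⟩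
  · obtain ⟨k, rfl⟩ := κ.surjective e
    rw [(h0 k).1]
    exact κ.symm.map_zero.trans (LinearMap.congr_fun g1 _).symm
  · obtain ⟨k, rfl⟩ := κ.surjective e
    rw [(h0 k).2]
    exact κ.symm.map_zero.trans (LinearMap.congr_fun g2 _).symm

/-! ### The fundamental group -/

variable (p : Ω.BasePoint)

lemma kerSMul_eq_bot (hΩ : Ω.centreZero = ⊥) (E : FlatBimodule Ω) : E.kerSMul p = ⊥ := by
  rw [eq_bot_iff, kerSMul, Submodule.span_le]
  rintro x ⟨a, e, ha, hx⟩
  obtain ⟨k, hk⟩ := Algebra.mem_bot.1 (hΩ ▸ a.2 : a.1 ∈ (⊥ : Subalgebra ℂ Ω.carrier))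
  have hk' : a = algebraMap ℂ Ω.centreZero k := Subtype.ext hk.symm
  rw [hk', AlgHom.commutes] at ha
  have hk0 : k = 0 := ha
  rw [hk', hk0, map_zero] at hx
  exact Subtype.ext (hx.trans (zero_smul _ _))

/-- As `Z_g(Ω)⁰ = ℂ`, the fibre of `E` at `p` is `Z_g(E)⁰`. -/
def centreFibre (hΩ : Ω.centreZero = ⊥) (E : FlatBimodule Ω) : E.centreZero ≃ₗ[ℂ] E.Fibre p :=
  (Submodule.quotEquivOfEqBot _ (kerSMul_eq_bot p hΩ E)).symm

lemma Matches.trans_centreFibre {c : CentralFrame Ω} {E : FlatBimodule Ω}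
    {V : ContRep (Multiplicative (ℝ × ℝ))}
    {α : E.centreZero ≃ₗ[ℂ] V.carrier} (h : Matches c E V α) :
    Matches c E V ((centreFibre p c.centreZero_eq_bot E).trans
      ((centreFibre p c.centreZero_eq_bot E).symm.trans α)) := by
  rwa [← LinearEquiv.trans_assoc, LinearEquiv.self_trans_symm, LinearEquiv.refl_trans]

/-- Under the identification of the fibres with the spaces `Z_g(E)⁰`, tensor products of fibres are
the restrictions of tensor products of flat connections. -/
lemma fibre_isTensor_iff (hΩ : Ω.centreZero = ⊥) {E F G : FlatBimodule Ω}
    (m : E.centreZero →ₗ[ℂ] F.centreZero →ₗ[ℂ] G.centreZero)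
    (m' : E.Fibre p →ₗ[ℂ] F.Fibre p →ₗ[ℂ] G.Fibre p)
    (h : ∀ e f, m' (centreFibre p hΩ E e) (centreFibre p hΩ F f) = centreFibre p hΩ G (m e f)) :
    (Ω.fibre p).IsTensor E F G m' ↔
    ∃ μ : E.carrier →ₗ[ℂ] F.carrier →ₗ[ℂ] G.carrier, IsTensor E F G μ ∧
      ∀ (e : E.centreZero) (f : F.centreZero), μ (e : E.carrier) (f : F.carrier) = (m e f).1 := by
  constructor
  · rintro ⟨μ, hμ, rfl⟩
    refine ⟨μ, hμ, fun e f => ?_⟩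
    exact congrArg Subtype.val ((centreFibre p hΩ G).injective (h e f))
  · rintro ⟨μ, hμ, hm⟩
    refine ⟨μ, hμ, LinearMap.ext fun x => LinearMap.ext fun y => ?_⟩
    obtain ⟨e, rfl⟩ := (centreFibre p hΩ E).surjective x
    obtain ⟨f, rfl⟩ := (centreFibre p hΩ F).surjective y
    rw [h]
    exact congrArg (centreFibre p hΩ G) (Subtype.ext (hm e f).symm)

/-- Flat connections over `Ω` correspond to continuous representations of `ℝ²`. -/
def correspondence : TensorFunctor.Correspondence (Ω.fibre p)
    (ContRep.forget (Multiplicative (ℝ × ℝ))) where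
  Rel E V φ := Matches c E V ((centreFibre p c.centreZero_eq_bot E).trans φ)
  exists_right E := by
    obtain ⟨V, α, h⟩ := exists_matches_rep c E
    refine ⟨V, (centreFibre p c.centreZero_eq_bot E).symm.trans α, h.trans_centreFibre p⟩
  exists_left V := by
    obtain ⟨E, α, h⟩ := exists_matches_flat c V
    refine ⟨E, (centreFibre p c.centreZero_eq_bot E).symm.trans α, h.trans_centreFibre p⟩
  lift_right {E F V W φ ψ} h k f := by
    obtain ⟨f', hf⟩ := h.exists_rep_hom k f
    refine ⟨f', fun x => ?_⟩
    obtain ⟨e, rfl⟩ := (centreFibre p c.centreZero_eq_bot E).surjective x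
    exact hf e
  lift_left {E F V W φ ψ} h k f' := by
    obtain ⟨f, hf⟩ := h.exists_flat_hom k f'
    refine ⟨f, fun x => ?_⟩
    obtain ⟨e, rfl⟩ := (centreFibre p c.centreZero_eq_bot E).surjective x
    exact hf e
  tensor_iff {E F G V W U φ ψ χ} h k l m m' hm := by
    let εE := centreFibre p c.centreZero_eq_bot E
    let εF := centreFibre p c.centreZero_eq_bot F
    let εG := centreFibre p c.centreZero_eq_bot G
    let m₀ : E.centreZero →ₗ[ℂ] F.centreZero →ₗ[ℂ] G.centreZero :=
      (LinearMap.compl₁₂ m εE.toLinearMap εF.toLinearMap).compr₂ εG.symm.toLinearMap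
    have h0 : ∀ e f, m (εE e) (εF f) = εG (m₀ e f) := fun e f =>
      (εG.apply_symm_apply _).symm
    refine (fibre_isTensor_iff p c.centreZero_eq_bot m₀ m h0).trans
      (h.isTensor_iff k l fun e f => ?_)
    exact (hm _ _).trans (congrArg χ (h0 e f))
  unit := by
    obtain ⟨α, h⟩ := exists_matches_unit c
    refine ⟨(centreFibre p c.centreZero_eq_bot _).symm.trans α, h.trans_centreFibre p⟩

end FlatBimodule

end

theorem mainTheorem10 (θ : ℝ) (hθ : Irrational θ) :
    -- the centre of the algebra of functions is trivial
    Subalgebra.center ℂ (NCTorus.Alg θ) = ⊥ ∧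
    (NCTorus.dga θ).centreZero = ⊥ ∧
    -- the graded centre is the invariant part
    (NCTorus.dga θ).gradedCentre = NCTorus.invariants θ ∧
    -- it is the exterior algebra of the space spanned by `u⁻¹du`, `v⁻¹dv`, with zero differential
    LinearIndependent ℂ ![NCTorus.Forms.uForm θ, NCTorus.Forms.vForm θ] ∧
    (∃ φ : ExteriorAlgebra ℂ (NCTorus.invOneForms θ) →ₐ[ℂ] NCTorus.Forms θ,
      (∀ v : NCTorus.invOneForms θ, φ (ExteriorAlgebra.ι ℂ v) = v) ∧
      Function.Injective φ ∧
      LinearMap.range φ.toLinearMap = (NCTorus.dga θ).gradedCentre ∧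
      ∀ k : ℕ, (⋀[ℂ]^k (NCTorus.invOneForms θ)).map φ.toLinearMap =
        (NCTorus.dga θ).gradedCentre ⊓ (NCTorus.dga θ).deg k) ∧
    (∀ w ∈ (NCTorus.dga θ).gradedCentre, (NCTorus.dga θ).d w = 0) ∧
    -- there is exactly one base point, and the fundamental group is an affine group scheme
    -- isomorphic to the algebraic hull of `ℝ²`
    Nonempty (Unique (NCTorus.dga θ).BasePoint) ∧
    ∀ p : (NCTorus.dga θ).BasePoint,
      IsAffineGroupScheme ((NCTorus.dga θ).fundamentalGroup p) ∧
      Nonempty ((NCTorus.dga θ).fundamentalGroup p ≅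
        algebraicHull (Multiplicative (ℝ × ℝ))) := by
  have hZ := NCTorus.Forms.gradedCentre_eq hθ
  refine ⟨NCTorus.Alg.center_eq_bot hθ, NCTorus.Forms.centreZero_eq_bot hθ, ?_,
    NCTorus.Forms.linearIndependent_uForm_vForm, ⟨NCTorus.Forms.exterior θ,
      NCTorus.Forms.exterior_ι, NCTorus.Forms.exterior_injective, ?_, fun k => ?_⟩, ?_,
    NCTorus.Forms.nonempty_unique_basePoint hθ, fun p => ?_⟩
  · rw [hZ, NCTorus.Forms.invariants_eq]
  · rw [hZ, NCTorus.Forms.range_exterior]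
  · rw [hZ, NCTorus.Forms.map_exteriorPower]
  · intro w hw
    rw [hZ] at hw
    obtain ⟨a, rfl⟩ := hw
    exact NCTorus.Forms.d_const a
  · let e : (NCTorus.dga θ).fundamentalGroup p ≅ algebraicHull (Multiplicative (ℝ × ℝ)) :=
      (FlatBimodule.correspondence (NCTorus.frame hθ) p).autGroupIso
    obtain ⟨H, ⟨i⟩⟩ := isAffineGroupScheme_algebraicHull (Multiplicative (ℝ × ℝ))
    exact ⟨⟨H, ⟨Functor.isoWhiskerRight e _ ≪≫ i⟩⟩, ⟨e⟩⟩
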